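/- Let $k\ge 0$ and let $\Gamma^k$ be the fundamental solution in $\mathbb R^2$: $\Gamma^k(x,y)=-\frac i4H_0^{(1)}(k|x-y|)$ for $k>0$ and $\Gamma^0(x,y)=\frac1{2\pi}\ln|x-y|$. Let $D\subset\mathbb R^2$ be a bounded simply connected domain whose boundary is a simple closed curve of class $C^2$, with outward unit normal $\nu$ and signed curvature $\tau$, defined by $\frac{d^2}{dt^2}x(t)=-\tau\,\nu_{x(t)}$ for a parametrization $x(t)$ of $\partial D$ by arc length. For a density $\phi$ on $\partial D$ put $$\mathcal S_D^k[\phi](x)=\int_{\partial D}\Gamma^k(x,y)\phi(y)\,d\sigma(y),\qquad \mathcal D_D^k[\phi](x)=\int_{\partial D}\frac{\partial\Gamma^k(x,y)}{\partial\nu_y}\phi(y)\,d\sigma(y),\qquad (\mathcal K_D^k)^*[\phi](x)=\int_{\partial D}\frac{\partial\Gamma^k(x,y)}{\partial\nu_x}\phi(y)\,d\sigma(y).$$ For small $\epsilon>0$ let $D_d=D\cup\{x+s\nu_x: x\in\partial D,\ 0\le s<\epsilon\}$, with boundary $\partial D_d=p(\partial D)$, where $p(x)=x+\epsilon\nu_x$;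 write $\widetilde x=p(x)$ and $\widetilde\phi=\phi\circ p^{-1}$, and let $(\mathcal K_{D_d}^k)^*$ be the operator defined as above with $D_d$, its outward unit normal and its arc length in place of those of $D$. Then there is a map $\mathcal K_1^k$ from $L^2(\partial D)$ to itself, not depending on $\epsilon$, such that for every $\phi\in L^2(\partial D)$ one has $(\mathcal K_D^k)^*[\phi]\in L^2(\partial D)$, the function $x\mapsto(\mathcal K_{D_d}^k)^*[\widetilde\phi](\widetilde x)$ is in $L^2(\partial D)$ for all sufficiently small $\epsilon>0$, and $$(\mathcal K_{D_d}^k)^*[\widetilde\phi](\widetilde x)=(\mathcal K_D^k)^*[\phi](x)+\epsilon\,\mathcal K_1^k[\phi](x)+o(\epsilon)\qquad(\epsilon\to0^+),$$ where $o(\epsilon)$ means that, for this fixed $\phi$, the $L^2(\partial D)$ norm of the remainder divided by $\epsilon$ tends to $0$. Moreover $$\mathcal K_1^k[\phi]=(\mathcal K_D^k)^*[\tau\phi]-\tau\,(\mathcal K_D^k)^*[\phi]+\frac{\partial\mathcal D_D^k[\phi]}{\partial\nu}-\frac{\partial^2}{\partial T^2}\mathcal S_D^k[\phi]-k^2\mathcal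 S_D^k[\phi]$$ as distributions on $\partial D$ (tested against $C^2$ functions of arc length). Here $\frac{\partial^2}{\partial T^2}$ is the second tangential derivative, that is, the second derivative with respect to arc length, in the sense of distributions, and $\frac{\partial\mathcal D_D^k[\phi]}{\partial\nu}$ is the limit as $s\to0$, in the sense of distributions on $\partial D$, of $x\mapsto\nu_x\cdot\nabla\mathcal D_D^k[\phi](x+s\nu_x)$; part of the claim is that this limit exists and is the same from outside ($s>0$) and from inside ($s<0$). -/

import Mathlib

open Filter Topology MeasureTheory

/-- The Euclidean plane. -/
abbrev Plane : Type := EuclideanSpace ℝ (Fin 2)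

noncomputable section

/-! ### Fundamental solutions -/

/-- The Bessel function of the first kind of order zero,
`J₀(z) = ∑ (-1)^m / (m!)^2 * (z/2)^(2m)`. -/
def besselJZero (z : ℝ) : ℝ :=
  ∑' m : ℕ, (-1 : ℝ) ^ m / (m.factorial : ℝ) ^ 2 * (z / 2) ^ (2 * m)

/-- The Bessel function of the second kind of order zero, for `z > 0`:
`Y₀(z) = (2/π) (log (z/2) + γ) J₀(z) - (2/π) ∑ (-1)^m h_m / (m!)^2 * (z/2)^(2m)`, where `γ` is
Euler's constant and `h_m = 1 + 1/2 + ⋯ + 1/m`. -/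
def besselYZero (z : ℝ) : ℝ :=
  2 / Real.pi * (Real.log (z / 2) + Real.eulerMascheroniConstant) * besselJZero z -
    2 / Real.pi *
      ∑' m : ℕ, (-1 : ℝ) ^ m * (harmonic m : ℝ) / (m.factorial : ℝ) ^ 2 * (z / 2) ^ (2 * m)

/-- The Hankel function of the first kind of order zero, `H₀ = J₀ + i Y₀`. -/
def hankelZero (z : ℝ) : ℂ :=
  (besselJZero z : ℂ) + Complex.I * (besselYZero z : ℂ)

/-- The fundamental solution of the Helmholtz (`k > 0`) and Laplace (`k = 0`) equations in the
plane. -/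
def fundSol (k : ℝ) (x y : Plane) : ℂ :=
  if k = 0 then ((1 / (2 * Real.pi) * Real.log ‖x - y‖ : ℝ) : ℂ)
  else -(Complex.I / 4) * hankelZero (k * ‖x - y‖)

/-! ### Planar domains -/

/-- `n` is the outward unit normal of the set `Ω` at the point `x`: near `x`, every open cone
strictly inside the half plane `⟪y - x, n⟫ < 0` lies in `Ω`, and every open cone strictly inside
the half plane `⟪y - x, n⟫ > 0` lies outside `Ω`.  There is at most one such `n`; for a domain
with `C¹` boundary it is the usual outward unit normal. -/
def IsOutwardUnitNormal (Ω : Set Plane) (x n : Plane) : Prop :=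
  ‖n‖ = 1 ∧ ∀ c : ℝ, 0 < c → ∀ᶠ y in 𝓝 x,
    (inner ℝ (y - x) n < -(c * ‖y - x‖) → y ∈ Ω) ∧
    (c * ‖y - x‖ < inner ℝ (y - x) n → y ∉ Ω)

open Classical in
/-- The outward unit normal of `Ω` at `x` (with the value `0` where there is none). -/
def outwardNormal (Ω : Set Plane) (x : Plane) : Plane :=
  if h : ∃ n, IsOutwardUnitNormal Ω x n then h.choose else 0

/-- `D` is a bounded domain whose boundary is one simple closed curve of class `C²` with `D`
locally on one side of it (equivalently, `D` is a bounded simply connected domain with boundary of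
class `C²`), and `γ` is a parametrization of `∂D` by arc length, `L` being the length of `∂D`. -/
structure IsC2Domain (D : Set Plane) (L : ℝ) (γ : ℝ → Plane) : Prop where
  isOpen : IsOpen D
  isConnected : IsConnected D
  isBounded : Bornology.IsBounded D
  length_pos : 0 < L
  contDiff : ContDiff ℝ 2 γ
  norm_deriv : ∀ t, ‖deriv γ t‖ = 1
  periodic : Function.Periodic γ L
  injOn : Set.InjOn γ (Set.Ico 0 L)
  range_eq : Set.range γ = frontier D
  exists_normal : ∀ x ∈ frontier D, ∃ n, IsOutwardUnitNormal D x n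

/-- The signed curvature `τ` of `∂D` at the point `x = γ t`, `γ` being a parametrization of `∂D`
by arc length: `γ'' t = - τ(x) ν_x`, that is, `τ(x) = - ⟪γ'' t, ν_x⟫`. -/
def signedCurvature (D : Set Plane) (γ : ℝ → Plane) (x : Plane) : ℝ :=
  -inner ℝ (deriv (deriv γ) (Function.invFun γ x)) (outwardNormal D x)

/-- The map `p(x) = x + ε ν_x` from `∂D` to `∂D_d`. -/
def offsetMap (D : Set Plane) (ε : ℝ) (x : Plane) : Plane :=
  x + ε • outwardNormal D x

/-- The coated domain `D_d`: the domain `D` together with the layer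
`{x + s ν_x : x ∈ ∂D, 0 ≤ s < ε}` of thickness `ε`. -/
def coatedDomain (D : Set Plane) (ε : ℝ) : Set Plane :=
  D ∪ {z | ∃ x ∈ frontier D, ∃ s : ℝ, 0 ≤ s ∧ s < ε ∧ z = x + s • outwardNormal D x}

/-- The transported density `φ̃ = φ ∘ p⁻¹` on `∂D_d`. -/
def transportDensity (D : Set Plane) (ε : ℝ) (φ : Plane → ℂ) (y : Plane) : ℂ :=
  φ (Function.invFunOn (offsetMap D ε) (frontier D) y)

/-! ### Integration along closed curves and layer potentials

A boundary is given by a closed curve `c`, run through once on `[0, L]`; integrals with respect to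
`dσ` are line integrals with respect to arc length. -/

/-- The line integral `∫ f dσ` along the curve `c` on `[0, L]`. -/
def arcIntegral (L : ℝ) (c : ℝ → Plane) (f : Plane → ℂ) : ℂ :=
  ∫ t in (0 : ℝ)..L, (‖deriv c t‖ : ℂ) * f (c t)

/-- The single layer potential `S^k[φ](x) = ∫ Γ^k(x, y) φ(y) dσ(y)`. -/
def singleLayer (k L : ℝ) (c : ℝ → Plane) (φ : Plane → ℂ) (x : Plane) : ℂ :=
  arcIntegral L c fun y => fundSol k x y * φ y

/-- The double layer potential `D^k[φ](x) = ∫ ∂Γ^k(x, y)/∂ν_y φ(y) dσ(y)` of the domain `Ω` whose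
boundary is the curve `c`. -/
def doubleLayer (k : ℝ) (Ω : Set Plane) (L : ℝ) (c : ℝ → Plane) (φ : Plane → ℂ) (x : Plane) : ℂ :=
  arcIntegral L c fun y => fderiv ℝ (fun z => fundSol k x z) y (outwardNormal Ω y) * φ y

/-- The Neumann–Poincaré operator `(K^k)^*[φ](x) = ∫ ∂Γ^k(x, y)/∂ν_x φ(y) dσ(y)` of the domain `Ω`
whose boundary is the curve `c`. -/
def neumannPoincare (k : ℝ) (Ω : Set Plane) (L : ℝ) (c : ℝ → Plane) (φ : Plane → ℂ)
    (x : Plane) : ℂ :=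
  arcIntegral L c fun y => fderiv ℝ (fun z => fundSol k z y) x (outwardNormal Ω x) * φ y

/-- The operator `(K^k_{D_d})^*` on `∂D_d`, the boundary `∂D_d` being the curve `t ↦ p(γ t)`. -/
def coatedNeumannPoincare (k : ℝ) (D : Set Plane) (L : ℝ) (γ : ℝ → Plane) (ε : ℝ)
    (φ : Plane → ℂ) (x : Plane) : ℂ :=
  neumannPoincare k (coatedDomain D ε) L (fun t => offsetMap D ε (γ t)) φ x

/-! ### Square integrable functions and distributions on `∂D`

`γ` is a parametrization of `∂D` by arc length, so that `dσ = dt`. -/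

/-- The `L²(∂D)` norm. -/
def boundaryL2Norm (L : ℝ) (γ : ℝ → Plane) (u : Plane → ℂ) : ENNReal :=
  eLpNorm (fun t => u (γ t)) 2 (volume.restrict (Set.Ioc 0 L))

/-- Membership in `L²(∂D)`. -/
def MemBoundaryL2 (L : ℝ) (γ : ℝ → Plane) (u : Plane → ℂ) : Prop :=
  MemLp (fun t => u (γ t)) 2 (volume.restrict (Set.Ioc 0 L))

/-- Test functions on `∂D`, as functions of arc length. -/
structure IsBoundaryTest (L : ℝ) (ψ : ℝ → ℂ) : Prop where
  contDiff : ContDiff ℝ 2 ψ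
  periodic : Function.Periodic ψ L

/-- The distribution on `∂D` given by a function `u` on `∂D`: `ψ ↦ ∫ u ψ dσ`. -/
def boundaryPairing (L : ℝ) (γ : ℝ → Plane) (u : Plane → ℂ) (ψ : ℝ → ℂ) : ℂ :=
  ∫ t in (0 : ℝ)..L, u (γ t) * ψ t

/-- The second tangential derivative `∂²u/∂T²` (the second derivative with respect to arc length)
of a function `u` on `∂D`, as a distribution: `ψ ↦ ∫ u ∂²ψ/∂T² dσ`. -/
def secondTangentialDeriv (L : ℝ) (γ : ℝ → Plane) (u : Plane → ℂ) (ψ : ℝ → ℂ) : ℂ :=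
  boundaryPairing L γ u (deriv (deriv ψ))

/-- The distribution `F` on `∂D` is the normal derivative `∂u/∂ν` on `∂D` of a function `u` on
the complement of `∂D`: the limit, from outside (`s > 0`) and from inside (`s < 0`), of
`x ↦ ν_x · ∇u(x + s ν_x)` in the sense of distributions. -/
def IsNormalDeriv (D : Set Plane) (L : ℝ) (γ : ℝ → Plane) (u : Plane → ℂ)
    (F : (ℝ → ℂ) → ℂ) : Prop :=
  ∀ ψ, IsBoundaryTest L ψ →
    Tendsto
      (fun s : ℝ => boundaryPairing L γ
        (fun x => fderiv ℝ u (x + s • outwardNormal D x) (outwardNormal D x)) ψ)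
      (𝓝[≠] 0) (𝓝 (F ψ))

end

/-!
The fundamental solution is `Γ(x, y) = G (|x - y|²)`, where `G` is smooth on `(0, ∞)`, has a
logarithmic singularity and solves an ordinary differential equation
(`exists_isRadialSolution`, from the power series of `J₀` and `Y₀`). So all kernels are explicit:
`radialGrad` and `radialHess` are the first two derivatives of `x ↦ G (|x|²)`. The boundary is a
curve `γ` parametrized by arc length, with an orthonormal frame `T = γ'`, `n = ν` such that
`T' = -τ n` and `n' = τ T` (`IsC2Domain.isArcFrame_outwardNormal`), and `(t, s) ↦ γ t + s n t`
parametrizes a neighbourhood of it, with quantitative estimates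
(`IsArcFrame.exists_tube`). In particular the coated domain has the same normals as `D`, and its
boundary has the arc length element `(1 + ε τ) dt`.

*The expansion.* With `Y = γ t - γ u + ε (n t - n u)`, the kernel of the Neumann–Poincaré operator of
the coated domain is `(1 + ε τ u) ∇G(|Y|²) · n t`. On a curve of class `C²` the quantities
`Y · n t`, `Y · (n t - n u)` and `n t · (n t - n u)` are `O(|Y|²)`, which makes the kernel and its
derivative in `ε` bounded, uniformly in `ε`. Hence its difference quotients converge boundedly, and
the operators converge strongly in `L²` (`tendsto_coatedKernel_expansion`). The first-order operator
has the kernel `τ u ∂G/∂ν_t + ∇²G(n t, n t - n u)`.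

*The formula.* The first part of this kernel gives `K*[τ φ]`. For the second part let
`H(a, b) = ∇²G(a, b)` at `x = γ t + s n t - γ u`. The normal derivative of the double layer potential
has the kernel `-H(n t, n u)`, and since the pairs `(T, n)` differ by rotations, the Helmholtz
equation gives `H(n t, n u) = -k² G T t · T u - H(T t, T u)` (`IsRadialSolution.radialHess_normal`).
For `s ≠ 0` everything is smooth, and `(1 + s τ t) H(T t, T u)` is the derivative in `t` of
`∇G · T u`. As `τ` is only continuous, the factor `1 + s τ` cannot be moved to the test function `ψ`
when integrating by parts; instead `s τ u ψ u` times a total derivative is subtracted. This leaves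
(`integral_hyperKernel`) a part with an integrable majorant, in which `∇G · T u` is further split into
`∇G · (T u - T t)`, which is bounded, and `∇G · T t`, which is integrated by parts again, and a
part bounded by the Poisson kernel `|s| / (s² + c (t - u)²)` times a continuous function vanishing at
`t = u`, which tends to zero. So the limit exists and is the same from both sides
(`tendsto_integral_hyperKernel`); integrating `∇G · (T u - T t)` by parts back on the boundary
itself, where this function is continuous across the diagonal, identifies the limit
(`integral_regularPart_zero`). By Fubini's theorem, `∂D[φ]/∂ν` is the operator with kernel
`∇²G(n t, n t - n u) + τ t ∂G/∂ν_t`, plus `∂²S[φ]/∂T² + k² S[φ]`, which is the assertion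
(`IsC2Domain.boundaryPairing_firstOrderOperator`).
-/

noncomputable section

/-! ### The fundamental solution as a function of the squared distance -/

/-- The entire function with coefficients `c`. -/
def entireSeries (c : ℕ → ℝ) (w : ℝ) : ℝ := ∑' m, c m * w ^ m

/-- The coefficients of the derivative of the power series with coefficients `c`. -/
def derivCoeff (c : ℕ → ℝ) (m : ℕ) : ℝ := (m + 1 : ℝ) * c (m + 1)

theorem abs_derivCoeff_le {c : ℕ → ℝ} {K : ℝ} (hc : ∀ m, |c m| ≤ K / (m.factorial : ℝ)) (m : ℕ) :
    |derivCoeff c m| ≤ K / (m.factorial : ℝ) := by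
  rw [derivCoeff, abs_mul, abs_of_nonneg (by positivity : (0 : ℝ) ≤ m + 1)]
  calc (m + 1 : ℝ) * |c (m + 1)| ≤ (m + 1) * (K / ((m + 1).factorial : ℝ)) := by
        gcongr; exact hc (m + 1)
    _ = K / (m.factorial : ℝ) := by
      rw [Nat.factorial_succ]; push_cast; field_simp

theorem summable_of_le_factorial {c : ℕ → ℝ} {K : ℝ} (hc : ∀ m, |c m| ≤ K / (m.factorial : ℝ))
    (w : ℝ) : Summable fun m => c m * w ^ m := by
  refine Summable.of_norm_bounded ((Real.summable_pow_div_factorial |w|).mul_left K) ?_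
  intro m
  rw [Real.norm_eq_abs, abs_mul, abs_pow]
  calc |c m| * |w| ^ m ≤ K / (m.factorial : ℝ) * |w| ^ m := by gcongr; exact hc m
    _ = _ := by ring

/-- A sum of a power series whose coefficients are `O(1/m!)` may be differentiated termwise; the
coefficients of the derivative satisfy the same bound. -/
theorem hasDerivAt_entireSeries {c : ℕ → ℝ} {K : ℝ}
    (hc : ∀ m, |c m| ≤ K / (m.factorial : ℝ)) (w : ℝ) :
    HasDerivAt (entireSeries c) (entireSeries (derivCoeff c) w) w := by
  have hK : 0 ≤ K := by simpa using (abs_nonneg _).trans (hc 0)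
  set R : ℝ := |w| + 1 with hR
  have hR0 : 0 < R := by positivity
  have hs : Summable fun m : ℕ => K * (R ^ m / (m.factorial : ℝ)) :=
    (Real.summable_pow_div_factorial R).mul_left K
  have hg : ∀ m : ℕ, ∀ y : ℝ, HasDerivAt (fun y : ℝ => c (m + 1) * y ^ (m + 1))
      ((m + 1 : ℝ) * c (m + 1) * y ^ m) y := by
    intro m y
    refine ((hasDerivAt_pow (m + 1) y).const_mul (c (m + 1))).congr_deriv ?_
    simp only [Nat.add_sub_cancel]
    push_cast; ring
  have hsum := summable_of_le_factorial hc
  have h := hasDerivAt_tsum_of_isPreconnected (𝕜 := ℝ)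
    (u := fun m : ℕ => K * (R ^ m / (m.factorial : ℝ)))
    (g := fun m y => c (m + 1) * y ^ (m + 1)) (g' := fun m y => (m + 1 : ℝ) * c (m + 1) * y ^ m)
    (t := Metric.ball 0 R) (y₀ := w) (y := w) hs Metric.isOpen_ball
    (convex_ball (0 : ℝ) R).isPreconnected (fun m y _ => hg m y) ?_ ?_
    ((summable_nat_add_iff 1).2 (hsum w)) ?_
  · refine (h.const_add (c 0)).congr_of_eventuallyEq (Eventually.of_forall fun y => ?_)
    rw [entireSeries, (hsum y).tsum_eq_zero_add]; simp
  · intro m y hy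
    have hy' : |y| ≤ R := by simpa using (mem_ball_zero_iff.1 hy).le
    rw [Real.norm_eq_abs, abs_mul, abs_pow]
    calc _ ≤ K / (m.factorial : ℝ) * R ^ m := by gcongr; exact abs_derivCoeff_le hc m
      _ = _ := by ring
  · simp [hR]
  · simp [hR]

/-- The data and estimates of a radial fundamental solution `x ↦ G (|x|²)` of the Helmholtz
equation in the plane: `G₁`, `G₂` are the first two derivatives of `G` on `(0, ∞)`. The bounds near
`0` are those of a logarithm; any power `ρ ^ (-c)` with `c < 1/2` would do for `G` itself, as it
becomes `|x| ^ (-2 c)`, which is integrable along curves. -/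
structure IsRadialSolution (k : ℝ) (G G₁ G₂ : ℝ → ℂ) : Prop where
  hasDerivAt : ∀ ρ, 0 < ρ → HasDerivAt G (G₁ ρ) ρ
  hasDerivAt₁ : ∀ ρ, 0 < ρ → HasDerivAt G₁ (G₂ ρ) ρ
  continuousOn₂ : ContinuousOn G₂ (Set.Ioi 0)
  helmholtz : ∀ ρ : ℝ, 0 < ρ → 4 * ρ * G₂ ρ + 4 * G₁ ρ + (k : ℂ) ^ 2 * G ρ = 0
  measurable : Measurable G
  measurable₁ : Measurable G₁
  measurable₂ : Measurable G₂
  bound : ∀ M : ℝ, ∃ C : ℝ, 0 ≤ C ∧ ∀ ρ, 0 < ρ → ρ ≤ M →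
    ‖G ρ‖ ≤ C * ρ ^ (-(1 / 4) : ℝ) ∧ ‖G₁ ρ‖ ≤ C / ρ ∧ ‖G₂ ρ‖ ≤ C / ρ ^ 2

theorem exists_norm_le_on_Icc {a : ℝ → ℂ} (ha : Continuous a) (M : ℝ) :
    ∃ C : ℝ, 0 ≤ C ∧ ∀ ρ ∈ Set.Icc (0 : ℝ) M, ‖a ρ‖ ≤ C := by
  obtain ⟨C, hC⟩ := (isCompact_Icc (a := (0 : ℝ)) (b := M)).exists_bound_of_continuousOn
    ha.continuousOn
  exact ⟨max C 0, le_max_right _ _, fun ρ hρ => (hC ρ hρ).trans (le_max_left _ _)⟩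

/-- `ρ ^ (1/4) * log ρ` is bounded on bounded subsets of `(0, ∞)`. -/
theorem exists_abs_log_le_rpow (M : ℝ) :
    ∃ C : ℝ, 0 ≤ C ∧ ∀ ρ, 0 < ρ → ρ ≤ M → |Real.log ρ| ≤ C * ρ ^ (-(1 / 4) : ℝ) := by
  refine ⟨4 + M ^ 2, by positivity, fun ρ h0 hM => ?_⟩
  have hp : (0 : ℝ) < ρ ^ (1 / 4 : ℝ) := Real.rpow_pos_of_pos h0 _
  rw [Real.rpow_neg h0.le, ← div_eq_mul_inv, le_div_iff₀ hp]
  rcases le_total ρ 1 with h1 | h1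
  · have := Real.abs_log_mul_self_rpow_lt ρ (1 / 4) h0 h1 (by norm_num)
    rw [abs_mul, abs_of_pos hp] at this
    nlinarith [sq_nonneg M]
  · have h2 : |Real.log ρ| ≤ ρ := by
      rw [abs_of_nonneg (Real.log_nonneg h1)]
      linarith [Real.log_le_sub_one_of_pos h0]
    have h3 : ρ ^ (1 / 4 : ℝ) ≤ ρ := by
      calc ρ ^ (1 / 4 : ℝ) ≤ ρ ^ (1 : ℝ) := Real.rpow_le_rpow_of_exponent_le h1 (by norm_num)
        _ = ρ := Real.rpow_one ρ
    calc |Real.log ρ| * ρ ^ (1 / 4 : ℝ) ≤ ρ * ρ := by gcongr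
      _ ≤ 4 + M ^ 2 := by nlinarith

/-- A function `a(ρ) log ρ + e(ρ)` with twice differentiable coefficients has the regularity and
the estimates required of a radial fundamental solution. -/
theorem isRadialSolution_of_log {k : ℝ} {a a₁ a₂ e e₁ e₂ : ℝ → ℂ}
    (ha : ∀ ρ, HasDerivAt a (a₁ ρ) ρ) (ha₁ : ∀ ρ, HasDerivAt a₁ (a₂ ρ) ρ) (ha₂ : Continuous a₂)
    (he : ∀ ρ, HasDerivAt e (e₁ ρ) ρ) (he₁ : ∀ ρ, HasDerivAt e₁ (e₂ ρ) ρ) (he₂ : Continuous e₂)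
    (hode : ∀ ρ : ℝ, 4 * ρ * a₂ ρ + 4 * a₁ ρ + (k : ℂ) ^ 2 * a ρ = 0)
    (hode' : ∀ ρ : ℝ, 4 * ρ * e₂ ρ + 4 * e₁ ρ + (k : ℂ) ^ 2 * e ρ = -8 * a₁ ρ) :
    IsRadialSolution k (fun ρ => a ρ * (Real.log ρ : ℂ) + e ρ)
      (fun ρ => a₁ ρ * (Real.log ρ : ℂ) + a ρ * ((ρ⁻¹ : ℝ) : ℂ) + e₁ ρ)
      (fun ρ => a₂ ρ * (Real.log ρ : ℂ) + 2 * a₁ ρ * ((ρ⁻¹ : ℝ) : ℂ)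
        - a ρ * ((ρ⁻¹ : ℝ) : ℂ) ^ 2 + e₂ ρ) := by
  have ca : Continuous a := continuous_iff_continuousAt.2 fun ρ => (ha ρ).continuousAt
  have ca₁ : Continuous a₁ := continuous_iff_continuousAt.2 fun ρ => (ha₁ ρ).continuousAt
  have ce : Continuous e := continuous_iff_continuousAt.2 fun ρ => (he ρ).continuousAt
  have ce₁ : Continuous e₁ := continuous_iff_continuousAt.2 fun ρ => (he₁ ρ).continuousAt
  have hlog : ∀ ρ : ℝ, 0 < ρ → HasDerivAt (fun ρ : ℝ => (Real.log ρ : ℂ)) ((ρ⁻¹ : ℝ) : ℂ) ρ :=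
    fun ρ hρ => (Real.hasDerivAt_log hρ.ne').ofReal_comp
  have hinv : ∀ ρ : ℝ, 0 < ρ →
      HasDerivAt (fun ρ : ℝ => ((ρ⁻¹ : ℝ) : ℂ)) (-((ρ⁻¹ : ℝ) : ℂ) ^ 2) ρ := by
    intro ρ hρ
    refine (hasDerivAt_inv hρ.ne').ofReal_comp.congr_deriv ?_
    push_cast; simp
  have mlog : Measurable fun ρ : ℝ => (Real.log ρ : ℂ) :=
    Complex.measurable_ofReal.comp Real.measurable_log
  have minv : Measurable fun ρ : ℝ => ((ρ⁻¹ : ℝ) : ℂ) :=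
    Complex.measurable_ofReal.comp measurable_inv
  refine ⟨?_, ?_, ?_, ?_, ?_, ?_, ?_, ?_⟩
  · intro ρ hρ
    exact ((ha ρ).mul (hlog ρ hρ)).add (he ρ)
  · intro ρ hρ
    refine ((((ha₁ ρ).mul (hlog ρ hρ)).add ((ha ρ).mul (hinv ρ hρ))).add (he₁ ρ)).congr_deriv ?_
    ring
  · have c1 : ContinuousOn (fun ρ : ℝ => (Real.log ρ : ℂ)) (Set.Ioi 0) :=
      fun ρ hρ => (hlog ρ hρ).continuousAt.continuousWithinAt
    have c2 : ContinuousOn (fun ρ : ℝ => ((ρ⁻¹ : ℝ) : ℂ)) (Set.Ioi 0) :=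
      fun ρ hρ => (hinv ρ hρ).continuousAt.continuousWithinAt
    have := ca.continuousOn (s := Set.Ioi 0)
    have := ca₁.continuousOn (s := Set.Ioi 0)
    have := ha₂.continuousOn (s := Set.Ioi 0)
    have := he₂.continuousOn (s := Set.Ioi 0)
    fun_prop
  · intro ρ hρ
    have h : (ρ : ℂ) * ((ρ⁻¹ : ℝ) : ℂ) = 1 := by
      rw [← Complex.ofReal_mul, mul_inv_cancel₀ hρ.ne', Complex.ofReal_one]
    linear_combination (Real.log ρ : ℂ) * hode ρ + hode' ρ
      + (8 * a₁ ρ - 4 * a ρ * ((ρ⁻¹ : ℝ) : ℂ)) * h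
  · exact (ca.measurable.mul mlog).add ce.measurable
  · exact ((ca₁.measurable.mul mlog).add (ca.measurable.mul minv)).add ce₁.measurable
  · exact (((ha₂.measurable.mul mlog).add ((ca₁.measurable.const_mul 2).mul minv)).sub
      (ca.measurable.mul (minv.pow_const 2))).add he₂.measurable
  · intro M
    obtain ⟨A, hA0, hA⟩ := exists_norm_le_on_Icc ca M
    obtain ⟨A₁, hA₁0, hA₁⟩ := exists_norm_le_on_Icc ca₁ M
    obtain ⟨A₂, hA₂0, hA₂⟩ := exists_norm_le_on_Icc ha₂ M
    obtain ⟨E, hE0, hE⟩ := exists_norm_le_on_Icc ce M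
    obtain ⟨E₁, hE₁0, hE₁⟩ := exists_norm_le_on_Icc ce₁ M
    obtain ⟨E₂, hE₂0, hE₂⟩ := exists_norm_le_on_Icc he₂ M
    obtain ⟨Λ, hΛ0, hΛ⟩ := exists_abs_log_le_rpow M
    -- `N` bounds `ρ`, so that `1`, `1/ρ` and `ρ^(-1/4)` can be compared on `(0, M]`
    set N := |M| + 1 with hN
    have hN1 : 1 ≤ N := by simp [hN]
    have hq : ∀ ρ, 0 < ρ → ρ ≤ M → 1 ≤ N * ρ ^ (-(1 / 4) : ℝ) ∧
        ρ ^ (-(1 / 4) : ℝ) ≤ N / ρ ∧ 1 ≤ N / ρ := by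
      intro ρ h0 hM
      have hρN : ρ ≤ N := hM.trans ((le_abs_self M).trans (by simp [hN]))
      have hp : (0 : ℝ) < ρ ^ (1 / 4 : ℝ) := Real.rpow_pos_of_pos h0 _
      refine ⟨?_, ?_, ?_⟩
      · rw [Real.rpow_neg h0.le, ← div_eq_mul_inv, le_div_iff₀ hp, one_mul]
        calc ρ ^ (1 / 4 : ℝ) ≤ N ^ (1 / 4 : ℝ) := by gcongr
          _ ≤ N ^ (1 : ℝ) := Real.rpow_le_rpow_of_exponent_le hN1 (by norm_num)
          _ = N := Real.rpow_one N
      · rw [le_div_iff₀ h0]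
        calc ρ ^ (-(1 / 4) : ℝ) * ρ = ρ ^ (-(1 / 4) : ℝ) * ρ ^ (1 : ℝ) := by rw [Real.rpow_one]
          _ = ρ ^ (3 / 4 : ℝ) := by rw [← Real.rpow_add h0]; norm_num
          _ ≤ N ^ (3 / 4 : ℝ) := by gcongr
          _ ≤ N ^ (1 : ℝ) := Real.rpow_le_rpow_of_exponent_le hN1 (by norm_num)
          _ = N := Real.rpow_one N
      · rw [le_div_iff₀ h0]; linarith
    refine ⟨(A * Λ + E * N) + (A₁ * Λ * N + A + E₁ * N) +
      (A₂ * Λ * N ^ 2 + 2 * A₁ * N + A + E₂ * N ^ 2), by positivity, fun ρ h0 hM => ?_⟩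
    obtain ⟨q1, q2, q3⟩ := hq ρ h0 hM
    have hm : ρ ∈ Set.Icc (0 : ℝ) M := ⟨h0.le, hM⟩
    have hl := hΛ ρ h0 hM
    have hi : (0 : ℝ) < ρ⁻¹ := inv_pos.2 h0
    set p := ρ ^ (-(1 / 4) : ℝ) with hp
    have hp0 : 0 < p := Real.rpow_pos_of_pos h0 _
    have nl : ‖(Real.log ρ : ℂ)‖ = |Real.log ρ| := by simp
    have ni : ‖((ρ⁻¹ : ℝ) : ℂ)‖ = ρ⁻¹ := by rw [Complex.norm_real, Real.norm_of_nonneg hi.le]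
    have q1' : |Real.log ρ| ≤ Λ * N * ρ⁻¹ := by
      refine hl.trans ?_
      rw [mul_assoc, ← div_eq_mul_inv]; gcongr
    have q3' : 1 ≤ N * ρ⁻¹ := by rwa [← div_eq_mul_inv]
    have q4 : N * ρ⁻¹ ≤ N ^ 2 * ρ⁻¹ ^ 2 := by nlinarith
    refine ⟨?_, ?_, ?_⟩
    · calc ‖a ρ * (Real.log ρ : ℂ) + e ρ‖ ≤ ‖a ρ‖ * |Real.log ρ| + ‖e ρ‖ * 1 := by
            refine (norm_add_le _ _).trans ?_
            rw [norm_mul, nl, mul_one]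
        _ ≤ A * (Λ * p) + E * (N * p) := by gcongr; exacts [hA ρ hm, hE ρ hm]
        _ = (A * Λ + E * N) * p := by ring
        _ ≤ _ := by
          refine mul_le_mul_of_nonneg_right ?_ (by positivity)
          have : 0 ≤ A₁ * Λ * N + A + E₁ * N := by positivity
          have : 0 ≤ A₂ * Λ * N ^ 2 + 2 * A₁ * N + A + E₂ * N ^ 2 := by positivity
          linarith
    · rw [div_eq_mul_inv]
      calc _ ≤ ‖a₁ ρ‖ * |Real.log ρ| + ‖a ρ‖ * ρ⁻¹ + ‖e₁ ρ‖ * 1 := by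
            refine (norm_add₃_le ).trans ?_
            rw [norm_mul, norm_mul, nl, ni, mul_one]
        _ ≤ A₁ * (Λ * N * ρ⁻¹) + A * ρ⁻¹ + E₁ * (N * ρ⁻¹) := by
            gcongr; exacts [hA₁ ρ hm, hA ρ hm, hE₁ ρ hm]
        _ = (A₁ * Λ * N + A + E₁ * N) * ρ⁻¹ := by ring
        _ ≤ _ := by
          refine mul_le_mul_of_nonneg_right ?_ (by positivity)
          have : 0 ≤ A * Λ + E * N := by positivity
          have : 0 ≤ A₂ * Λ * N ^ 2 + 2 * A₁ * N + A + E₂ * N ^ 2 := by positivity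
          linarith
    · rw [div_eq_mul_inv, ← inv_pow]
      calc _ ≤ ‖a₂ ρ‖ * |Real.log ρ| + 2 * ‖a₁ ρ‖ * ρ⁻¹ + ‖a ρ‖ * ρ⁻¹ ^ 2 + ‖e₂ ρ‖ * 1 := by
            refine (norm_add_le _ _).trans ?_
            rw [mul_one]
            gcongr
            refine (norm_sub_le _ _).trans ?_
            refine (add_le_add_left (norm_add_le _ _) _).trans ?_
            simp only [norm_mul, norm_pow, nl, ni, Complex.norm_ofNat]
            exact le_rfl
        _ ≤ A₂ * (Λ * N * ρ⁻¹ * (N * ρ⁻¹)) + 2 * A₁ * ρ⁻¹ * (N * ρ⁻¹) + A * ρ⁻¹ ^ 2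
              + E₂ * (N ^ 2 * ρ⁻¹ ^ 2) := by
            have z1 : |Real.log ρ| ≤ Λ * N * ρ⁻¹ * (N * ρ⁻¹) :=
              q1'.trans (le_mul_of_one_le_right (by positivity) q3')
            have z2 : 2 * ‖a₁ ρ‖ * ρ⁻¹ ≤ 2 * A₁ * ρ⁻¹ * (N * ρ⁻¹) := by
              refine le_trans ?_ (le_mul_of_one_le_right (by positivity) q3')
              gcongr; exact hA₁ ρ hm
            gcongr
            exacts [hA₂ ρ hm, hA ρ hm, hE₂ ρ hm, q3'.trans q4]
        _ = (A₂ * Λ * N ^ 2 + 2 * A₁ * N + A + E₂ * N ^ 2) * ρ⁻¹ ^ 2 := by ring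
        _ ≤ _ := by
          refine mul_le_mul_of_nonneg_right ?_ (by positivity)
          have : 0 ≤ A * Λ + E * N := by positivity
          have : 0 ≤ A₁ * Λ * N + A + E₁ * N := by positivity
          linarith

/-- The Bessel differential operator `w S'' + S' + S` in terms of power series coefficients. -/
theorem entireSeries_bessel {c : ℕ → ℝ} {K : ℝ} (hc : ∀ m, |c m| ≤ K / (m.factorial : ℝ)) (w : ℝ) :
    w * entireSeries (derivCoeff (derivCoeff c)) w + entireSeries (derivCoeff c) w
      + entireSeries c w = entireSeries (fun m => (m + 1 : ℝ) ^ 2 * c (m + 1) + c m) w := by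
  have h1 := abs_derivCoeff_le hc
  have h2 := abs_derivCoeff_le h1
  have s0 := summable_of_le_factorial hc w
  have s1 := summable_of_le_factorial h1 w
  have s2 := summable_of_le_factorial h2 w
  have s3 : Summable fun m : ℕ => (m : ℝ) * derivCoeff c m * w ^ m := by
    refine (summable_nat_add_iff 1).1 ((s2.mul_left w).congr fun m => ?_)
    simp only [derivCoeff]; push_cast; ring
  have e2 : w * entireSeries (derivCoeff (derivCoeff c)) w
      = ∑' m : ℕ, (m : ℝ) * derivCoeff c m * w ^ m := by
    rw [s3.tsum_eq_zero_add, entireSeries, ← tsum_mul_left]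
    simp only [derivCoeff, Nat.cast_zero, zero_mul, zero_add]
    refine tsum_congr fun m => ?_
    push_cast; ring
  rw [e2]
  simp only [entireSeries]
  rw [← s3.tsum_add s1, ← (s3.add s1).tsum_add s0]
  refine tsum_congr fun m => ?_
  simp only [derivCoeff]; ring

/-- The coefficients of `J₀(2 √w)`. -/
def besselCoeff (m : ℕ) : ℝ := (-1) ^ m / (m.factorial : ℝ) ^ 2

/-- The coefficients of the entire part of `Y₀(2 √w)`. -/
def besselHarmonicCoeff (m : ℕ) : ℝ := (-1) ^ m * (harmonic m : ℝ) / (m.factorial : ℝ) ^ 2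

theorem abs_besselCoeff_le (m : ℕ) : |besselCoeff m| ≤ 1 / (m.factorial : ℝ) := by
  have h : (1 : ℝ) ≤ m.factorial := by exact_mod_cast m.factorial_pos
  rw [besselCoeff, abs_div, abs_pow, abs_neg, abs_one, one_pow, abs_of_nonneg (by positivity)]
  gcongr
  nlinarith

theorem abs_harmonic_le (m : ℕ) : |(harmonic m : ℝ)| ≤ m.factorial := by
  have h0 : ∀ m : ℕ, (0 : ℝ) ≤ harmonic m := by
    intro m
    rcases Nat.eq_zero_or_pos m with rfl | h
    · simp
    · exact_mod_cast (harmonic_pos h.ne').le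
  rw [abs_of_nonneg (h0 m)]
  have : (harmonic m : ℝ) ≤ m := by
    induction m with
    | zero => simp
    | succ m ih =>
      rw [harmonic_succ]; push_cast
      have : ((m : ℝ) + 1)⁻¹ ≤ 1 := inv_le_one_of_one_le₀ (by linarith [Nat.cast_nonneg (α := ℝ) m])
      linarith
  exact this.trans (by exact_mod_cast Nat.self_le_factorial m)

theorem abs_besselHarmonicCoeff_le (m : ℕ) :
    |besselHarmonicCoeff m| ≤ 1 / (m.factorial : ℝ) := by
  have h : (0 : ℝ) < m.factorial := by exact_mod_cast m.factorial_pos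
  rw [besselHarmonicCoeff, abs_div, abs_mul, abs_pow, abs_neg, abs_one, one_pow, one_mul,
    abs_of_nonneg (by positivity : (0 : ℝ) ≤ (m.factorial : ℝ) ^ 2),
    div_le_div_iff₀ (by positivity) h]
  nlinarith [abs_harmonic_le m]

theorem besselCoeff_succ (m : ℕ) : (m + 1 : ℝ) ^ 2 * besselCoeff (m + 1) = -besselCoeff m := by
  simp only [besselCoeff, Nat.factorial_succ]
  push_cast
  field_simp
  ring

theorem entireSeries_besselCoeff (w : ℝ) :
    w * entireSeries (derivCoeff (derivCoeff besselCoeff)) w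
      + entireSeries (derivCoeff besselCoeff) w + entireSeries besselCoeff w = 0 := by
  rw [entireSeries_bessel abs_besselCoeff_le]
  simp [entireSeries, besselCoeff_succ]

theorem entireSeries_besselHarmonicCoeff (w : ℝ) :
    w * entireSeries (derivCoeff (derivCoeff besselHarmonicCoeff)) w
      + entireSeries (derivCoeff besselHarmonicCoeff) w + entireSeries besselHarmonicCoeff w
      = entireSeries (derivCoeff besselCoeff) w := by
  rw [entireSeries_bessel abs_besselHarmonicCoeff_le]
  congr 1
  funext m
  have e : ∀ m, besselHarmonicCoeff m = besselCoeff m * harmonic m := fun m => by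
    simp only [besselHarmonicCoeff, besselCoeff]; ring
  have hm : (m + 1 : ℝ) ≠ 0 := by positivity
  rw [e, e, harmonic_succ, derivCoeff]
  push_cast
  linear_combination (harmonic m + ((m : ℝ) + 1)⁻¹) * besselCoeff_succ m
    - ((m : ℝ) + 1)⁻¹ * besselCoeff_succ m
    + (besselCoeff (m + 1) * (m + 1)) * (mul_inv_cancel₀ hm)

theorem hasDerivAt_scaled {c : ℕ → ℝ} {K : ℝ} (hc : ∀ m, |c m| ≤ K / (m.factorial : ℝ))
    (κ : ℝ) (ρ : ℝ) : HasDerivAt (fun ρ => (entireSeries c (κ * ρ) : ℂ))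
      (κ * entireSeries (derivCoeff c) (κ * ρ)) ρ := by
  have h := (hasDerivAt_entireSeries hc (κ * ρ)).comp ρ ((hasDerivAt_id ρ).const_mul κ)
  refine h.ofReal_comp.congr_deriv ?_
  push_cast; ring

theorem continuous_scaled {c : ℕ → ℝ} {K : ℝ} (hc : ∀ m, |c m| ≤ K / (m.factorial : ℝ))
    (κ : ℝ) : Continuous fun ρ : ℝ => (entireSeries c (κ * ρ) : ℂ) :=
  continuous_iff_continuousAt.2 fun ρ => (hasDerivAt_scaled hc κ ρ).continuousAt

/-- The fundamental solution is a function `G` of the squared distance; for `k > 0` the power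
series of the Bessel functions give `G(ρ) = a(ρ) log ρ + e(ρ)` with `a` and `e` entire. -/
theorem exists_isRadialSolution {k : ℝ} (hk : 0 ≤ k) : ∃ G G₁ G₂ : ℝ → ℂ,
    IsRadialSolution k G G₁ G₂ ∧ ∀ x y : Plane, x ≠ y → fundSol k x y = G (‖x - y‖ ^ 2) := by
  rcases hk.eq_or_lt with rfl | hk
  · have hz : ∀ c : ℂ, ∀ ρ : ℝ, HasDerivAt (fun _ : ℝ => c) 0 ρ := fun c ρ => hasDerivAt_const ρ c
    refine ⟨_, _, _, isRadialSolution_of_log (k := 0) (hz ((1 / (4 * Real.pi) : ℝ) : ℂ)) (hz 0)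
      continuous_const (hz 0) (hz 0) continuous_const (by simp) (by simp), fun x y _ => ?_⟩
    rw [fundSol, if_pos rfl, add_zero, ← Complex.ofReal_mul, Real.log_pow]
    congr 1
    push_cast
    field_simp
    ring
  · set κ : ℝ := k ^ 2 / 4 with hκ
    have hκ0 : 0 < κ := by positivity
    have A0 := abs_besselCoeff_le
    have A1 := abs_derivCoeff_le A0
    have A2 := abs_derivCoeff_le A1
    have B0 := abs_besselHarmonicCoeff_le
    have B1 := abs_derivCoeff_le B0
    have B2 := abs_derivCoeff_le B1
    set p : ℂ := ((1 / (4 * Real.pi) : ℝ) : ℂ) with hp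
    -- with `log (k r / 2) = (log κ + log r²) / 2` the coefficients are `a = p J`, `e = q J - 2 p Y`,
    -- where `J`, `Y` are the entire series in `J₀` and `Y₀`, in the variable `κ r²`
    set q : ℂ := ((1 / (4 * Real.pi) * Real.log κ
        + Real.eulerMascheroniConstant / (2 * Real.pi) : ℝ) : ℂ)
      - Complex.I / 4 with hq
    have hk2 : (k : ℂ) ^ 2 = 4 * κ := by rw [hκ]; push_cast; ring
    refine ⟨_, _, _, isRadialSolution_of_log (k := k)
      (fun ρ => (hasDerivAt_scaled A0 κ ρ).const_mul p)
      (fun ρ => ((hasDerivAt_scaled A1 κ ρ).const_mul (κ : ℂ)).const_mul p)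
      ((((continuous_scaled A2 κ).const_mul (κ : ℂ)).const_mul (κ : ℂ)).const_mul p)
      (fun ρ => ((hasDerivAt_scaled A0 κ ρ).const_mul q).sub
        ((hasDerivAt_scaled B0 κ ρ).const_mul (2 * p)))
      (fun ρ => (((hasDerivAt_scaled A1 κ ρ).const_mul (κ : ℂ)).const_mul q).sub
        (((hasDerivAt_scaled B1 κ ρ).const_mul (κ : ℂ)).const_mul (2 * p)))
      (((((continuous_scaled A2 κ).const_mul (κ : ℂ)).const_mul (κ : ℂ)).const_mul q).sub
        ((((continuous_scaled B2 κ).const_mul (κ : ℂ)).const_mul (κ : ℂ)).const_mul (2 * p)))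
      ?_ ?_, fun x y hxy => ?_⟩
    · intro ρ
      have h := congrArg (fun x : ℝ => (x : ℂ)) (entireSeries_besselCoeff (κ * ρ))
      push_cast at h
      rw [hk2]
      linear_combination 4 * κ * p * h
    · intro ρ
      have h := congrArg (fun x : ℝ => (x : ℂ)) (entireSeries_besselCoeff (κ * ρ))
      have h' := congrArg (fun x : ℝ => (x : ℂ)) (entireSeries_besselHarmonicCoeff (κ * ρ))
      push_cast at h h'
      simp only [Pi.sub_apply]
      rw [hk2]
      linear_combination 4 * κ * q * h - 4 * κ * (2 * p) * h'
    · have hr : 0 < ‖x - y‖ := norm_pos_iff.2 (sub_ne_zero.2 hxy)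
      set r := ‖x - y‖ with hr'
      have hw : (k * r / 2) ^ 2 = κ * r ^ 2 := by rw [hκ]; ring
      have hJ : besselJZero (k * r) = entireSeries besselCoeff (κ * r ^ 2) := by
        simp only [besselJZero, entireSeries, besselCoeff, pow_mul, hw]
      have hY : ∑' m : ℕ, (-1 : ℝ) ^ m * (harmonic m : ℝ) / (m.factorial : ℝ) ^ 2
          * (k * r / 2) ^ (2 * m) = entireSeries besselHarmonicCoeff (κ * r ^ 2) := by
        simp only [entireSeries, besselHarmonicCoeff, pow_mul, hw]
      have hlog : 2 * Real.log (k * r / 2) = Real.log κ + Real.log (r ^ 2) := by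
        rw [← Real.log_mul hκ0.ne' (by positivity), ← hw, Real.log_pow]; push_cast; ring
      rw [fundSol, if_neg hk.ne', hankelZero, besselYZero, hY, hJ]
      have hl : Real.log (k * r / 2) = (Real.log κ + Real.log (r ^ 2)) / 2 := by linarith
      simp only [Pi.sub_apply]
      rw [hl, hp, hq]
      have hpi : (Real.pi : ℂ) ≠ 0 := by exact_mod_cast Real.pi_ne_zero
      push_cast
      field_simp
      ring_nf
      simp only [Complex.I_sq]
      ring

/-! ### Gradient and Hessian of a radial function -/

/-- The directional derivative at `x`, in the direction `a`, of `x ↦ G (|x|²)` with `G' = G₁`. -/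
def radialGrad (G₁ : ℝ → ℂ) (x a : Plane) : ℂ := 2 * G₁ (‖x‖ ^ 2) * (inner ℝ x a : ℝ)

/-- The second derivative at `x`, in the directions `a` and `b`, of `x ↦ G (|x|²)` with `G' = G₁`
and `G'' = G₂`. -/
def radialHess (G₁ G₂ : ℝ → ℂ) (x a b : Plane) : ℂ :=
  2 * G₁ (‖x‖ ^ 2) * (inner ℝ a b : ℝ) +
    4 * G₂ (‖x‖ ^ 2) * (inner ℝ x a : ℝ) * (inner ℝ x b : ℝ)

/-- `radialHess` as a continuous linear map in its last argument. -/
def radialHessL (G₁ G₂ : ℝ → ℂ) (x a : Plane) : Plane →L[ℝ] ℂ :=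
  (2 * G₁ (‖x‖ ^ 2)) • Complex.ofRealCLM.comp (innerSL ℝ a) +
    (4 * G₂ (‖x‖ ^ 2) * (inner ℝ x a : ℝ)) • Complex.ofRealCLM.comp (innerSL ℝ x)

theorem radialHessL_apply (G₁ G₂ : ℝ → ℂ) (x a b : Plane) :
    radialHessL G₁ G₂ x a b = radialHess G₁ G₂ x a b := by
  simp [radialHessL, radialHess]

section Algebra

variable (G₁ G₂ : ℝ → ℂ) (x a b c : Plane)

theorem radialGrad_sub : radialGrad G₁ x (a - b) = radialGrad G₁ x a - radialGrad G₁ x b := by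
  simp only [radialGrad, inner_sub_right]; push_cast; ring

theorem radialGrad_smul (s : ℝ) : radialGrad G₁ x (s • a) = s * radialGrad G₁ x a := by
  simp only [radialGrad, real_inner_smul_right]; push_cast; ring

theorem radialHess_sub : radialHess G₁ G₂ x a (b - c)
    = radialHess G₁ G₂ x a b - radialHess G₁ G₂ x a c := by
  simp only [radialHess, inner_sub_right]; push_cast; ring

theorem radialHess_smul (s : ℝ) : radialHess G₁ G₂ x a (s • b) = s * radialHess G₁ G₂ x a b := by
  simp only [radialHess, real_inner_smul_right]; push_cast; ring

theorem radialHess_comm : radialHess G₁ G₂ x a b = radialHess G₁ G₂ x b a := by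
  simp only [radialHess, real_inner_comm b a]; ring

end Algebra

section Measurability

variable {α : Type*} [MeasurableSpace α] {X A B : α → Plane} {G₁ G₂ : ℝ → ℂ}

theorem measurable_radialGrad (h₁ : Measurable G₁) (hX : Measurable X) (hA : Measurable A) :
    Measurable fun p => radialGrad G₁ (X p) (A p) :=
  ((h₁.comp (hX.norm.pow_const 2)).const_mul 2).mul
    (Complex.measurable_ofReal.comp (hX.inner hA))

theorem measurable_radialHess (h₁ : Measurable G₁) (h₂ : Measurable G₂) (hX : Measurable X)
    (hA : Measurable A) (hB : Measurable B) :
    Measurable fun p => radialHess G₁ G₂ (X p) (A p) (B p) :=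
  (((h₁.comp (hX.norm.pow_const 2)).const_mul 2).mul
    (Complex.measurable_ofReal.comp (hA.inner hB))).add
  ((((h₂.comp (hX.norm.pow_const 2)).const_mul 4).mul
    (Complex.measurable_ofReal.comp (hX.inner hA))).mul
    (Complex.measurable_ofReal.comp (hX.inner hB)))

end Measurability

theorem hasFDerivAt_norm_sq_plane (x : Plane) :
    HasFDerivAt (fun x : Plane => ‖x‖ ^ 2) ((2 : ℝ) • innerSL ℝ x) x := by
  refine (hasStrictFDerivAt_norm_sq x).hasFDerivAt.congr_fderiv ?_
  ext a
  simp

theorem norm_sq_pos_of_ne {x : Plane} (hx : x ≠ 0) : 0 < ‖x‖ ^ 2 := by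
  have := norm_pos_iff.2 hx
  positivity

namespace IsRadialSolution

variable {k : ℝ} {G G₁ G₂ : ℝ → ℂ} (hG : IsRadialSolution k G G₁ G₂)

include hG

theorem exists_hasFDerivAt {x : Plane} (hx : x ≠ 0) : ∃ ℓ : Plane →L[ℝ] ℂ,
    HasFDerivAt (fun x : Plane => G (‖x‖ ^ 2)) ℓ x ∧ ∀ a, ℓ a = radialGrad G₁ x a := by
  refine ⟨_, (hG.hasDerivAt _ (norm_sq_pos_of_ne hx)).hasFDerivAt.comp x
    (hasFDerivAt_norm_sq_plane x), fun a => ?_⟩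
  simp [radialGrad]; ring

theorem hasFDerivAt_radialGrad {x : Plane} (hx : x ≠ 0) (a : Plane) :
    HasFDerivAt (fun x : Plane => radialGrad G₁ x a) (radialHessL G₁ G₂ x a) x := by
  have h1 := (hG.hasDerivAt₁ _ (norm_sq_pos_of_ne hx)).hasFDerivAt.comp x
    (hasFDerivAt_norm_sq_plane x)
  have h2 : HasFDerivAt (fun x : Plane => ((inner ℝ x a : ℝ) : ℂ))
      (Complex.ofRealCLM.comp (innerSL ℝ a)) x := by
    have := (Complex.ofRealCLM.comp (innerSL ℝ a)).hasFDerivAt (x := x)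
    refine this.congr_of_eventuallyEq (Eventually.of_forall fun y => ?_)
    simp [real_inner_comm]
  refine ((h1.const_mul 2).mul h2).congr_fderiv ?_
  ext b
  simp [radialHessL]
  ring

theorem hasDerivAt_comp {Y : ℝ → Plane} {Y' : Plane} {s : ℝ} (hY : HasDerivAt Y Y' s)
    (h0 : Y s ≠ 0) : HasDerivAt (fun s => G (‖Y s‖ ^ 2)) (radialGrad G₁ (Y s) Y') s := by
  obtain ⟨ℓ, hℓ, hℓ'⟩ := hG.exists_hasFDerivAt h0
  exact (hℓ.comp_hasDerivAt s hY).congr_deriv (hℓ' _)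

theorem hasDerivAt_radialGrad_comp {Y A : ℝ → Plane} {Y' A' : Plane} {s : ℝ}
    (hY : HasDerivAt Y Y' s) (hA : HasDerivAt A A' s) (h0 : Y s ≠ 0) :
    HasDerivAt (fun s => radialGrad G₁ (Y s) (A s))
      (radialHess G₁ G₂ (Y s) (A s) Y' + radialGrad G₁ (Y s) A') s := by
  have h1 : HasDerivAt (fun s => G₁ (‖Y s‖ ^ 2))
      (2 * G₂ (‖Y s‖ ^ 2) * (inner ℝ (Y s) Y' : ℝ)) s := by
    have h := ((hG.hasDerivAt₁ _ (norm_sq_pos_of_ne h0)).hasFDerivAt.comp (Y s)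
      (hasFDerivAt_norm_sq_plane (Y s))).comp_hasDerivAt s hY
    refine h.congr_deriv ?_
    simp; ring
  have h2 := (hY.inner ℝ hA).ofReal_comp
  refine ((h1.const_mul 2).mul h2).congr_deriv ?_
  simp only [radialHess, radialGrad, real_inner_comm Y' (A s)]
  push_cast; ring

theorem fderiv_fundSol_left (hfs : ∀ x y : Plane, x ≠ y → fundSol k x y = G (‖x - y‖ ^ 2))
    {x y : Plane} (hxy : x ≠ y) (a : Plane) :
    fderiv ℝ (fun z => fundSol k z y) x a = radialGrad G₁ (x - y) a := by
  obtain ⟨ℓ, hℓ, hℓ'⟩ := hG.exists_hasFDerivAt (sub_ne_zero.2 hxy)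
  have h : HasFDerivAt (fun z => fundSol k z y) ℓ x := by
    have := hℓ.comp x ((hasFDerivAt_id x).sub_const y)
    refine (this.congr_of_eventuallyEq ?_)
    filter_upwards [isOpen_ne.mem_nhds hxy] with z hz using hfs z y hz
  rw [h.fderiv, hℓ']

theorem fderiv_fundSol_right (hfs : ∀ x y : Plane, x ≠ y → fundSol k x y = G (‖x - y‖ ^ 2))
    {x y : Plane} (hxy : x ≠ y) (a : Plane) :
    fderiv ℝ (fun z => fundSol k x z) y a = -radialGrad G₁ (x - y) a := by
  have : (fun z => fundSol k x z) =ᶠ[𝓝 y] fun z => fundSol k z x := by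
    filter_upwards [isOpen_ne.mem_nhds hxy.symm] with z hz
    rw [hfs x z (Ne.symm hz), hfs z x hz, norm_sub_rev]
  rw [this.fderiv_eq, hG.fderiv_fundSol_left hfs hxy.symm, radialGrad, radialGrad, norm_sub_rev,
    ← neg_sub x y, inner_neg_left]
  push_cast; ring

/-- For a pair of orthonormal frames that differ by a rotation, the Helmholtz equation turns the
Hessian in normal directions into the Hessian in tangential directions. -/
theorem radialHess_normal {x n n' T T' : Plane} (hx : x ≠ 0)
    (h : inner ℝ x n * inner ℝ x n' + inner ℝ x T * inner ℝ x T' = ‖x‖ ^ 2 * inner ℝ T T')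
    (hn : inner ℝ n n' = inner ℝ T T') :
    radialHess G₁ G₂ x n n' = -(k : ℂ) ^ 2 * G (‖x‖ ^ 2) * (inner ℝ T T' : ℝ)
      - radialHess G₁ G₂ x T T' := by
  have e := hG.helmholtz _ (norm_sq_pos_of_ne hx)
  have h' := congrArg (fun x : ℝ => (x : ℂ)) h
  push_cast at h'
  simp only [radialHess, hn]
  push_cast at e
  linear_combination 4 * G₂ (‖x‖ ^ 2) * h' + ((inner ℝ T T' : ℝ) : ℂ) * e

theorem continuousOn_radialGrad :
    ContinuousOn (fun p : Plane × Plane => radialGrad G₁ p.1 p.2) {p | p.1 ≠ 0} := by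
  have hc : ContinuousOn G₁ (Set.Ioi 0) := fun ρ hρ =>
    (hG.hasDerivAt₁ ρ hρ).continuousAt.continuousWithinAt
  have h1 : ContinuousOn (fun p : Plane × Plane => G₁ (‖p.1‖ ^ 2)) {p | p.1 ≠ 0} :=
    hc.comp (by fun_prop) fun p hp => norm_sq_pos_of_ne hp
  have h2 : Continuous (fun p : Plane × Plane => ((inner ℝ p.1 p.2 : ℝ) : ℂ)) := by fun_prop
  exact (continuousOn_const.mul h1).mul h2.continuousOn

theorem continuousOn_radialHess :
    ContinuousOn (fun p : Plane × Plane × Plane => radialHess G₁ G₂ p.1 p.2.1 p.2.2)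
      {p | p.1 ≠ 0} := by
  have hc : ContinuousOn G₁ (Set.Ioi 0) := fun ρ hρ =>
    (hG.hasDerivAt₁ ρ hρ).continuousAt.continuousWithinAt
  have h1 : ContinuousOn (fun p : Plane × Plane × Plane => G₁ (‖p.1‖ ^ 2)) {p | p.1 ≠ 0} :=
    hc.comp (by fun_prop) fun p hp => norm_sq_pos_of_ne hp
  have h3 : ContinuousOn (fun p : Plane × Plane × Plane => G₂ (‖p.1‖ ^ 2)) {p | p.1 ≠ 0} :=
    hG.continuousOn₂.comp (by fun_prop) fun p hp => norm_sq_pos_of_ne hp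
  have e1 : Continuous (fun p : Plane × Plane × Plane => ((inner ℝ p.1 p.2.1 : ℝ) : ℂ)) := by
    fun_prop
  have e2 : Continuous (fun p : Plane × Plane × Plane => ((inner ℝ p.1 p.2.2 : ℝ) : ℂ)) := by
    fun_prop
  have e3 : Continuous (fun p : Plane × Plane × Plane => ((inner ℝ p.2.1 p.2.2 : ℝ) : ℂ)) := by
    fun_prop
  exact ((continuousOn_const.mul h1).mul e3.continuousOn).add
    (((continuousOn_const.mul h3).mul e1.continuousOn).mul e2.continuousOn)

theorem continuousOn_radial :
    ContinuousOn (fun x : Plane => G (‖x‖ ^ 2)) {x | x ≠ 0} := by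
  have hc : ContinuousOn G (Set.Ioi 0) := fun ρ hρ =>
    (hG.hasDerivAt ρ hρ).continuousAt.continuousWithinAt
  exact hc.comp (by fun_prop) fun p hp => norm_sq_pos_of_ne hp

end IsRadialSolution

/-- Quantitative bounds on `G`, `G₁`, `G₂` on `(0, M]`. -/
structure RadialBound (G G₁ G₂ : ℝ → ℂ) (M C : ℝ) : Prop where
  nonneg : 0 ≤ C
  bound₀ : ∀ ρ, 0 < ρ → ρ ≤ M → ‖G ρ‖ ≤ C * ρ ^ (-(1 / 4) : ℝ)
  bound₁ : ∀ ρ, 0 < ρ → ρ ≤ M → ‖G₁ ρ‖ ≤ C / ρ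
  bound₂ : ∀ ρ, 0 < ρ → ρ ≤ M → ‖G₂ ρ‖ ≤ C / ρ ^ 2

theorem IsRadialSolution.exists_radialBound {k : ℝ} {G G₁ G₂ : ℝ → ℂ}
    (hG : IsRadialSolution k G G₁ G₂) (M : ℝ) : ∃ C, RadialBound G G₁ G₂ M C := by
  obtain ⟨C, hC, h⟩ := hG.bound M
  exact ⟨C, hC, fun ρ h0 hM => (h ρ h0 hM).1, fun ρ h0 hM => (h ρ h0 hM).2.1,
    fun ρ h0 hM => (h ρ h0 hM).2.2⟩

namespace RadialBound

variable {G G₁ G₂ : ℝ → ℂ} {M C : ℝ} (hB : RadialBound G G₁ G₂ M C)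

include hB

theorem norm_radialGrad_le {x a : Plane} (hx : x ≠ 0) (hM : ‖x‖ ^ 2 ≤ M) :
    ‖radialGrad G₁ x a‖ ≤ 2 * C * |inner ℝ x a| / ‖x‖ ^ 2 := by
  have := hB.bound₁ _ (norm_sq_pos_of_ne hx) hM
  rw [radialGrad, norm_mul, norm_mul, Complex.norm_ofNat, Complex.norm_real, Real.norm_eq_abs]
  calc 2 * ‖G₁ (‖x‖ ^ 2)‖ * |inner ℝ x a| ≤ 2 * (C / ‖x‖ ^ 2) * |inner ℝ x a| := by gcongr
    _ = _ := by ring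

theorem norm_radialHess_le {x a b : Plane} (hx : x ≠ 0) (hM : ‖x‖ ^ 2 ≤ M) :
    ‖radialHess G₁ G₂ x a b‖ ≤ 2 * C * |inner ℝ a b| / ‖x‖ ^ 2
      + 4 * C * (|inner ℝ x a| * |inner ℝ x b|) / (‖x‖ ^ 2) ^ 2 := by
  have h1 := hB.bound₁ _ (norm_sq_pos_of_ne hx) hM
  have h2 := hB.bound₂ _ (norm_sq_pos_of_ne hx) hM
  refine (norm_add_le _ _).trans ?_
  simp only [norm_mul, Complex.norm_ofNat, Complex.norm_real, Real.norm_eq_abs]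
  calc _ ≤ 2 * (C / ‖x‖ ^ 2) * |inner ℝ a b|
        + 4 * (C / (‖x‖ ^ 2) ^ 2) * |inner ℝ x a| * |inner ℝ x b| := by gcongr
    _ = _ := by ring

theorem norm_radialGrad_le_div {x a : Plane} (hx : x ≠ 0) (hM : ‖x‖ ^ 2 ≤ M) :
    ‖radialGrad G₁ x a‖ ≤ 2 * C * ‖a‖ / ‖x‖ := by
  have h0 := norm_pos_iff.2 hx
  have hC := hB.nonneg
  refine (hB.norm_radialGrad_le hx hM).trans ?_
  rw [div_le_div_iff₀ (by positivity) h0]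
  have := abs_real_inner_le_norm x a
  calc 2 * C * |inner ℝ x a| * ‖x‖ ≤ 2 * C * (‖x‖ * ‖a‖) * ‖x‖ := by gcongr
    _ = _ := by ring

theorem norm_radialHess_le_div {x a b : Plane} (hx : x ≠ 0) (hM : ‖x‖ ^ 2 ≤ M) :
    ‖radialHess G₁ G₂ x a b‖ ≤ 6 * C * (‖a‖ * ‖b‖) / ‖x‖ ^ 2 := by
  have h0 := norm_pos_iff.2 hx
  have hC := hB.nonneg
  refine (hB.norm_radialHess_le hx hM).trans ?_
  calc _ ≤ 2 * C * (‖a‖ * ‖b‖) / ‖x‖ ^ 2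
        + 4 * C * ((‖x‖ * ‖a‖) * (‖x‖ * ‖b‖)) / (‖x‖ ^ 2) ^ 2 := by
        gcongr <;> exact abs_real_inner_le_norm _ _
    _ = _ := by field_simp; ring

end RadialBound

/-! ### Closed curves with a frame -/

/-- `γ` is a simple closed curve of length `L`, parametrized by arc length, with tangent `T`, unit
normal `n` and signed curvature `τ`, so that `T' = -τ n` and `n' = τ T`; the last two properties
hold as `(T, n)` is obtained from a fixed orthonormal frame by rotations. -/
structure IsArcFrame (L : ℝ) (γ T n : ℝ → Plane) (τ : ℝ → ℝ) : Prop where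
  length_pos : 0 < L
  periodic : Function.Periodic γ L
  periodic_T : Function.Periodic T L
  periodic_n : Function.Periodic n L
  periodic_τ : Function.Periodic τ L
  hasDerivAt : ∀ t, HasDerivAt γ (T t) t
  hasDerivAt_T : ∀ t, HasDerivAt T (-(τ t • n t)) t
  hasDerivAt_n : ∀ t, HasDerivAt n (τ t • T t) t
  continuous_τ : Continuous τ
  norm_T : ∀ t, ‖T t‖ = 1
  norm_n : ∀ t, ‖n t‖ = 1
  inner_T_n : ∀ t, inner ℝ (T t) (n t) = 0
  eq_add_of_eq : ∀ t u, γ t = γ u → ∃ m : ℤ, t = u + m * L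
  inner_n : ∀ t u, inner ℝ (n t) (n u) = inner ℝ (T t) (T u)
  inner_frame : ∀ x t u, inner ℝ x (n t) * inner ℝ x (n u) + inner ℝ x (T t) * inner ℝ x (T u)
    = ‖x‖ ^ 2 * inner ℝ (T t) (T u)

/-- Quantitative estimates along a framed closed curve, in terms of the length `‖γ t - γ u‖` of
chords: regularity of the frame, comparison of chords and arcs, and the distance of points of a
tubular neighbourhood of width `δ`. -/
structure IsTube (L : ℝ) (γ T n : ℝ → Plane) (τ : ℝ → ℝ) (K δ : ℝ) : Prop where
  one_le : 1 ≤ K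
  pos : 0 < δ
  mul_le : K * δ ≤ 1 / 2
  abs_τ_le : ∀ t, |τ t| ≤ K
  norm_n_sub_le : ∀ t u, ‖n t - n u‖ ≤ K * ‖γ t - γ u‖
  norm_T_sub_le : ∀ t u, ‖T t - T u‖ ≤ K * ‖γ t - γ u‖
  abs_inner_le : ∀ t u, |inner ℝ (γ t - γ u) (n t)| ≤ K * ‖γ t - γ u‖ ^ 2
  abs_sub_le : ∀ t u, |t - u| ≤ L / 2 → |t - u| ≤ K * ‖γ t - γ u‖
  tube_le : ∀ t u s s', |s| ≤ δ → |s'| ≤ δ →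
    ‖γ t - γ u‖ ^ 2 + (s - s') ^ 2 ≤ K * ‖γ t + s • n t - (γ u + s' • n u)‖ ^ 2
  diam_le : ∀ t u s s', |s| ≤ δ → |s'| ≤ δ → ‖γ t + s • n t - (γ u + s' • n u)‖ ^ 2 ≤ K

/-- Modulo periods, two parameters are at most half a period apart. -/
theorem exists_int_abs_sub_le {L : ℝ} (hL : 0 < L) (t u : ℝ) :
    ∃ m : ℤ, |t - (u + m * L)| ≤ L / 2 := by
  refine ⟨round ((t - u) / L), ?_⟩
  have h := abs_sub_round ((t - u) / L)
  have e : t - (u + (round ((t - u) / L)) * L) = ((t - u) / L - round ((t - u) / L)) * L := by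
    field_simp; ring
  rw [e, abs_mul, abs_of_pos hL]
  nlinarith

theorem Function.Periodic.add_int_mul {α : Type*} {f : ℝ → α} {L : ℝ}
    (h : Function.Periodic f L) (u : ℝ) (m : ℤ) : f (u + m * L) = f u := by
  simpa using h.int_mul m u

namespace IsArcFrame

variable {L : ℝ} {γ T n : ℝ → Plane} {τ : ℝ → ℝ} (hF : IsArcFrame L γ T n τ)

include hF

theorem continuous : Continuous γ :=
  continuous_iff_continuousAt.2 fun t => (hF.hasDerivAt t).continuousAt

theorem continuous_T : Continuous T :=
  continuous_iff_continuousAt.2 fun t => (hF.hasDerivAt_T t).continuousAt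

theorem continuous_n : Continuous n :=
  continuous_iff_continuousAt.2 fun t => (hF.hasDerivAt_n t).continuousAt

/-- Regularity of the frame in terms of chords, and comparison of arcs and chords. -/
theorem exists_chord_bound : ∃ K : ℝ, 4 ≤ K ∧ (∀ t, |τ t| ≤ K) ∧
    (∀ t u, ‖n t - n u‖ ≤ K * ‖γ t - γ u‖) ∧ (∀ t u, ‖T t - T u‖ ≤ K * ‖γ t - γ u‖) ∧
    (∀ t u, |inner ℝ (γ t - γ u) (n t)| ≤ K * ‖γ t - γ u‖ ^ 2) ∧
    (∀ t u, |t - u| ≤ L / 2 → |t - u| ≤ K * ‖γ t - γ u‖) := by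
  have hL := hF.length_pos
  obtain ⟨M₀, hM₀⟩ := (isBounded_iff_forall_norm_le.1
    (hF.periodic_τ.isBounded_of_continuous hL.ne' hF.continuous_τ))
  set M := max M₀ 1 with hM
  have hM1 : 1 ≤ M := le_max_right _ _
  have hτ : ∀ t, |τ t| ≤ M := fun t => (hM₀ _ ⟨t, rfl⟩).trans (le_max_left _ _)
  -- Lipschitz estimates in the parameter
  have hT : ∀ t u, ‖T t - T u‖ ≤ M * |t - u| := fun t u =>
    convex_univ.norm_image_sub_le_of_norm_hasDerivWithin_le
      (fun x _ => (hF.hasDerivAt_T x).hasDerivWithinAt)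
      (fun x _ => by rw [norm_neg, norm_smul, hF.norm_n, mul_one]; exact hτ x)
      (Set.mem_univ u) (Set.mem_univ t)
  have hn : ∀ t u, ‖n t - n u‖ ≤ M * |t - u| := fun t u =>
    convex_univ.norm_image_sub_le_of_norm_hasDerivWithin_le
      (fun x _ => (hF.hasDerivAt_n x).hasDerivWithinAt)
      (fun x _ => by rw [norm_smul, hF.norm_T, mul_one]; exact hτ x)
      (Set.mem_univ u) (Set.mem_univ t)
  have hγ : ∀ t u, ‖γ t - γ u - (t - u) • T t‖ ≤ M * |t - u| ^ 2 := by
    intro t u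
    have h := (convex_uIcc t u).norm_image_sub_le_of_norm_hasDerivWithin_le
      (f := fun x => γ x - x • T t) (f' := fun x => T x - T t) (C := M * |t - u|) (x := u) (y := t)
      (fun x _ => by
        have := (hF.hasDerivAt x).sub ((hasDerivAt_id x).smul_const (T t))
        exact (this.congr_deriv (by simp)).hasDerivWithinAt)
      (fun x hx => (hT x t).trans (by
        have := Set.abs_sub_left_of_mem_uIcc hx
        rw [abs_sub_comm x t, abs_sub_comm t u, abs_sub_comm t x]
        gcongr))
      Set.right_mem_uIcc Set.left_mem_uIcc
    rw [Real.norm_eq_abs] at h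
    calc _ = ‖γ t - t • T t - (γ u - u • T t)‖ := by congr 1; module
      _ ≤ _ := h
      _ = _ := by ring
  -- chords and arcs are comparable: for short arcs by the previous estimate, for long arcs by
  -- compactness, as the curve is simple
  have hnear : ∀ t u, |t - u| ≤ 1 / (2 * M) → |t - u| ≤ 2 * ‖γ t - γ u‖ := by
    intro t u h
    have h1 := hγ t u
    have h2 : ‖(t - u) • T t‖ = |t - u| := by rw [norm_smul, hF.norm_T, mul_one, Real.norm_eq_abs]
    have h3 : ‖(t - u) • T t‖ ≤ ‖γ t - γ u‖ + ‖γ t - γ u - (t - u) • T t‖ := by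
      have := norm_sub_le (γ t - γ u) (γ t - γ u - (t - u) • T t)
      rwa [sub_sub_cancel] at this
    have h4 : M * |t - u| ^ 2 ≤ |t - u| / 2 := by
      rw [le_div_iff₀ (by positivity)] at h
      nlinarith [abs_nonneg (t - u)]
    linarith
  have hcpt : IsCompact {p : ℝ × ℝ | p.2 ∈ Set.Icc 0 L ∧ 1 / (2 * M) ≤ |p.1 - p.2| ∧
      |p.1 - p.2| ≤ L / 2} := by
    have hbox : IsCompact (Set.Icc (-L) (2 * L) ×ˢ Set.Icc 0 L) :=
      isCompact_Icc.prod isCompact_Icc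
    refine hbox.of_isClosed_subset ?_ ?_
    · have h1 : IsClosed {p : ℝ × ℝ | p.2 ∈ Set.Icc 0 L} := isClosed_Icc.preimage continuous_snd
      have h2 : IsClosed {p : ℝ × ℝ | 1 / (2 * M) ≤ |p.1 - p.2|} :=
        isClosed_le (by fun_prop) (by fun_prop)
      have h3 : IsClosed {p : ℝ × ℝ | |p.1 - p.2| ≤ L / 2} :=
        isClosed_le (by fun_prop) (by fun_prop)
      exact h1.inter (h2.inter h3)
    · rintro ⟨t, u⟩ ⟨⟨h1, h2⟩, -, h3⟩
      have := abs_le.1 h3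
      simp only at h1 h2 this
      exact ⟨⟨by linarith, by linarith⟩, ⟨h1, h2⟩⟩
  obtain ⟨m, hm0, hm⟩ := hcpt.exists_forall_le' (f := fun p : ℝ × ℝ => ‖γ p.1 - γ p.2‖) (a := 0)
    (by have := hF.continuous; fun_prop) (by
      rintro ⟨t, u⟩ ⟨-, h1, h2⟩
      simp only at h1 h2 ⊢
      refine norm_pos_iff.2 fun h => ?_
      obtain ⟨m, hm⟩ := hF.eq_add_of_eq t u (sub_eq_zero.1 h)
      have e : t - u = m * L := by linarith
      rw [e, abs_mul, abs_of_pos hL] at h1 h2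
      have hm1 : |(m : ℝ)| < 1 := by nlinarith
      have : m = 0 := Int.abs_lt_one_iff.1 (by exact_mod_cast hm1)
      rw [this, Int.cast_zero, abs_zero, zero_mul] at h1
      have : 0 < 1 / (2 * M) := by positivity
      linarith)
  have hchord : ∀ t u, |t - u| ≤ L / 2 → |t - u| ≤ max 2 (L / m) * ‖γ t - γ u‖ := by
    intro t u h
    by_cases h1 : |t - u| ≤ 1 / (2 * M)
    · exact (hnear t u h1).trans (by gcongr; exact le_max_left _ _)
    · set j : ℤ := ⌊u / L⌋ with hj
      have e1 : γ (t + (-j : ℤ) * L) = γ t := hF.periodic.add_int_mul t (-j)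
      have e2 : γ (u + (-j : ℤ) * L) = γ u := hF.periodic.add_int_mul u (-j)
      have e3 : (t + (-j : ℤ) * L) - (u + (-j : ℤ) * L) = t - u := by ring
      have l1 := Int.floor_le (u / L)
      have l2 := (Int.lt_floor_add_one (u / L)).le
      rw [← hj] at l1 l2
      rw [le_div_iff₀ hL] at l1
      rw [div_le_iff₀ hL] at l2
      have := hm (t + (-j : ℤ) * L, u + (-j : ℤ) * L)
        ⟨⟨by push_cast; linarith, by push_cast; linarith⟩,
        by simp only [e3]; exact (not_le.1 h1).le, by simp only [e3]; exact h⟩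
      simp only [e1, e2] at this
      calc |t - u| ≤ L := h.trans (by linarith)
        _ = L / m * m := by field_simp
        _ ≤ max 2 (L / m) * ‖γ t - γ u‖ := by gcongr; exact le_max_right _ _
  set c := max 2 (L / m) with hc
  have hc2 : 2 ≤ c := le_max_left _ _
  -- estimates in terms of chords
  have hper : ∀ t u, ∃ u', |t - u'| ≤ L / 2 ∧ γ u' = γ u ∧ T u' = T u ∧ n u' = n u := by
    intro t u
    obtain ⟨m, hm⟩ := exists_int_abs_sub_le hL t u
    exact ⟨u + m * L, hm, hF.periodic.add_int_mul u m, hF.periodic_T.add_int_mul u m,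
      hF.periodic_n.add_int_mul u m⟩
  set K₁ := M * c ^ 2 with hK₁
  have hMc : M * c ≤ K₁ := by rw [hK₁, sq]; gcongr; nlinarith
  have hK₁1 : 4 ≤ K₁ := by rw [hK₁]; nlinarith
  have bn : ∀ t u, ‖n t - n u‖ ≤ K₁ * ‖γ t - γ u‖ := by
    intro t u
    obtain ⟨u', h, e1, e2, e3⟩ := hper t u
    rw [← e1, ← e3]
    calc _ ≤ M * |t - u'| := hn t u'
      _ ≤ M * (c * ‖γ t - γ u'‖) := by gcongr; exact hchord t u' h
      _ = M * c * ‖γ t - γ u'‖ := by ring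
      _ ≤ _ := by gcongr
  have bT : ∀ t u, ‖T t - T u‖ ≤ K₁ * ‖γ t - γ u‖ := by
    intro t u
    obtain ⟨u', h, e1, e2, e3⟩ := hper t u
    rw [← e1, ← e2]
    calc _ ≤ M * |t - u'| := hT t u'
      _ ≤ M * (c * ‖γ t - γ u'‖) := by gcongr; exact hchord t u' h
      _ = M * c * ‖γ t - γ u'‖ := by ring
      _ ≤ _ := by gcongr
  have bi : ∀ t u, |inner ℝ (γ t - γ u) (n t)| ≤ K₁ * ‖γ t - γ u‖ ^ 2 := by
    intro t u
    obtain ⟨u', h, e1, e2, e3⟩ := hper t u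
    rw [← e1]
    have e : inner ℝ (γ t - γ u') (n t) = inner ℝ (γ t - γ u' - (t - u') • T t) (n t) := by
      rw [inner_sub_left _ (_ • _), real_inner_smul_left, hF.inner_T_n, mul_zero, sub_zero]
    rw [e]
    calc _ ≤ ‖γ t - γ u' - (t - u') • T t‖ * ‖n t‖ := abs_real_inner_le_norm _ _
      _ ≤ M * |t - u'| ^ 2 := by rw [hF.norm_n, mul_one]; exact hγ t u'
      _ ≤ M * (c * ‖γ t - γ u'‖) ^ 2 := by gcongr; exact hchord t u' h
      _ = _ := by rw [hK₁]; ring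
  exact ⟨K₁, hK₁1, fun t => (hτ t).trans (by rw [hK₁]; nlinarith), bn, bT, bi,
    fun t u h => (hchord t u h).trans (by gcongr; rw [hK₁]; nlinarith)⟩

/-- The point `γ t + s n t` is displaced from `γ u + s' n u` by `γ t - γ u + (s - s') n u` up to an
error `s (n t - n u)`, which is small compared to the chord when `|s| ≤ δ`; and the two terms are
orthogonal up to an error of second order in the chord. -/
theorem exists_tube : ∃ K δ, IsTube L γ T n τ K δ := by
  have hL := hF.length_pos
  obtain ⟨R, hR⟩ := (isBounded_iff_forall_norm_le.1
    (hF.periodic.isBounded_of_continuous hL.ne' hF.continuous))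
  have hR0 : 0 ≤ R := (norm_nonneg _).trans (hR _ ⟨0, rfl⟩)
  obtain ⟨K₁, hK₁1, hτ, bn, bT, bi, hchord⟩ := hF.exists_chord_bound
  set K := 8 * K₁ + (2 * R + 2) ^ 2 with hK
  have hK₁K : K₁ ≤ K := by rw [hK]; nlinarith
  set δ := 1 / (2 * K) with hδ
  have hK0 : 0 < K := by linarith
  have hδ0 : 0 < δ := by positivity
  have hKδ : K * δ = 1 / 2 := by rw [hδ]; field_simp
  have hK₁δ : K₁ * δ ≤ 1 / 16 := by
    have : 8 * K₁ ≤ K := by rw [hK]; nlinarith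
    nlinarith
  have hδ1 : δ ≤ 1 := by nlinarith
  refine ⟨K, δ, by linarith, hδ0, hKδ.le, fun t => (hτ t).trans ?_,
    fun t u => (bn t u).trans ?_, fun t u => (bT t u).trans ?_, fun t u => (bi t u).trans ?_,
    fun t u h => (hchord t u h).trans ?_, ?_, ?_⟩
  · exact hK₁K
  · gcongr
  · gcongr
  · gcongr
  · gcongr
  · intro t u s s' hs hs'
    set r := ‖γ t - γ u‖ with hr
    set P := γ t - γ u + (s - s') • n u with hP
    set Z := γ t + s • n t - (γ u + s' • n u) with hZ
    have e : P = Z - s • (n t - n u) := by rw [hP, hZ]; module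
    have hP1 : ‖P‖ ^ 2 = r ^ 2 + 2 * ((s - s') * inner ℝ (γ t - γ u) (n u)) + (s - s') ^ 2 := by
      rw [hP, norm_add_sq_real, real_inner_smul_right, norm_smul, hF.norm_n, mul_one,
        Real.norm_eq_abs, sq_abs]
    have hss : |s - s'| ≤ 2 * δ := (abs_sub _ _).trans (by linarith)
    have hi : |inner ℝ (γ t - γ u) (n u)| ≤ K₁ * r ^ 2 := by
      have := bi u t
      rwa [← neg_sub, inner_neg_left, abs_neg, norm_neg] at this
    have h1 : -((2 * δ) * (K₁ * r ^ 2)) ≤ (s - s') * inner ℝ (γ t - γ u) (n u) := by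
      refine (abs_le.1 ?_).1
      rw [abs_mul]
      gcongr
    have h2 : ‖P‖ ≤ ‖Z‖ + δ * (K₁ * r) := by
      rw [e]
      refine (norm_sub_le _ _).trans ?_
      rw [norm_smul, Real.norm_eq_abs]
      gcongr
      exact bn t u
    have h3 : ‖P‖ ^ 2 ≤ 2 * ‖Z‖ ^ 2 + 2 * (δ * (K₁ * r)) ^ 2 := by
      have : ‖P‖ ^ 2 ≤ (‖Z‖ + δ * (K₁ * r)) ^ 2 := by gcongr
      nlinarith [sq_nonneg (‖Z‖ - δ * (K₁ * r))]
    have h4 : (δ * (K₁ * r)) ^ 2 ≤ 1 / 256 * r ^ 2 := by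
      have : (K₁ * δ) ^ 2 ≤ (1 / 16) ^ 2 := by gcongr
      calc (δ * (K₁ * r)) ^ 2 = (K₁ * δ) ^ 2 * r ^ 2 := by ring
        _ ≤ (1 / 16) ^ 2 * r ^ 2 := by gcongr
        _ = _ := by ring
    have h5 : (2 * δ) * (K₁ * r ^ 2) ≤ 1 / 8 * r ^ 2 := by
      calc _ = 2 * (K₁ * δ) * r ^ 2 := by ring
        _ ≤ 2 * (1 / 16) * r ^ 2 := by gcongr
        _ = _ := by ring
    have h6 : r ^ 2 + (s - s') ^ 2 ≤ 8 * ‖Z‖ ^ 2 := by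
      nlinarith [sq_nonneg r, sq_nonneg (s - s')]
    refine h6.trans ?_
    gcongr
    rw [hK]; nlinarith
  · intro t u s s' hs hs'
    have hb : ‖γ t + s • n t - (γ u + s' • n u)‖ ≤ 2 * R + 2 := by
      have a1 := hR _ ⟨t, rfl⟩
      have a2 := hR _ ⟨u, rfl⟩
      have a3 : ‖s • n t‖ ≤ 1 := by
        rw [norm_smul, hF.norm_n, mul_one]; exact hs.trans hδ1
      have a4 : ‖s' • n u‖ ≤ 1 := by
        rw [norm_smul, hF.norm_n, mul_one]; exact hs'.trans hδ1
      refine (norm_sub_le _ _).trans ?_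
      have b1 := norm_add_le (γ t) (s • n t)
      have b2 := norm_add_le (γ u) (s' • n u)
      linarith
    calc _ ≤ (2 * R + 2) ^ 2 := by gcongr
      _ ≤ K := by rw [hK]; nlinarith

end IsArcFrame

/-! ### The boundary of a planar domain and of its coating -/

/-- Rotation of the plane by a right angle. -/
def rotate (v : Plane) : Plane := !₂[-(v 1), v 0]

theorem plane_inner (v w : Plane) : inner ℝ v w = v 0 * w 0 + v 1 * w 1 := by
  simp [PiLp.inner_apply, Fin.sum_univ_two]; ring

theorem plane_norm_sq (v : Plane) : ‖v‖ ^ 2 = v 0 ^ 2 + v 1 ^ 2 := by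
  rw [← real_inner_self_eq_norm_sq, plane_inner]; ring

theorem rotate_zero (v : Plane) : rotate v 0 = -(v 1) := rfl

theorem rotate_one (v : Plane) : rotate v 1 = v 0 := rfl

theorem rotate_rotate (v : Plane) : rotate (rotate v) = -v := by
  ext i; fin_cases i <;> simp [rotate]

theorem inner_rotate_rotate (v w : Plane) : inner ℝ (rotate v) (rotate w) = inner ℝ v w := by
  simp only [plane_inner, rotate_zero, rotate_one]; ring

theorem inner_rotate_self (v : Plane) : inner ℝ v (rotate v) = 0 := by
  simp only [plane_inner, rotate_zero, rotate_one]; ring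

theorem norm_rotate (v : Plane) : ‖rotate v‖ = ‖v‖ := by
  rw [← sq_eq_sq₀ (norm_nonneg _) (norm_nonneg _), plane_norm_sq, plane_norm_sq, rotate_zero,
    rotate_one]; ring

/-- `(v, rotate v)` is an orthonormal basis for a unit vector `v`. -/
theorem eq_inner_smul_rotate {v w : Plane} (hv : ‖v‖ = 1) (h : inner ℝ v w = 0) :
    w = (inner ℝ w (rotate v) : ℝ) • rotate v := by
  have h1 : v 0 ^ 2 + v 1 ^ 2 = 1 := by rw [← plane_norm_sq, hv, one_pow]
  rw [plane_inner] at h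
  ext i
  fin_cases i <;> simp [plane_inner, rotate_zero, rotate_one]
  · linear_combination (-w 0) * h1 + v 0 * h
  · linear_combination (-w 1) * h1 + v 1 * h

theorem hasDerivAt_rotate {v : ℝ → Plane} {v' : Plane} {t : ℝ} (h : HasDerivAt v v' t) :
    HasDerivAt (fun t => rotate (v t)) (rotate v') t := by
  let ℓ : Plane →ₗ[ℝ] Plane :=
    { toFun := rotate
      map_add' := fun a b => by ext i; fin_cases i <;> simp [rotate]; ring
      map_smul' := fun a b => by ext i; fin_cases i <;> simp [rotate] }
  exact ℓ.toContinuousLinearMap.hasFDerivAt.comp_hasDerivAt t h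

/-- A set has at most one outward unit normal at a point. -/
theorem IsOutwardUnitNormal.unique {Ω : Set Plane} {x n n' : Plane}
    (h : IsOutwardUnitNormal Ω x n) (h' : IsOutwardUnitNormal Ω x n') : n = n' := by
  by_contra hne
  set v := n' - n with hv
  have hv0 : 0 < ‖v‖ := norm_pos_iff.2 (sub_ne_zero.2 (Ne.symm hne))
  -- the direction `n' - n` points into `Ω` according to `n`, and out of it according to `n'`
  have hsq : ‖v‖ ^ 2 = 2 - 2 * inner ℝ n' n := by
    rw [hv, norm_sub_sq_real, h.1, h'.1]; ring
  have e1 : inner ℝ v n = -(‖v‖ ^ 2 / 2) := by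
    rw [hsq, hv, inner_sub_left, real_inner_self_eq_norm_sq, h.1]; ring
  have e2 : inner ℝ v n' = ‖v‖ ^ 2 / 2 := by
    rw [hsq, hv, inner_sub_left, real_inner_self_eq_norm_sq, h'.1, real_inner_comm]; ring
  have ht : Tendsto (fun s : ℝ => x + s • v) (𝓝[>] 0) (𝓝 x) := by
    have : Continuous fun s : ℝ => x + s • v := by fun_prop
    simpa using (this.tendsto 0).mono_left nhdsWithin_le_nhds
  obtain ⟨s, ⟨hs1, hs2⟩, hs0⟩ := ((ht.eventually ((h.2 (‖v‖ / 4) (by positivity)).and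
    (h'.2 (‖v‖ / 4) (by positivity)))).and self_mem_nhdsWithin).exists
  have hs0 : 0 < s := hs0
  have hsv : 0 < s * ‖v‖ ^ 2 := by positivity
  simp only [add_sub_cancel_left, real_inner_smul_left, norm_smul, Real.norm_eq_abs,
    abs_of_pos hs0, e1, e2] at hs1 hs2
  exact hs2.2 (by nlinarith) (hs1.1 (by nlinarith))

theorem IsOutwardUnitNormal.outwardNormal_eq {Ω : Set Plane} {x n : Plane}
    (h : IsOutwardUnitNormal Ω x n) : outwardNormal Ω x = n := by
  have h' : ∃ n, IsOutwardUnitNormal Ω x n := ⟨n, h⟩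
  rw [outwardNormal, dif_pos h']
  exact h'.choose_spec.unique h

/-- The points `x + s n` with small `s > 0` lie outside, those with `s < 0` lie inside. -/
theorem IsOutwardUnitNormal.eventually_notMem {Ω : Set Plane} {x n : Plane}
    (h : IsOutwardUnitNormal Ω x n) :
    ∀ᶠ s in 𝓝[>] (0 : ℝ), x + s • n ∉ Ω ∧ x + s • (-n) ∈ Ω := by
  have ht : ∀ n, Tendsto (fun s : ℝ => x + s • n) (𝓝[>] 0) (𝓝 x) := fun n => by
    have : Continuous fun s : ℝ => x + s • n := by fun_prop
    simpa using (this.tendsto 0).mono_left nhdsWithin_le_nhds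
  have hc := h.2 (1 / 2) (by norm_num)
  filter_upwards [(ht n).eventually hc, (ht (-n)).eventually hc, self_mem_nhdsWithin]
    with s h1 h2 hs0
  have hs0 : 0 < s := hs0
  simp only [add_sub_cancel_left, real_inner_smul_left, norm_smul, Real.norm_eq_abs,
    abs_of_pos hs0, inner_neg_left, real_inner_self_eq_norm_sq, h.1, norm_neg] at h1 h2
  exact ⟨h1.2 (by linarith), h2.1 (by linarith)⟩

namespace IsC2Domain

variable {D : Set Plane} {L : ℝ} {γ : ℝ → Plane} (hD : IsC2Domain D L γ)

include hD

theorem hasDerivAt (t : ℝ) : HasDerivAt γ (deriv γ t) t :=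
  (hD.contDiff.differentiable (by norm_num) t).hasDerivAt

theorem contDiff_deriv : ContDiff ℝ 1 (deriv γ) := by
  have := hD.contDiff
  rw [show (2 : WithTop ℕ∞) = 1 + 1 by norm_num, contDiff_succ_iff_deriv] at this
  exact this.2.2

theorem hasDerivAt_deriv (t : ℝ) : HasDerivAt (deriv γ) (deriv (deriv γ) t) t :=
  (hD.contDiff_deriv.differentiable (by norm_num) t).hasDerivAt

theorem continuous_deriv_deriv : Continuous (deriv (deriv γ)) :=
  hD.contDiff_deriv.continuous_deriv (by norm_num)

theorem periodic_deriv : Function.Periodic (deriv γ) L := fun t => by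
  have h : (fun x => γ (x + L)) = γ := funext hD.periodic
  rw [← deriv_comp_add_const, h]

theorem periodic_deriv_deriv : Function.Periodic (deriv (deriv γ)) L := fun t => by
  have h : (fun x => deriv γ (x + L)) = deriv γ := funext hD.periodic_deriv
  rw [← deriv_comp_add_const, h]

theorem inner_deriv_deriv (t : ℝ) : inner ℝ (deriv γ t) (deriv (deriv γ) t) = 0 := by
  have h1 := (hD.hasDerivAt_deriv t).inner ℝ (hD.hasDerivAt_deriv t)
  have h2 : (fun t => (inner ℝ (deriv γ t) (deriv γ t) : ℝ)) = fun _ => 1 := by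
    funext t; rw [real_inner_self_eq_norm_sq, hD.norm_deriv, one_pow]
  rw [h2] at h1
  have := h1.unique (hasDerivAt_const t 1)
  rw [real_inner_comm (deriv γ t)] at this
  linarith

theorem eq_add_of_eq (t u : ℝ) (h : γ t = γ u) : ∃ m : ℤ, t = u + m * L := by
  have hL := hD.length_pos
  have key : ∀ t, ∃ m : ℤ, t + m * L ∈ Set.Ico 0 L := fun t => by
    refine ⟨-⌊t / L⌋, ?_, ?_⟩
    · have := (le_div_iff₀ hL).1 (Int.floor_le (t / L))
      push_cast; linarith
    · have := (div_lt_iff₀ hL).1 (Int.lt_floor_add_one (t / L))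
      push_cast; linarith
  obtain ⟨a, ha⟩ := key t
  obtain ⟨b, hb⟩ := key u
  have := hD.injOn ha hb (by
    rw [hD.periodic.add_int_mul, hD.periodic.add_int_mul, h])
  exact ⟨b - a, by push_cast; linarith⟩

/-- Either choice of a unit normal field makes the boundary a framed curve. -/
theorem isArcFrame {σ : ℝ} (hσ : σ = 1 ∨ σ = -1) :
    IsArcFrame L γ (deriv γ) (fun t => σ • rotate (deriv γ t))
      (fun t => -inner ℝ (deriv (deriv γ) t) (σ • rotate (deriv γ t))) := by
  have hσ2 : σ * σ = 1 := by rcases hσ with rfl | rfl <;> norm_num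
  have e : ∀ t, deriv (deriv γ) t
      = (inner ℝ (deriv (deriv γ) t) (rotate (deriv γ t)) : ℝ) • rotate (deriv γ t) := fun t =>
    eq_inner_smul_rotate (hD.norm_deriv t) (hD.inner_deriv_deriv t)
  have hn : ∀ t, HasDerivAt (fun t => σ • rotate (deriv γ t))
      (σ • rotate (deriv (deriv γ) t)) t := fun t =>
    (hasDerivAt_rotate (hD.hasDerivAt_deriv t)).const_smul σ
  refine ⟨hD.length_pos, hD.periodic, hD.periodic_deriv, fun t => ?_, fun t => ?_, hD.hasDerivAt,
    fun t => ?_, fun t => ?_, ?_, hD.norm_deriv, fun t => ?_, fun t => ?_, hD.eq_add_of_eq,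
    fun t u => ?_, fun x t u => ?_⟩
  · simp only [hD.periodic_deriv t]
  · simp only [hD.periodic_deriv t, hD.periodic_deriv_deriv t]
  · refine (hD.hasDerivAt_deriv t).congr_deriv ?_
    conv_lhs => rw [e t]
    rw [real_inner_smul_right, smul_smul, ← neg_smul]
    congr 1
    linear_combination -(inner ℝ (deriv (deriv γ) t) (rotate (deriv γ t)) : ℝ) * hσ2
  · refine (hn t).congr_deriv ?_
    have : rotate (deriv (deriv γ) t)
        = -(inner ℝ (deriv (deriv γ) t) (rotate (deriv γ t)) : ℝ) • deriv γ t := by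
      conv_lhs => rw [e t]
      rw [show ∀ (c : ℝ) (v : Plane), rotate (c • v) = c • rotate v from fun c v => by
        ext i; fin_cases i <;> simp [rotate], rotate_rotate, smul_neg, neg_smul]
    rw [this, real_inner_smul_right, smul_smul]
    congr 1; ring
  · have h1 := hD.continuous_deriv_deriv
    have h2 : Continuous fun t => σ • rotate (deriv γ t) :=
      continuous_iff_continuousAt.2 fun t => (hn t).continuousAt
    fun_prop
  · rw [norm_smul, norm_rotate, hD.norm_deriv]
    rcases hσ with rfl | rfl <;> norm_num
  · rw [real_inner_smul_right, inner_rotate_self, mul_zero]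
  · rw [real_inner_smul_right, real_inner_smul_left, inner_rotate_rotate, ← mul_assoc, hσ2, one_mul]
  · rw [real_inner_smul_right, real_inner_smul_right]
    have : inner ℝ x (rotate (deriv γ t)) * inner ℝ x (rotate (deriv γ u))
        + inner ℝ x (deriv γ t) * inner ℝ x (deriv γ u)
        = ‖x‖ ^ 2 * inner ℝ (deriv γ t) (deriv γ u) := by
      simp only [plane_inner, plane_norm_sq, rotate_zero, rotate_one]; ring
    linear_combination inner ℝ x (rotate (deriv γ t)) * inner ℝ x (rotate (deriv γ u)) * hσ2 + this

theorem mem_frontier (t : ℝ) : γ t ∈ frontier D := hD.range_eq ▸ Set.mem_range_self t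

theorem isOutwardUnitNormal (t : ℝ) : IsOutwardUnitNormal D (γ t) (outwardNormal D (γ t)) := by
  obtain ⟨n, hn⟩ := hD.exists_normal _ (hD.mem_frontier t)
  rwa [hn.outwardNormal_eq]

/-- The outward normal is orthogonal to the tangent: the curve does not enter the open set `D`. -/
theorem inner_deriv_outwardNormal (t : ℝ) : inner ℝ (deriv γ t) (outwardNormal D (γ t)) = 0 := by
  have hN := hD.isOutwardUnitNormal t
  set N := outwardNormal D (γ t)
  by_contra h0
  set a : ℝ := inner ℝ (deriv γ t) N with ha
  have ha0 : 0 < |a| := abs_pos.2 h0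
  have h1 := hN.2 (|a| / 4) (by positivity)
  have hc : Tendsto γ (𝓝 t) (𝓝 (γ t)) := (hD.hasDerivAt t).continuousAt
  have ho := (hasDerivAt_iff_isLittleO.1 (hD.hasDerivAt t)).def
    (show 0 < min (|a| / 4) 1 by positivity)
  have hev : ∀ᶠ u in 𝓝 t, (u - t) * a < 0 → False := by
    filter_upwards [hc.eventually h1, ho] with u hu1 hu2 hua
    rw [Real.norm_eq_abs] at hu2
    have hnot : γ u ∉ D := by
      have := hD.mem_frontier u
      rw [hD.isOpen.frontier_eq] at this
      exact this.2
    refine hnot (hu1.1 ?_)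
    have e1 : inner ℝ (γ u - γ t) N
        = (u - t) * a + inner ℝ (γ u - γ t - (u - t) • deriv γ t) N := by
      rw [inner_sub_left (γ u - γ t), real_inner_smul_left]; ring
    have e2 : |inner ℝ (γ u - γ t - (u - t) • deriv γ t) N| ≤ |a| / 4 * |u - t| := by
      refine (abs_real_inner_le_norm _ _).trans ?_
      rw [hN.1, mul_one]
      exact hu2.trans (by gcongr; exact min_le_left _ _)
    have e3 : ‖γ u - γ t‖ ≤ 2 * |u - t| := by
      have : ‖γ u - γ t‖ ≤ ‖γ u - γ t - (u - t) • deriv γ t‖ + ‖(u - t) • deriv γ t‖ := by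
        simpa using norm_add_le (γ u - γ t - (u - t) • deriv γ t) ((u - t) • deriv γ t)
      rw [norm_smul, hD.norm_deriv, mul_one, Real.norm_eq_abs] at this
      have h3 : min (|a| / 4) 1 * |u - t| ≤ 1 * |u - t| := by gcongr; exact min_le_right _ _
      linarith
    have e4 : (u - t) * a = -(|u - t| * |a|) := by rw [← abs_mul, abs_of_neg hua, neg_neg]
    have e5 : 0 < |u - t| * |a| := by linarith
    have := (abs_le.1 e2).2
    nlinarith [abs_nonneg (u - t)]
  have hne : ∃ᶠ u in 𝓝 t, (u - t) * a < 0 := by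
    rcases lt_or_gt_of_ne h0 with h | h
    · have : ∀ᶠ u in 𝓝[>] t, (u - t) * a < 0 := by
        filter_upwards [self_mem_nhdsWithin] with u hu
        exact mul_neg_of_pos_of_neg (sub_pos.2 hu) h
      exact this.frequently.filter_mono nhdsWithin_le_nhds
    · have : ∀ᶠ u in 𝓝[<] t, (u - t) * a < 0 := by
        filter_upwards [self_mem_nhdsWithin] with u hu
        exact mul_neg_of_neg_of_pos (sub_neg.2 hu) h
      exact this.frequently.filter_mono nhdsWithin_le_nhds
  obtain ⟨u, hu1, hu2⟩ := (hne.and_eventually hev).exists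
  exact hu2 hu1

/-- One side of a tubular neighbourhood of the boundary lies inside or outside the domain, being
connected and disjoint from the boundary. -/
theorem tube_side {T n : ℝ → Plane} {τ : ℝ → ℝ} (hF : IsArcFrame L γ T n τ) {K δ : ℝ}
    (hT : IsTube L γ T n τ K δ) :
    (∀ t s, 0 < s → s ≤ δ → γ t + s • n t ∈ D) ∨ (∀ t s, 0 < s → s ≤ δ → γ t + s • n t ∉ D) := by
  set S : Set Plane := (fun p : ℝ × ℝ => γ p.1 + p.2 • n p.1) '' (Set.univ ×ˢ Set.Ioc 0 δ) with hS
  have hpre : IsPreconnected S := by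
    refine (isPreconnected_univ.prod isPreconnected_Ioc).image _ ?_
    have h1 := hF.continuous
    have h2 := hF.continuous_n
    fun_prop
  have hmem : ∀ t s, 0 < s → s ≤ δ → γ t + s • n t ∈ S := fun t s h0 h1 =>
    ⟨(t, s), ⟨Set.mem_univ _, h0, h1⟩, rfl⟩
  have hmiss : ¬ (S ∩ frontier D).Nonempty := by
    rintro ⟨_, ⟨⟨t, s⟩, ⟨-, h0, h1⟩, rfl⟩, hx⟩
    rw [← hD.range_eq] at hx
    obtain ⟨u, hu⟩ := hx
    simp only at h0 h1 hu
    have := hT.tube_le t u s 0 (by rwa [abs_of_pos h0]) (by simpa using hT.pos.le)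
    rw [zero_smul, add_zero, ← hu, sub_self, norm_zero] at this
    nlinarith [sq_nonneg ‖γ t - γ u‖]
  by_contra! hcon
  obtain ⟨⟨t, s, h0, h1, h2⟩, ⟨t', s', h0', h1', h2'⟩⟩ := hcon
  have hcover : S ⊆ D ∪ (closure D)ᶜ := fun x hx => by
    by_cases hxD : x ∈ D
    · exact Or.inl hxD
    · refine Or.inr fun hc => hmiss ⟨x, hx, ?_⟩
      rw [hD.isOpen.frontier_eq]
      exact ⟨hc, hxD⟩
  obtain ⟨x, -, hx1, hx2⟩ := hpre D (closure D)ᶜ hD.isOpen isClosed_closure.isOpen_compl hcover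
    ⟨_, hmem t' s' h0' h1', h2'⟩
    ⟨_, hmem t s h0 h1, (hcover (hmem t s h0 h1)).resolve_left h2⟩
  exact hx2 (subset_closure hx1)

/-- The outward normal field is one of the two continuous unit normal fields. -/
theorem exists_outwardNormal_eq :
    ∃ σ : ℝ, (σ = 1 ∨ σ = -1) ∧ ∀ t, outwardNormal D (γ t) = σ • rotate (deriv γ t) := by
  obtain ⟨K, δ, hT⟩ := (hD.isArcFrame (Or.inl rfl)).exists_tube
  have hsign : ∀ t, outwardNormal D (γ t) = rotate (deriv γ t) ∨
      outwardNormal D (γ t) = -rotate (deriv γ t) := fun t => by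
    have h1 := eq_inner_smul_rotate (hD.norm_deriv t) (hD.inner_deriv_outwardNormal t)
    set c : ℝ := inner ℝ (outwardNormal D (γ t)) (rotate (deriv γ t))
    have h2 := (hD.isOutwardUnitNormal t).1
    rw [h1, norm_smul, norm_rotate, hD.norm_deriv, mul_one, Real.norm_eq_abs] at h2
    rcases (abs_eq zero_le_one).1 h2 with h | h
    · left; rw [h1, h, one_smul]
    · right; rw [h1, h, neg_smul, one_smul]
  have hsmall : ∀ᶠ s in 𝓝[>] (0 : ℝ), 0 < s ∧ s ≤ δ := by
    filter_upwards [Ioc_mem_nhdsGT hT.pos] with s hs using hs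
  rcases hD.tube_side (hD.isArcFrame (Or.inl rfl)) hT with h | h
  · refine ⟨-1, Or.inr rfl, fun t => ?_⟩
    rw [neg_smul, one_smul]
    refine (hsign t).resolve_left fun h' => ?_
    obtain ⟨s, hs, h0, h1⟩ := ((hD.isOutwardUnitNormal t).eventually_notMem.and hsmall).exists
    have := h t s h0 h1
    rw [one_smul] at this
    rw [h'] at hs
    exact hs.1 this
  · refine ⟨1, Or.inl rfl, fun t => ?_⟩
    rw [one_smul]
    refine (hsign t).resolve_right fun h' => ?_
    obtain ⟨s, hs, h0, h1⟩ := ((hD.isOutwardUnitNormal t).eventually_notMem.and hsmall).exists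
    have := h t s h0 h1
    rw [one_smul] at this
    rw [h', neg_neg] at hs
    exact this hs.2

/-- The boundary, framed by the outward normal, together with its signed curvature. -/
theorem isArcFrame_outwardNormal :
    IsArcFrame L γ (deriv γ) (fun t => outwardNormal D (γ t))
      (fun t => signedCurvature D γ (γ t)) := by
  obtain ⟨σ, hσ, h⟩ := hD.exists_outwardNormal_eq
  have h1 := hD.isArcFrame hσ
  have h2 : (fun t => outwardNormal D (γ t)) = fun t => σ • rotate (deriv γ t) := funext h
  have h3 : (fun t => signedCurvature D γ (γ t))
      = fun t => -inner ℝ (deriv (deriv γ) t) (σ • rotate (deriv γ t)) := by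
    funext t
    rw [signedCurvature, ← h t]
    -- the curvature at `γ t` is computed at some parameter of that point, which differs from `t`
    -- by a multiple of the period
    obtain ⟨m, hm⟩ := hD.eq_add_of_eq (Function.invFun γ (γ t)) t
      (Function.invFun_eq ⟨t, rfl⟩)
    rw [hm, hD.periodic_deriv_deriv.add_int_mul]
  rw [h2, h3]
  exact h1

section Coating

variable {K δ : ℝ} (hT : IsTube L γ (deriv γ) (fun t => outwardNormal D (γ t))
  (fun t => signedCurvature D γ (γ t)) K δ)

include hT

theorem notMem_of_tube {t s : ℝ} (h0 : 0 < s) (hs : s ≤ δ) :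
    γ t + s • outwardNormal D (γ t) ∉ D := by
  rcases hD.tube_side hD.isArcFrame_outwardNormal hT with h | h
  · have hsmall : ∀ᶠ s in 𝓝[>] (0 : ℝ), 0 < s ∧ s ≤ δ := by
      filter_upwards [Ioc_mem_nhdsGT hT.pos] with s hs using hs
    obtain ⟨s, hs, h0, h1⟩ := ((hD.isOutwardUnitNormal t).eventually_notMem.and hsmall).exists
    exact absurd (h t s h0 h1) hs.1
  · exact h t s h0 hs

omit hD in
theorem eq_of_tube {t u s s' : ℝ} (hs : |s| ≤ δ) (hs' : |s'| ≤ δ)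
    (h : γ t + s • outwardNormal D (γ t) = γ u + s' • outwardNormal D (γ u)) :
    γ t = γ u ∧ s = s' := by
  have := hT.tube_le t u s s' hs hs'
  rw [h, sub_self, norm_zero, zero_pow two_ne_zero, mul_zero] at this
  constructor
  · refine sub_eq_zero.1 (norm_eq_zero.1 (pow_eq_zero_iff two_ne_zero |>.1 ?_))
    nlinarith [sq_nonneg ‖γ t - γ u‖, sq_nonneg (s - s')]
  · refine sub_eq_zero.1 (pow_eq_zero_iff two_ne_zero |>.1 ?_)
    nlinarith [sq_nonneg ‖γ t - γ u‖, sq_nonneg (s - s')]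

theorem injOn_offsetMap {ε : ℝ} (hε : |ε| ≤ δ) : Set.InjOn (offsetMap D ε) (frontier D) := by
  rw [← hD.range_eq]
  rintro _ ⟨t, rfl⟩ _ ⟨u, rfl⟩ h
  exact (eq_of_tube hT hε hε h).1

theorem transportDensity_offsetMap {ε : ℝ} (hε : |ε| ≤ δ) (φ : Plane → ℂ) (t : ℝ) :
    transportDensity D ε φ (offsetMap D ε (γ t)) = φ (γ t) := by
  rw [transportDensity, (hD.injOn_offsetMap hT hε).leftInvOn_invFunOn (hD.mem_frontier t)]

omit hT in
theorem hasDerivAt_offsetMap (ε t : ℝ) : HasDerivAt (fun t => offsetMap D ε (γ t))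
    ((1 + ε * signedCurvature D γ (γ t)) • deriv γ t) t := by
  have hF := hD.isArcFrame_outwardNormal
  refine ((hF.hasDerivAt t).add ((hF.hasDerivAt_n t).const_smul ε)).congr_deriv ?_
  module

omit hD in
theorem one_add_mul_pos {ε : ℝ} (hε : |ε| ≤ δ) (t : ℝ) :
    0 < 1 + ε * signedCurvature D γ (γ t) := by
  have h1 := hT.abs_τ_le t
  have h2 : |ε * signedCurvature D γ (γ t)| ≤ 1 / 2 := by
    rw [abs_mul]
    calc _ ≤ δ * K := by gcongr; exact hT.pos.le
      _ ≤ 1 / 2 := by linarith [hT.mul_le]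
  linarith [(abs_le.1 h2).1]

theorem norm_deriv_offsetMap {ε : ℝ} (hε : |ε| ≤ δ) (t : ℝ) :
    ‖deriv (fun t => offsetMap D ε (γ t)) t‖ = 1 + ε * signedCurvature D γ (γ t) := by
  rw [(hD.hasDerivAt_offsetMap ε t).deriv, norm_smul, hD.norm_deriv, mul_one,
    Real.norm_of_nonneg (one_add_mul_pos hT hε t).le]

/-- The coating has the same outward normals as the domain: by the inverse function theorem, the
points near `γ t + ε ν` have coordinates `(u, s)` in the tubular neighbourhood, they belong to the
coated domain if and only if `s < ε`, and `s - ε` is the component of the displacement along `ν` up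
to a quadratic error. -/
theorem isOutwardUnitNormal_coatedDomain {ε : ℝ} (h0 : 0 < ε) (hε : ε < δ) (t : ℝ) :
    IsOutwardUnitNormal (coatedDomain D ε) (γ t + ε • outwardNormal D (γ t))
      (outwardNormal D (γ t)) := by
  have hF := hD.isArcFrame_outwardNormal
  have hK := hT.one_le
  have hεa : |ε| ≤ δ := by rw [abs_of_pos h0]; exact hε.le
  refine ⟨(hD.isOutwardUnitNormal t).1, fun c hc => ?_⟩
  set n : ℝ → Plane := fun t => outwardNormal D (γ t) with hn
  set z := γ t + ε • n t with hz
  have hn' : ContDiff ℝ 1 n := by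
    refine contDiff_one_iff_deriv.2 ⟨fun t => (hF.hasDerivAt_n t).differentiableAt, ?_⟩
    have : deriv n = fun t => signedCurvature D γ (γ t) • deriv γ t :=
      funext fun t => (hF.hasDerivAt_n t).deriv
    rw [this]
    exact hF.continuous_τ.smul hF.continuous_T
  have hC : ContDiff ℝ 1 fun p : ℝ × ℝ => γ p.1 + p.2 • n p.1 :=
    ((hD.contDiff.of_le (by norm_num)).comp contDiff_fst).add
      (contDiff_snd.smul (hn'.comp contDiff_fst))
  have hst := hC.contDiffAt.hasStrictFDerivAt (x := (t, ε)) one_ne_zero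
  set ℓ := fderiv ℝ (fun p : ℝ × ℝ => γ p.1 + p.2 • n p.1) (t, ε) with hℓ
  have hℓ1 : ℓ (1, 0) = (1 + ε * signedCurvature D γ (γ t)) • deriv γ t := by
    have h1 : HasDerivAt (fun u : ℝ => (u, ε)) ((1 : ℝ), (0 : ℝ)) t :=
      (hasDerivAt_id t).prodMk (hasDerivAt_const t ε)
    have h2 : HasDerivAt ((fun p : ℝ × ℝ => γ p.1 + p.2 • n p.1) ∘ fun u : ℝ => (u, ε))
        (ℓ (1, 0)) t := hst.hasFDerivAt.comp_hasDerivAt t h1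
    exact h2.unique (hD.hasDerivAt_offsetMap ε t)
  have hℓ2 : ℓ (0, 1) = n t := by
    have h1 : HasDerivAt (fun s : ℝ => (t, s)) ((0 : ℝ), (1 : ℝ)) ε :=
      (hasDerivAt_const ε t).prodMk (hasDerivAt_id ε)
    have h2 : HasDerivAt (fun s : ℝ => γ t + s • n t) (n t) ε := by
      simpa using ((hasDerivAt_id ε).smul_const (n t)).const_add (γ t)
    have h3 : HasDerivAt (fun s => γ t + s • n t) (ℓ (0, 1)) ε :=
      hst.hasFDerivAt.comp_hasDerivAt ε h1
    exact h3.unique h2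
  have hsurj : ℓ.range = ⊤ := by
    refine LinearMap.range_eq_top.2 fun w => ?_
    have hp := (one_add_mul_pos hT hεa t).ne'
    set q := 1 + ε * signedCurvature D γ (γ t)
    set a : ℝ := inner ℝ w (deriv γ t)
    obtain ⟨σ, hσ, hσn⟩ := hD.exists_outwardNormal_eq
    set b : ℝ := inner ℝ w (rotate (deriv γ t))
    have hσ2 : σ * σ = 1 := by rcases hσ with rfl | rfl <;> norm_num
    have hw : w = a • deriv γ t + b • rotate (deriv γ t) := by
      have h1 := eq_inner_smul_rotate (v := deriv γ t) (w := w - a • deriv γ t)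
        (hD.norm_deriv t) (by
          rw [inner_sub_right, real_inner_smul_right, real_inner_self_eq_norm_sq, hD.norm_deriv,
            real_inner_comm]; simp [a])
      rw [inner_sub_left, real_inner_smul_left, inner_rotate_self, mul_zero, sub_zero] at h1
      rw [← h1]; abel
    refine ⟨(a / q, b * σ), ?_⟩
    have : ((a / q, b * σ) : ℝ × ℝ)
        = (a / q) • ((1 : ℝ), (0 : ℝ)) + (b * σ) • ((0 : ℝ), (1 : ℝ)) := by
      simp
    change ℓ (a / q, b * σ) = w
    rw [this, map_add, map_smul, map_smul, hℓ1, hℓ2, smul_smul, div_mul_cancel₀ _ hp]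
    rw [show n t = σ • rotate (deriv γ t) from hσn t, smul_smul, mul_assoc, hσ2, mul_one, ← hw]
  have hmap := hst.map_nhds_eq_of_surj hsurj
  change map _ _ = 𝓝 z at hmap
  rw [← hmap, eventually_map]
  have hs1 : ∀ᶠ p : ℝ × ℝ in 𝓝 (t, ε), 0 < p.2 ∧ p.2 < δ :=
    (continuous_snd.tendsto (t, ε)).eventually (Ioo_mem_nhds h0 hε)
  have hs2 : ∀ᶠ p : ℝ × ℝ in 𝓝 (t, ε), 2 * K ^ 2 * ‖γ p.1 + p.2 • n p.1 - z‖ < c := by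
    have hcont : Continuous fun p : ℝ × ℝ => 2 * K ^ 2 * ‖γ p.1 + p.2 • n p.1 - z‖ := by
      have := hC.continuous; fun_prop
    exact (hcont.tendsto (t, ε)).eventually (gt_mem_nhds (by simpa [hz] using hc))
  filter_upwards [hs1, hs2] with ⟨u, s⟩ ⟨hs0, hsδ⟩ hsm
  simp only at hs0 hsδ hsm ⊢
  have hsa : |s| ≤ δ := by rw [abs_of_pos hs0]; exact hsδ.le
  set w := γ u + s • n u - z with hw
  set r := ‖γ u - γ t‖ with hr
  have htube : r ^ 2 + (s - ε) ^ 2 ≤ K * ‖w‖ ^ 2 := hT.tube_le u t s ε hsa hεa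
  have hnn : ‖n t‖ = 1 := hF.norm_n t
  have hnormal : |inner ℝ w (n t) - (s - ε)| ≤ 2 * K * r ^ 2 := by
    have e1 : w = (γ u - γ t) + s • (n u - n t) + (s - ε) • n t := by rw [hw, hz]; module
    have e2 : inner ℝ w (n t) - (s - ε)
        = inner ℝ (γ u - γ t) (n t) + s * inner ℝ (n u - n t) (n t) := by
      rw [e1, inner_add_left, inner_add_left, real_inner_smul_left, real_inner_smul_left (n t),
        real_inner_self_eq_norm_sq, hnn]; ring
    have e3 : inner ℝ (n u - n t) (n t) = -(‖n u - n t‖ ^ 2 / 2) := by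
      rw [norm_sub_sq_real, inner_sub_left, real_inner_self_eq_norm_sq, hnn,
        show ‖n u‖ = 1 from hF.norm_n u]; ring
    have e4 : |inner ℝ (γ u - γ t) (n t)| ≤ K * r ^ 2 := by
      have := hT.abs_inner_le t u
      rwa [← neg_sub, inner_neg_left, abs_neg, norm_neg] at this
    have e5 : |s * inner ℝ (n u - n t) (n t)| ≤ K * r ^ 2 := by
      have h1 : ‖n u - n t‖ ^ 2 ≤ (K * r) ^ 2 := by gcongr; exact hT.norm_n_sub_le u t
      rw [e3, abs_mul, abs_neg, abs_of_nonneg (by positivity : 0 ≤ ‖n u - n t‖ ^ 2 / 2)]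
      calc |s| * (‖n u - n t‖ ^ 2 / 2) ≤ δ * ((K * r) ^ 2 / 2) := by
            have := hT.pos.le
            gcongr
        _ = (K * δ) * (K * r ^ 2) / 2 := by ring
        _ ≤ (1 / 2) * (K * r ^ 2) / 2 := by gcongr; exact hT.mul_le
        _ ≤ K * r ^ 2 := by nlinarith [mul_nonneg (by linarith : 0 ≤ K) (sq_nonneg r)]
    rw [e2]
    exact (abs_add_le _ _).trans (by linarith)
  have hquad : 2 * K * r ^ 2 ≤ c * ‖w‖ := by
    have : r ^ 2 ≤ K * ‖w‖ ^ 2 := by nlinarith [sq_nonneg (s - ε)]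
    calc 2 * K * r ^ 2 ≤ 2 * K * (K * ‖w‖ ^ 2) := by gcongr
      _ = (2 * K ^ 2 * ‖w‖) * ‖w‖ := by ring
      _ ≤ c * ‖w‖ := by gcongr
  have hb := abs_le.1 (hnormal.trans hquad)
  refine ⟨fun h => Or.inr ⟨γ u, hD.mem_frontier u, s, hs0.le, by linarith, rfl⟩, fun h => ?_⟩
  have hsε : ε < s := by linarith
  rintro (hmem | ⟨x, hx, s', h0', h1', he⟩)
  · exact hD.notMem_of_tube hT hs0 hsδ.le hmem
  · rw [← hD.range_eq] at hx
    obtain ⟨v, rfl⟩ := hx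
    have hs'a : |s'| ≤ δ := by rw [abs_of_nonneg h0']; linarith
    have := (eq_of_tube hT hsa hs'a he).2
    linarith

theorem outwardNormal_coatedDomain {ε : ℝ} (h0 : 0 < ε) (hε : ε < δ) (t : ℝ) :
    outwardNormal (coatedDomain D ε) (offsetMap D ε (γ t)) = outwardNormal D (γ t) :=
  (hD.isOutwardUnitNormal_coatedDomain hT h0 hε t).outwardNormal_eq

end Coating

end IsC2Domain

/-! ### Integral operators on an interval -/

section IntegralOperators

variable {L : ℝ}

theorem aestronglyMeasurable_kernel {κ : ℝ → ℝ → ℂ} (hκ : Measurable (Function.uncurry κ))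
    {f : ℝ → ℂ} {μ ν : Measure ℝ} [SFinite μ] [SFinite ν] (hf : AEStronglyMeasurable f ν) :
    AEStronglyMeasurable (fun p : ℝ × ℝ => κ p.1 p.2 * f p.2) (μ.prod ν) :=
  hκ.aestronglyMeasurable.mul hf.comp_snd

/-- A bounded kernel maps integrable functions to bounded, hence to square integrable, functions. -/
theorem memLp_integral_kernel {κ : ℝ → ℝ → ℂ} (hκ : Measurable (Function.uncurry κ)) {B : ℝ}
    (hB : ∀ t u, ‖κ t u‖ ≤ B) {f : ℝ → ℂ} (hf : Integrable f (volume.restrict (Set.Ioc 0 L))) :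
    MemLp (fun t => ∫ u in Set.Ioc 0 L, κ t u * f u) 2 (volume.restrict (Set.Ioc 0 L)) := by
  refine MemLp.of_bound
    (aestronglyMeasurable_kernel hκ hf.aestronglyMeasurable).integral_prod_right'
    (∫ u in Set.Ioc 0 L, B * ‖f u‖) (Eventually.of_forall fun t => ?_)
  refine norm_integral_le_of_norm_le (hf.norm.const_mul B) (Eventually.of_forall fun u => ?_)
  rw [norm_mul]
  gcongr
  exact hB t u

/-- If uniformly bounded kernels tend to zero pointwise, then the integral operators tend to zero
in `L²`, strongly. -/
theorem tendsto_eLpNorm_integral_kernel {κ : ℝ → ℝ → ℝ → ℂ} {l : Filter ℝ}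
    [l.IsCountablyGenerated] (hκ : ∀ ε, Measurable (Function.uncurry (κ ε))) {B : ℝ}
    (hB : ∀ᶠ ε in l, ∀ t u, ‖κ ε t u‖ ≤ B) (hlim : ∀ t u, Tendsto (fun ε => κ ε t u) l (𝓝 0))
    {f : ℝ → ℂ} (hf : Integrable f (volume.restrict (Set.Ioc 0 L))) :
    Tendsto (fun ε => eLpNorm (fun t => ∫ u in Set.Ioc 0 L, κ ε t u * f u) 2
      (volume.restrict (Set.Ioc 0 L))) l (𝓝 0) := by
  set μ : Measure ℝ := volume.restrict (Set.Ioc 0 L) with hμ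
  set b : ℝ := ∫ u, B * ‖f u‖ ∂μ with hb
  have hmeas : ∀ ε, AEStronglyMeasurable (fun t => ∫ u, κ ε t u * f u ∂μ) μ := fun ε =>
    (aestronglyMeasurable_kernel (hκ ε) hf.aestronglyMeasurable).integral_prod_right'
  have hint : ∀ t, Tendsto (fun ε => ∫ u, κ ε t u * f u ∂μ) l (𝓝 0) := fun t => by
    have := tendsto_integral_filter_of_dominated_convergence (μ := μ) (l := l)
      (F := fun ε u => κ ε t u * f u) (f := fun _ => (0 : ℂ)) (fun u => B * ‖f u‖)
      (Eventually.of_forall fun ε =>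
        ((hκ ε).comp measurable_prodMk_left).aestronglyMeasurable.mul hf.aestronglyMeasurable)
      (by
        filter_upwards [hB] with ε hε
        refine Eventually.of_forall fun u => ?_
        rw [norm_mul]
        gcongr
        exact hε t u)
      (hf.norm.const_mul B)
      (Eventually.of_forall fun u => by simpa using (hlim t u).mul_const (f u))
    simpa using this
  have hle : ∀ᶠ ε in l, ∀ t, ‖∫ u, κ ε t u * f u ∂μ‖ ≤ b := by
    filter_upwards [hB] with ε hε t
    refine norm_integral_le_of_norm_le (hf.norm.const_mul B) (Eventually.of_forall fun u => ?_)
    rw [norm_mul]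
    gcongr
    exact hε t u
  have hl : Tendsto (fun ε => ∫⁻ t, ‖∫ u, κ ε t u * f u ∂μ‖ₑ ^ (2 : ℝ) ∂μ) l (𝓝 0) := by
    have := tendsto_lintegral_filter_of_dominated_convergence' (μ := μ) (l := l)
      (F := fun ε t => ‖∫ u, κ ε t u * f u ∂μ‖ₑ ^ (2 : ℝ)) (f := fun _ => 0)
      (fun _ => ENNReal.ofReal b ^ (2 : ℝ))
      (Eventually.of_forall fun ε => (hmeas ε).enorm.pow_const 2)
      (by
        filter_upwards [hle] with ε hε
        refine Eventually.of_forall fun t => ?_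
        gcongr
        rw [← ofReal_norm]
        exact ENNReal.ofReal_le_ofReal (hε t))
      (by
        rw [lintegral_const]
        refine ENNReal.mul_ne_top (by simp) ?_
        rw [hμ]; simp)
      (Eventually.of_forall fun t => by
        have h1 := (hint t).enorm
        rw [enorm_zero] at h1
        have h2 := (ENNReal.continuous_rpow_const (y := (2 : ℝ))).tendsto 0
        rw [ENNReal.zero_rpow_of_pos (by norm_num)] at h2
        exact h2.comp h1)
    simpa using this
  have h2 := (ENNReal.continuous_rpow_const (y := (1 / 2 : ℝ))).tendsto 0
  rw [ENNReal.zero_rpow_of_pos (by norm_num)] at h2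
  refine (h2.comp hl).congr fun ε => ?_
  rw [eLpNorm_eq_lintegral_rpow_enorm_toReal two_ne_zero ENNReal.ofNat_ne_top]
  simp

/-- A measurable kernel `κ (t, u)` on `(0, L]²` whose integrals over `t` are bounded in `u`. -/
structure IsWeakKernel (L : ℝ) (κ : ℝ → ℝ → ℂ) : Prop where
  measurable : Measurable (Function.uncurry κ)
  integrable : ∀ u, Integrable (fun t => κ t u) (volume.restrict (Set.Ioc 0 L))
  exists_bound : ∃ B, ∀ u, ∫ t in Set.Ioc 0 L, ‖κ t u‖ ≤ B

theorem IsWeakKernel.of_bound {κ : ℝ → ℝ → ℂ} (hκ : Measurable (Function.uncurry κ)) {B : ℝ}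
    (hB : ∀ t u, ‖κ t u‖ ≤ B) : IsWeakKernel L κ := by
  have hi : ∀ u, Integrable (fun t => κ t u) (volume.restrict (Set.Ioc 0 L)) := fun u =>
    Integrable.of_bound (hκ.comp measurable_prodMk_right).aestronglyMeasurable B
      (Eventually.of_forall fun t => hB t u)
  refine ⟨hκ, hi, ∫ _ in Set.Ioc 0 L, B, fun u => ?_⟩
  exact integral_mono (hi u).norm (integrable_const B) fun t => hB t u

theorem IsWeakKernel.integrable_mul {κ : ℝ → ℝ → ℂ} (hκ : IsWeakKernel L κ) {ψ : ℝ → ℂ}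
    (hψ : Continuous ψ) (u : ℝ) :
    Integrable (fun t => κ t u * ψ t) (volume.restrict (Set.Ioc 0 L)) := by
  obtain ⟨R, hR⟩ := (isCompact_Icc (a := (0 : ℝ)) (b := L)).exists_bound_of_continuousOn
    hψ.continuousOn
  refine (hκ.integrable u).mul_bdd (c := R) hψ.aestronglyMeasurable ?_
  filter_upwards [ae_restrict_mem measurableSet_Ioc] with t ht
    using hR t (Set.Ioc_subset_Icc_self ht)

/-- Fubini's theorem for the pairing of an integral operator with a continuous function. -/
theorem IsWeakKernel.integral_swap {κ : ℝ → ℝ → ℂ} (hκ : IsWeakKernel L κ) {ψ : ℝ → ℂ}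
    (hψ : Continuous ψ) {f : ℝ → ℂ} (hf : Integrable f (volume.restrict (Set.Ioc 0 L))) :
    Integrable (fun u => (∫ t in Set.Ioc 0 L, κ t u * ψ t) * f u)
      (volume.restrict (Set.Ioc 0 L)) ∧
    ∫ t in Set.Ioc 0 L, (∫ u in Set.Ioc 0 L, κ t u * f u) * ψ t =
      ∫ u in Set.Ioc 0 L, (∫ t in Set.Ioc 0 L, κ t u * ψ t) * f u := by
  set μ : Measure ℝ := volume.restrict (Set.Ioc 0 L) with hμ
  obtain ⟨B, hB⟩ := hκ.exists_bound
  obtain ⟨R, hR⟩ := (isCompact_Icc (a := (0 : ℝ)) (b := L)).exists_bound_of_continuousOn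
    hψ.continuousOn
  have hψR : ∀ᵐ t ∂μ, ‖ψ t‖ ≤ R := by
    filter_upwards [ae_restrict_mem measurableSet_Ioc] with t ht
      using hR t (Set.Ioc_subset_Icc_self ht)
  have hm : AEStronglyMeasurable (fun p : ℝ × ℝ => κ p.1 p.2 * ψ p.1 * f p.2) (μ.prod μ) :=
    (hκ.measurable.aestronglyMeasurable.mul
      (hψ.comp continuous_fst).aestronglyMeasurable).mul hf.aestronglyMeasurable.comp_snd
  have hi : Integrable (fun p : ℝ × ℝ => κ p.1 p.2 * ψ p.1 * f p.2) (μ.prod μ) := by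
    rw [integrable_prod_iff' hm]
    refine ⟨Eventually.of_forall fun u => (hκ.integrable_mul hψ u).mul_const (f u), ?_⟩
    refine (hf.norm.const_mul (|R| * |B|)).mono' hm.norm.prod_swap.integral_prod_right'
      (Eventually.of_forall fun u => ?_)
    rw [Real.norm_of_nonneg (integral_nonneg fun t => norm_nonneg _)]
    calc ∫ t, ‖κ t u * ψ t * f u‖ ∂μ ≤ ∫ t, ‖κ t u‖ * (|R| * ‖f u‖) ∂μ := by
          refine integral_mono_ae ((hκ.integrable_mul hψ u).mul_const _).norm
            ((hκ.integrable u).norm.mul_const _) ?_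
          filter_upwards [hψR] with t ht
          rw [norm_mul, norm_mul, mul_assoc]
          gcongr
          exact ht.trans (le_abs_self R)
      _ = (∫ t, ‖κ t u‖ ∂μ) * (|R| * ‖f u‖) := integral_mul_const _ _
      _ ≤ |B| * (|R| * ‖f u‖) := by gcongr; exact (hB u).trans (le_abs_self B)
      _ = |R| * |B| * ‖f u‖ := by ring
  refine ⟨?_, ?_⟩
  · refine hi.integral_prod_right.congr (Eventually.of_forall fun u => ?_)
    exact integral_mul_const (f u) _
  · calc _ = ∫ t, ∫ u, κ t u * ψ t * f u ∂μ ∂μ := by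
          refine integral_congr_ae (Eventually.of_forall fun t => ?_)
          simp only
          rw [← integral_mul_const]
          refine integral_congr_ae (Eventually.of_forall fun u => ?_)
          simp only; ring
      _ = ∫ u, ∫ t, κ t u * ψ t * f u ∂μ ∂μ := integral_integral_swap hi
      _ = _ := by
          refine integral_congr_ae (Eventually.of_forall fun u => ?_)
          exact integral_mul_const _ _

end IntegralOperators

section PoissonKernel

/-- Rescaling by `t = u + |s| w` of the kernels `|s| / (s² + c (t - u)²)`. -/
theorem integral_poisson (h : ℝ → ℝ) (c u : ℝ) {s : ℝ} (hs : s ≠ 0) :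
    ∫ t, h t * (|s| / (s ^ 2 + c * (t - u) ^ 2)) = ∫ w, h (u + |s| * w) / (1 + c * w ^ 2) := by
  have hs0 : 0 < |s| := abs_pos.2 hs
  have h1 := integral_add_left_eq_self (μ := (volume : Measure ℝ))
    (fun t => h t * (|s| / (s ^ 2 + c * (t - u) ^ 2))) u
  have h2 := Measure.integral_comp_mul_left
    (fun v => h (u + v) * (|s| / (s ^ 2 + c * (u + v - u) ^ 2))) |s|
  rw [← h1]
  rw [abs_inv, abs_abs, smul_eq_mul, eq_inv_mul_iff_mul_eq₀ hs0.ne'] at h2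
  rw [← h2, ← integral_const_mul]
  congr 1
  funext w
  have e : s ^ 2 + c * (u + |s| * w - u) ^ 2 = |s| ^ 2 * (1 + c * w ^ 2) := by
    rw [← sq_abs s]; ring
  rw [e]
  by_cases hz : 1 + c * w ^ 2 = 0
  · simp [hz]
  · field_simp

theorem integrable_inv_one_add_mul_sq {c : ℝ} (hc : 0 < c) :
    Integrable fun w : ℝ => (1 + c * w ^ 2)⁻¹ := by
  have h := integrable_inv_one_add_sq.comp_mul_left' (Real.sqrt_pos.2 hc).ne'
  refine h.congr (Eventually.of_forall fun w => ?_)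
  simp only [mul_pow, Real.sq_sqrt hc.le]

theorem integrable_poisson {h : ℝ → ℝ} (hh : Continuous h) {B : ℝ} (hB : ∀ t, |h t| ≤ B)
    {c : ℝ} (hc : 0 < c) (u : ℝ) {s : ℝ} (hs : s ≠ 0) :
    Integrable fun t => h t * (|s| / (s ^ 2 + c * (t - u) ^ 2)) := by
  have hs2 : 0 < s ^ 2 := by positivity
  have h1 : Integrable fun t : ℝ => |s| / s ^ 2 * (1 + c / s ^ 2 * (t - u) ^ 2)⁻¹ :=
    ((integrable_inv_one_add_mul_sq (div_pos hc hs2)).comp_sub_right u).const_mul _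
  refine (h1.bdd_mul (c := B) hh.aestronglyMeasurable
    (Eventually.of_forall fun t => by simpa using hB t)).congr (Eventually.of_forall fun t => ?_)
  have : 0 < s ^ 2 + c * (t - u) ^ 2 := by positivity
  simp only
  field_simp

/-- The kernels `|s| / (s² + c (t - u)²)` are an approximate identity, up to a constant. -/
theorem tendsto_integral_poisson {h : ℝ → ℝ} (hh : Continuous h) {B : ℝ} (hB : ∀ t, |h t| ≤ B)
    {c : ℝ} (hc : 0 < c) (u : ℝ) (h0 : h u = 0) :
    Tendsto (fun s : ℝ => ∫ t, h t * (|s| / (s ^ 2 + c * (t - u) ^ 2))) (𝓝[≠] 0) (𝓝 0) := by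
  have hlim : Tendsto (fun s : ℝ => ∫ w, h (u + |s| * w) / (1 + c * w ^ 2)) (𝓝[≠] 0) (𝓝 0) := by
    have := tendsto_integral_filter_of_dominated_convergence (μ := volume) (l := 𝓝[≠] (0 : ℝ))
      (F := fun s w => h (u + |s| * w) / (1 + c * w ^ 2)) (f := fun _ => (0 : ℝ))
      (fun w => B * (1 + c * w ^ 2)⁻¹)
      (Eventually.of_forall fun s => by
        refine Continuous.aestronglyMeasurable (Continuous.div (by fun_prop) (by fun_prop) ?_)
        intro w
        have : 0 < 1 + c * w ^ 2 := by positivity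
        exact this.ne')
      (Eventually.of_forall fun s => Eventually.of_forall fun w => by
        have : 0 < 1 + c * w ^ 2 := by positivity
        rw [norm_div, Real.norm_of_nonneg this.le, div_eq_mul_inv]
        gcongr
        exact hB _)
      ((integrable_inv_one_add_mul_sq hc).const_mul B)
      (Eventually.of_forall fun w => by
        have hcont : Continuous fun s : ℝ => h (u + |s| * w) / (1 + c * w ^ 2) := by
          fun_prop
        have := (hcont.tendsto 0).mono_left (nhdsWithin_le_nhds (s := {0}ᶜ))
        simpa [h0] using this)
    simpa using this
  refine hlim.congr' ?_
  filter_upwards [self_mem_nhdsWithin] with s hs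
  exact (integral_poisson h c u hs).symm

/-- The convolution with these kernels is bounded uniformly in `s` and `u`. -/
theorem integral_poisson_le {h : ℝ → ℝ} (hh : Continuous h) {B : ℝ} (hB : ∀ t, |h t| ≤ B)
    {c : ℝ} (hc : 0 < c) (u : ℝ) {s : ℝ} (hs : s ≠ 0) :
    ∫ t, h t * (|s| / (s ^ 2 + c * (t - u) ^ 2)) ≤ B * ∫ w, (1 + c * w ^ 2)⁻¹ := by
  have e : ∫ w : ℝ, (1 + c * w ^ 2)⁻¹ = ∫ t, 1 * (|s| / (s ^ 2 + c * (t - u) ^ 2)) := by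
    rw [integral_poisson (fun _ => 1) c u hs]; simp
  rw [e, ← integral_const_mul]
  refine integral_mono (integrable_poisson hh hB hc u hs)
    ((integrable_poisson continuous_const (B := 1) (by simp) hc u hs).const_mul B) fun t => ?_
  have : 0 < s ^ 2 + c * (t - u) ^ 2 := by positivity
  simp only [one_mul]
  gcongr
  exact (le_abs_self _).trans (hB t)

end PoissonKernel

/-! ### Kernels on a closed curve and the expansion of the Neumann–Poincaré operator -/

/-- The kernel of the Neumann–Poincaré operator of the curve at distance `ε` from `γ`, expressed in
terms of the parameters `t`, `u` of `γ`. For `ε = 0` this is the operator of `γ` itself. -/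
def coatedKernel (G₁ : ℝ → ℂ) (γ n : ℝ → Plane) (τ : ℝ → ℝ) (ε t u : ℝ) : ℂ :=
  ((1 + ε * τ u : ℝ) : ℂ) * radialGrad G₁ (γ t - γ u + ε • (n t - n u)) (n t)

/-- The derivative of `coatedKernel` with respect to `ε`. -/
def coatedKernelDeriv (G₁ G₂ : ℝ → ℂ) (γ n : ℝ → Plane) (τ : ℝ → ℝ) (ε t u : ℝ) : ℂ :=
  (τ u : ℂ) * radialGrad G₁ (γ t - γ u + ε • (n t - n u)) (n t) +
    ((1 + ε * τ u : ℝ) : ℂ) * radialHess G₁ G₂ (γ t - γ u + ε • (n t - n u)) (n t) (n t - n u)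

section CurveGeometry

variable {L : ℝ} {γ T n : ℝ → Plane} {τ : ℝ → ℝ} {K δ : ℝ}

theorem IsArcFrame.inner_eq (hF : IsArcFrame L γ T n τ) (t : ℝ) (x y : Plane) :
    inner ℝ x y = inner ℝ x (T t) * inner ℝ y (T t) + inner ℝ x (n t) * inner ℝ y (n t) := by
  have h1 := hF.inner_frame (x + y) t t
  have h2 := hF.inner_frame x t t
  have h3 := hF.inner_frame y t t
  rw [real_inner_self_eq_norm_sq, hF.norm_T] at h1 h2 h3
  rw [norm_add_sq_real] at h1
  simp only [inner_add_left] at h1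
  linarith

theorem IsArcFrame.inner_n_sub (hF : IsArcFrame L γ T n τ) (t u : ℝ) :
    inner ℝ (n t) (n t - n u) = ‖n t - n u‖ ^ 2 / 2 := by
  rw [norm_sub_sq_real, inner_sub_right, real_inner_self_eq_norm_sq, hF.norm_n, hF.norm_n]; ring

theorem IsArcFrame.inner_T_sub (hF : IsArcFrame L γ T n τ) (t u : ℝ) :
    inner ℝ (T t) (T t - T u) = ‖T t - T u‖ ^ 2 / 2 := by
  rw [norm_sub_sq_real, inner_sub_right, real_inner_self_eq_norm_sq, hF.norm_T, hF.norm_T]; ring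

theorem IsArcFrame.countable_eq (hF : IsArcFrame L γ T n τ) (u : ℝ) :
    {t | γ t = γ u}.Countable := by
  refine (Set.countable_range fun m : ℤ => u + m * L).mono fun t ht => ?_
  obtain ⟨m, hm⟩ := hF.eq_add_of_eq t u ht
  exact ⟨m, hm.symm⟩

theorem IsArcFrame.ae_ne (hF : IsArcFrame L γ T n τ) (u : ℝ) (μ : Measure ℝ)
    [NullSingletonClass μ] :
    ∀ᵐ t ∂μ, γ t ≠ γ u :=
  (hF.countable_eq u).ae_notMem μ

namespace IsTube

variable (hF : IsArcFrame L γ T n τ) (hT : IsTube L γ T n τ K δ)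

include hT

theorem abs_inner_le' (t u : ℝ) : |inner ℝ (γ t - γ u) (n u)| ≤ K * ‖γ t - γ u‖ ^ 2 := by
  have := hT.abs_inner_le u t
  rwa [← neg_sub, inner_neg_left, abs_neg, norm_neg] at this

theorem n_eq_of_eq {t u : ℝ} (h : γ t = γ u) : n t = n u := by
  have := hT.norm_n_sub_le t u
  rw [h, sub_self, norm_zero, mul_zero] at this
  exact sub_eq_zero.1 (norm_le_zero_iff.1 this)

theorem sq_le_offset {ε : ℝ} (hε : |ε| ≤ δ) (t u : ℝ) :
    ‖γ t - γ u‖ ^ 2 ≤ K * ‖γ t - γ u + ε • (n t - n u)‖ ^ 2 := by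
  have h := hT.tube_le t u ε ε hε hε
  rw [show γ t + ε • n t - (γ u + ε • n u) = γ t - γ u + ε • (n t - n u) by module] at h
  simpa using h

theorem sq_offset_le {ε : ℝ} (hε : |ε| ≤ δ) (t u : ℝ) :
    ‖γ t - γ u + ε • (n t - n u)‖ ^ 2 ≤ K := by
  have h := hT.diam_le t u ε ε hε hε
  rwa [show γ t + ε • n t - (γ u + ε • n u) = γ t - γ u + ε • (n t - n u) by module] at h

theorem norm_le_offset {ε : ℝ} (hε : |ε| ≤ δ) (t u : ℝ) :
    ‖γ t - γ u‖ ≤ K * ‖γ t - γ u + ε • (n t - n u)‖ := by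
  have h := hT.sq_le_offset hε t u
  have hK := hT.one_le
  refine abs_le_of_sq_le_sq' (h.trans ?_) (by positivity) |>.2
  rw [mul_pow]
  gcongr
  nlinarith

theorem offset_ne_zero {ε : ℝ} (hε : |ε| ≤ δ) {t u : ℝ} (h : γ t ≠ γ u) :
    γ t - γ u + ε • (n t - n u) ≠ 0 := fun h0 => by
  have h1 := hT.norm_le_offset hε t u
  rw [h0, norm_zero, mul_zero] at h1
  exact h (sub_eq_zero.1 (norm_le_zero_iff.1 h1))

include hF

/-- The numerator of the Neumann–Poincaré kernel of a parallel curve is of second order. -/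
theorem abs_inner_offset_le {ε : ℝ} (hε : |ε| ≤ δ) (t u : ℝ) :
    |inner ℝ (γ t - γ u + ε • (n t - n u)) (n t)|
      ≤ 2 * K ^ 2 * ‖γ t - γ u + ε • (n t - n u)‖ ^ 2 := by
  have hK := hT.one_le
  have h1 := hT.abs_inner_le t u
  have h2 := hT.norm_n_sub_le t u
  have h3 := hT.sq_le_offset hε t u
  have hδ := hT.pos
  set r := ‖γ t - γ u‖
  have e : inner ℝ (γ t - γ u + ε • (n t - n u)) (n t)
      = inner ℝ (γ t - γ u) (n t) + ε * (‖n t - n u‖ ^ 2 / 2) := by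
    rw [inner_add_left, real_inner_smul_left, real_inner_comm (n t) (n t - n u),
      hF.inner_n_sub]
  have h4 : |ε * (‖n t - n u‖ ^ 2 / 2)| ≤ K * r ^ 2 := by
    rw [abs_mul, abs_of_nonneg (by positivity : 0 ≤ ‖n t - n u‖ ^ 2 / 2)]
    calc |ε| * (‖n t - n u‖ ^ 2 / 2) ≤ δ * ((K * r) ^ 2 / 2) := by gcongr
      _ = (K * δ) * (K * r ^ 2) / 2 := by ring
      _ ≤ (1 / 2) * (K * r ^ 2) / 2 := by gcongr; exact hT.mul_le
      _ ≤ K * r ^ 2 := by nlinarith [mul_nonneg (by linarith : 0 ≤ K) (sq_nonneg r)]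
  rw [e]
  calc _ ≤ K * r ^ 2 + K * r ^ 2 := (abs_add_le _ _).trans (add_le_add h1 h4)
    _ = 2 * K * r ^ 2 := by ring
    _ ≤ 2 * K * (K * ‖γ t - γ u + ε • (n t - n u)‖ ^ 2) := by gcongr
    _ = _ := by ring

omit hF in
theorem abs_inner_offset_sub_le {ε : ℝ} (hε : |ε| ≤ δ) (t u : ℝ) :
    |inner ℝ (γ t - γ u + ε • (n t - n u)) (n t - n u)|
      ≤ K ^ 2 * ‖γ t - γ u + ε • (n t - n u)‖ ^ 2 := by
  have hK := hT.one_le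
  have h1 := hT.norm_le_offset hε t u
  set Y := γ t - γ u + ε • (n t - n u)
  calc _ ≤ ‖Y‖ * ‖n t - n u‖ := abs_real_inner_le_norm _ _
    _ ≤ ‖Y‖ * (K * (K * ‖Y‖)) := by
      gcongr
      exact (hT.norm_n_sub_le t u).trans (by gcongr)
    _ = _ := by ring

theorem abs_inner_n_sub_le {ε : ℝ} (hε : |ε| ≤ δ) (t u : ℝ) :
    |inner ℝ (n t) (n t - n u)| ≤ K ^ 4 * ‖γ t - γ u + ε • (n t - n u)‖ ^ 2 := by
  have hK := hT.one_le
  have h1 := hT.norm_le_offset hε t u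
  have h2 := hT.norm_n_sub_le t u
  set Y := γ t - γ u + ε • (n t - n u)
  rw [hF.inner_n_sub, abs_of_nonneg (by positivity)]
  calc ‖n t - n u‖ ^ 2 / 2 ≤ ‖n t - n u‖ ^ 2 := by linarith [sq_nonneg ‖n t - n u‖]
    _ ≤ (K * (K * ‖Y‖)) ^ 2 := by gcongr; exact h2.trans (by gcongr)
    _ = _ := by ring

/-- The tangent turns slowly along a chord: `⟪γ t - γ u, T u - T t⟫` is of third order. -/
theorem abs_inner_T_sub_le (t u : ℝ) :
    |inner ℝ (γ t - γ u) (T u - T t)| ≤ 2 * K ^ 2 * ‖γ t - γ u‖ ^ 3 := by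
  have hK := hT.one_le
  have h1 := hT.abs_inner_le' t u
  have h2 := hT.norm_T_sub_le u t
  rw [norm_sub_rev (γ u)] at h2
  set r := ‖γ t - γ u‖
  have hr : 0 ≤ r := norm_nonneg _
  rw [hF.inner_eq u]
  have e1 : inner ℝ (T u - T t) (T u) = ‖T u - T t‖ ^ 2 / 2 := by
    rw [real_inner_comm, hF.inner_T_sub]
  have h3 : |inner ℝ (γ t - γ u) (T u)| ≤ r := by
    refine (abs_real_inner_le_norm _ _).trans ?_
    rw [hF.norm_T, mul_one]
  have h4 : |inner ℝ (T u - T t) (n u)| ≤ K * r := by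
    refine (abs_real_inner_le_norm _ _).trans ?_
    rwa [hF.norm_n, mul_one]
  have h5 : |inner ℝ (T u - T t) (T u)| ≤ (K * r) ^ 2 := by
    rw [e1, abs_of_nonneg (by positivity)]
    calc ‖T u - T t‖ ^ 2 / 2 ≤ ‖T u - T t‖ ^ 2 := by linarith [sq_nonneg ‖T u - T t‖]
      _ ≤ _ := by gcongr
  refine (abs_add_le _ _).trans ?_
  rw [abs_mul, abs_mul]
  calc _ ≤ r * (K * r) ^ 2 + K * r ^ 2 * (K * r) := by gcongr
    _ = _ := by ring

end IsTube

end CurveGeometry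

section Kernels

variable {k : ℝ} {G G₁ G₂ : ℝ → ℂ} {L : ℝ} {γ T n : ℝ → Plane} {τ : ℝ → ℝ} {K δ C : ℝ}

theorem radialGrad_zero_left (G₁ : ℝ → ℂ) (a : Plane) : radialGrad G₁ 0 a = 0 := by
  simp [radialGrad]

theorem radialHess_zero_right (G₁ G₂ : ℝ → ℂ) (x a : Plane) : radialHess G₁ G₂ x a 0 = 0 := by
  simp [radialHess]

section Bounds

variable (hF : IsArcFrame L γ T n τ) (hT : IsTube L γ T n τ K δ) (hB : RadialBound G G₁ G₂ K C)

include hF hT hB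

theorem norm_radialGrad_offset_le {ε : ℝ} (hε : |ε| ≤ δ) (t u : ℝ) :
    ‖radialGrad G₁ (γ t - γ u + ε • (n t - n u)) (n t)‖ ≤ 4 * C * K ^ 2 := by
  have hC := hB.nonneg
  by_cases h : γ t = γ u
  · rw [h, hT.n_eq_of_eq h, sub_self, sub_self, smul_zero, add_zero, radialGrad_zero_left,
      norm_zero]
    positivity
  · have h0 := norm_pos_iff.2 (hT.offset_ne_zero hε h)
    refine (hB.norm_radialGrad_le (hT.offset_ne_zero hε h) (hT.sq_offset_le hε t u)).trans ?_
    rw [div_le_iff₀ (by positivity)]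
    calc _ ≤ 2 * C * (2 * K ^ 2 * ‖γ t - γ u + ε • (n t - n u)‖ ^ 2) := by
          gcongr; exact hT.abs_inner_offset_le hF hε t u
      _ = _ := by ring

theorem norm_radialHess_offset_le {ε : ℝ} (hε : |ε| ≤ δ) (t u : ℝ) :
    ‖radialHess G₁ G₂ (γ t - γ u + ε • (n t - n u)) (n t) (n t - n u)‖ ≤ 10 * C * K ^ 4 := by
  have hC := hB.nonneg
  by_cases h : γ t = γ u
  · rw [hT.n_eq_of_eq h, sub_self, radialHess_zero_right, norm_zero]
    positivity
  · have h0 := norm_pos_iff.2 (hT.offset_ne_zero hε h)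
    refine (hB.norm_radialHess_le (hT.offset_ne_zero hε h) (hT.sq_offset_le hε t u)).trans ?_
    have h1 := hT.abs_inner_offset_le hF hε t u
    have h2 := hT.abs_inner_offset_sub_le hε t u
    have h3 := hT.abs_inner_n_sub_le hF hε t u
    set Y := γ t - γ u + ε • (n t - n u)
    calc _ ≤ 2 * C * (K ^ 4 * ‖Y‖ ^ 2) / ‖Y‖ ^ 2
          + 4 * C * (2 * K ^ 2 * ‖Y‖ ^ 2 * (K ^ 2 * ‖Y‖ ^ 2)) / (‖Y‖ ^ 2) ^ 2 := by gcongr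
      _ = _ := by field_simp; ring

omit hF hB in
theorem IsTube.abs_one_add_le {ε : ℝ} (hε : |ε| ≤ δ) (u : ℝ) : |1 + ε * τ u| ≤ 2 := by
  have h2 : |ε * τ u| ≤ 1 / 2 := by
    rw [abs_mul]
    calc _ ≤ δ * K := by
          gcongr
          · exact hT.pos.le
          · exact hT.abs_τ_le u
      _ ≤ 1 / 2 := by linarith [hT.mul_le]
  refine (abs_add_le _ _).trans ?_
  rw [abs_one]; linarith

theorem norm_coatedKernel_le {ε : ℝ} (hε : |ε| ≤ δ) (t u : ℝ) :
    ‖coatedKernel G₁ γ n τ ε t u‖ ≤ 8 * C * K ^ 2 := by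
  rw [coatedKernel, norm_mul, Complex.norm_real, Real.norm_eq_abs]
  calc _ ≤ 2 * (4 * C * K ^ 2) := by
        gcongr
        · exact hT.abs_one_add_le hε u
        · exact norm_radialGrad_offset_le hF hT hB hε t u
    _ = _ := by ring

theorem norm_coatedKernelDeriv_le {ε : ℝ} (hε : |ε| ≤ δ) (t u : ℝ) :
    ‖coatedKernelDeriv G₁ G₂ γ n τ ε t u‖ ≤ K * (4 * C * K ^ 2) + 2 * (10 * C * K ^ 4) := by
  have hK := hT.one_le
  refine (norm_add_le _ _).trans ?_
  rw [norm_mul, norm_mul, Complex.norm_real, Real.norm_eq_abs, Complex.norm_real, Real.norm_eq_abs]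
  gcongr
  · exact hT.abs_τ_le u
  · exact norm_radialGrad_offset_le hF hT hB hε t u
  · exact hT.abs_one_add_le hε u
  · exact norm_radialHess_offset_le hF hT hB hε t u

end Bounds

/-- On the diagonal the kernels vanish, because the inner products in them do; the value there is
irrelevant for the integrals. -/
theorem coatedKernel_of_eq (hT : IsTube L γ T n τ K δ) {t u : ℝ} (h : γ t = γ u) (ε : ℝ) :
    coatedKernel G₁ γ n τ ε t u = 0 := by
  rw [coatedKernel, h, hT.n_eq_of_eq h, sub_self, sub_self, smul_zero, add_zero,
    radialGrad_zero_left, mul_zero]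

theorem coatedKernelDeriv_of_eq (hT : IsTube L γ T n τ K δ) {t u : ℝ} (h : γ t = γ u) (ε : ℝ) :
    coatedKernelDeriv G₁ G₂ γ n τ ε t u = 0 := by
  rw [coatedKernelDeriv, h, hT.n_eq_of_eq h, sub_self, sub_self, smul_zero, add_zero,
    radialGrad_zero_left, mul_zero, radialHess_zero_right, mul_zero, add_zero]

theorem hasDerivAt_coatedKernel (hG : IsRadialSolution k G G₁ G₂) (hT : IsTube L γ T n τ K δ)
    {ε : ℝ} (hε : |ε| ≤ δ) (t u : ℝ) :
    HasDerivAt (fun ε => coatedKernel G₁ γ n τ ε t u) (coatedKernelDeriv G₁ G₂ γ n τ ε t u) ε := by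
  by_cases h : γ t = γ u
  · rw [coatedKernelDeriv_of_eq hT h]
    exact (hasDerivAt_const ε (0 : ℂ)).congr_of_eventuallyEq
      (Eventually.of_forall fun ε => coatedKernel_of_eq hT h ε)
  · have h1 : HasDerivAt (fun ε : ℝ => γ t - γ u + ε • (n t - n u)) (n t - n u) ε := by
      simpa using ((hasDerivAt_id ε).smul_const (n t - n u)).const_add (γ t - γ u)
    have h2 := hG.hasDerivAt_radialGrad_comp h1 (hasDerivAt_const ε (n t))
      (hT.offset_ne_zero hε h)
    have h3 : HasDerivAt (fun ε : ℝ => ((1 + ε * τ u : ℝ) : ℂ)) (τ u : ℂ) ε := by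
      have : HasDerivAt (fun ε : ℝ => 1 + ε * τ u) (τ u) ε := by
        simpa using ((hasDerivAt_id ε).mul_const (τ u)).const_add 1
      exact this.ofReal_comp
    refine (h3.mul h2).congr_deriv ?_
    simp [coatedKernelDeriv, radialGrad]

theorem measurable_coatedKernel (hG : IsRadialSolution k G G₁ G₂) (hF : IsArcFrame L γ T n τ)
    (ε : ℝ) : Measurable (Function.uncurry (coatedKernel G₁ γ n τ ε)) := by
  have h1 := hF.continuous
  have h2 := hF.continuous_n
  have h3 := hF.continuous_τ
  refine Measurable.mul ?_ (measurable_radialGrad hG.measurable₁ ?_ ?_)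
  · exact Continuous.measurable (by fun_prop)
  · exact Continuous.measurable (by fun_prop)
  · exact Continuous.measurable (by fun_prop)

theorem measurable_coatedKernelDeriv (hG : IsRadialSolution k G G₁ G₂) (hF : IsArcFrame L γ T n τ)
    (ε : ℝ) : Measurable (Function.uncurry (coatedKernelDeriv G₁ G₂ γ n τ ε)) := by
  have h1 := hF.continuous
  have h2 := hF.continuous_n
  have h3 := hF.continuous_τ
  refine Measurable.add (Measurable.mul ?_ (measurable_radialGrad hG.measurable₁ ?_ ?_))
    (Measurable.mul ?_ (measurable_radialHess hG.measurable₁ hG.measurable₂ ?_ ?_ ?_)) <;>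
  exact Continuous.measurable (by fun_prop)

/-- The expansion of the Neumann–Poincaré operators of the parallel curves to first order: the
difference quotients of the kernels are bounded and converge pointwise. -/
theorem tendsto_coatedKernel_expansion (hG : IsRadialSolution k G G₁ G₂)
    (hF : IsArcFrame L γ T n τ) (hT : IsTube L γ T n τ K δ) {f : ℝ → ℂ}
    (hf : Integrable f (volume.restrict (Set.Ioc 0 L))) :
    Tendsto (fun ε : ℝ => eLpNorm (fun t =>
        (∫ u in Set.Ioc 0 L, coatedKernel G₁ γ n τ ε t u * f u) -
          ((∫ u in Set.Ioc 0 L, coatedKernel G₁ γ n τ 0 t u * f u) +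
            (ε : ℂ) * ∫ u in Set.Ioc 0 L, coatedKernelDeriv G₁ G₂ γ n τ 0 t u * f u)) 2
        (volume.restrict (Set.Ioc 0 L)) / ENNReal.ofReal ε) (𝓝[>] 0) (𝓝 0) := by
  obtain ⟨C, hB⟩ := hG.exists_radialBound K
  set μ : Measure ℝ := volume.restrict (Set.Ioc 0 L) with hμ
  set B := K * (4 * C * K ^ 2) + 2 * (10 * C * K ^ 4) with hBdef
  have hδ := hT.pos
  have h00 : |(0 : ℝ)| ≤ δ := by simpa using hδ.le
  set R : ℝ → ℝ → ℝ → ℂ := fun ε t u => (ε : ℂ)⁻¹ * (coatedKernel G₁ γ n τ ε t u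
    - coatedKernel G₁ γ n τ 0 t u) - coatedKernelDeriv G₁ G₂ γ n τ 0 t u with hR
  have hRm : ∀ ε, Measurable (Function.uncurry (R ε)) := fun ε =>
    (((measurable_coatedKernel hG hF ε).sub (measurable_coatedKernel hG hF 0)).const_mul _).sub
      (measurable_coatedKernelDeriv hG hF 0)
  have hsmall : ∀ᶠ ε in 𝓝[>] (0 : ℝ), 0 < ε ∧ ε ≤ δ := by
    filter_upwards [Ioc_mem_nhdsGT hδ] with s hs using hs
  have hRB : ∀ᶠ ε in 𝓝[>] (0 : ℝ), ∀ t u, ‖R ε t u‖ ≤ B + B := by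
    filter_upwards [hsmall] with ε ⟨h0, h1⟩ t u
    have hmv := (convex_Icc (0 : ℝ) ε).norm_image_sub_le_of_norm_hasDerivWithin_le
      (f := fun ε => coatedKernel G₁ γ n τ ε t u)
      (fun x hx => (hasDerivAt_coatedKernel hG hT (by
        rw [abs_of_nonneg hx.1]; exact hx.2.trans h1) t u).hasDerivWithinAt)
      (fun x hx => norm_coatedKernelDeriv_le hF hT hB (by
        rw [abs_of_nonneg hx.1]; exact hx.2.trans h1) t u)
      (Set.left_mem_Icc.2 h0.le) (Set.right_mem_Icc.2 h0.le)
    rw [sub_zero, Real.norm_of_nonneg h0.le] at hmv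
    refine (norm_sub_le _ _).trans (add_le_add ?_ (norm_coatedKernelDeriv_le hF hT hB h00 t u))
    rw [norm_mul, norm_inv, Complex.norm_real, Real.norm_of_nonneg h0.le, inv_mul_le_iff₀ h0,
      mul_comm ε]
    exact hmv
  have hRlim : ∀ t u, Tendsto (fun ε => R ε t u) (𝓝[>] 0) (𝓝 0) := fun t u => by
    have h := (hasDerivAt_iff_tendsto_slope_zero.1
      (hasDerivAt_coatedKernel hG hT h00 t u)).mono_left
      (nhdsWithin_mono (0 : ℝ) (fun x hx => (ne_of_gt hx : x ≠ 0)))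
    have h' := h.sub_const (coatedKernelDeriv G₁ G₂ γ n τ 0 t u)
    rw [sub_self] at h'
    refine h'.congr fun ε => ?_
    simp only [hR, zero_add, Complex.real_smul, Complex.ofReal_inv]
  have key := tendsto_eLpNorm_integral_kernel hRm hRB hRlim hf
  refine key.congr' ?_
  filter_upwards [hsmall] with ε ⟨h0, h1⟩
  have hε : |ε| ≤ δ := by rwa [abs_of_pos h0]
  have i1 : ∀ ε, |ε| ≤ δ → ∀ t, Integrable (fun u => coatedKernel G₁ γ n τ ε t u * f u) μ :=
    fun ε hε t => hf.bdd_mul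
      ((measurable_coatedKernel hG hF ε).comp measurable_prodMk_left).aestronglyMeasurable
      (Eventually.of_forall fun u => norm_coatedKernel_le hF hT hB hε t u)
  have i2 : ∀ t, Integrable (fun u => coatedKernelDeriv G₁ G₂ γ n τ 0 t u * f u) μ :=
    fun t => hf.bdd_mul
      ((measurable_coatedKernelDeriv hG hF 0).comp measurable_prodMk_left).aestronglyMeasurable
      (Eventually.of_forall fun u => norm_coatedKernelDeriv_le hF hT hB h00 t u)
  have hε0 : (ε : ℂ) ≠ 0 := by exact_mod_cast h0.ne'
  have e : (fun t => (∫ u, coatedKernel G₁ γ n τ ε t u * f u ∂μ) -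
      ((∫ u, coatedKernel G₁ γ n τ 0 t u * f u ∂μ) +
        (ε : ℂ) * ∫ u, coatedKernelDeriv G₁ G₂ γ n τ 0 t u * f u ∂μ))
      = (ε : ℂ) • fun t => ∫ u, R ε t u * f u ∂μ := by
    funext t
    rw [Pi.smul_apply, smul_eq_mul]
    have e1 : ∫ u, R ε t u * f u ∂μ = ∫ u, ((ε : ℂ)⁻¹ * (coatedKernel G₁ γ n τ ε t u * f u
        - coatedKernel G₁ γ n τ 0 t u * f u) - coatedKernelDeriv G₁ G₂ γ n τ 0 t u * f u) ∂μ := by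
      congr 1
      funext u
      simp only [hR]; ring
    have i3 : Integrable (fun u => (ε : ℂ)⁻¹ * (coatedKernel G₁ γ n τ ε t u * f u
        - coatedKernel G₁ γ n τ 0 t u * f u)) μ := ((i1 ε hε t).sub (i1 0 h00 t)).const_mul _
    rw [e1, integral_sub i3 (i2 t), integral_const_mul, integral_sub (i1 ε hε t) (i1 0 h00 t)]
    field_simp
    ring
  have e' : ‖(ε : ℂ)‖ₑ = ENNReal.ofReal ε := by
    rw [← ofReal_norm, Complex.norm_real, Real.norm_of_nonneg h0.le]
  rw [e, eLpNorm_const_smul, e', mul_comm,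
    ENNReal.mul_div_cancel_right (by simpa using h0) ENNReal.ofReal_ne_top]

end Kernels

/-! ### Periodic integrals and weakly singular bounds -/

section Periodic

variable {E : Type*} [NormedAddCommGroup E] [NormedSpace ℝ E] {L : ℝ} {f : ℝ → E}

theorem Function.Periodic.setIntegral_shift (hf : Function.Periodic f L) (hL : 0 < L) (u : ℝ) :
    ∫ t in Set.Ioc 0 L, f t = ∫ t in Set.Ioc (u - L / 2) (u + L / 2), f t := by
  have h := hf.intervalIntegral_add_eq 0 (u - L / 2)
  rw [zero_add, show u - L / 2 + L = u + L / 2 by ring,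
    intervalIntegral.integral_of_le hL.le, intervalIntegral.integral_of_le (by linarith)] at h
  exact h

omit [NormedSpace ℝ E] in
theorem Function.Periodic.integrable_shift (hf : Function.Periodic f L) (hL : 0 < L) (u : ℝ)
    (h : Integrable f (volume.restrict (Set.Ioc (u - L / 2) (u + L / 2)))) :
    Integrable f (volume.restrict (Set.Ioc 0 L)) := by
  have h1 : IntervalIntegrable f volume (u - L / 2) (u - L / 2 + L) := by
    rw [intervalIntegrable_iff_integrableOn_Ioc_of_le (by linarith)]
    rwa [show u - L / 2 + L = u + L / 2 by ring]
  have h2 := hf.intervalIntegrable hL.ne' h1 0 L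
  rwa [intervalIntegrable_iff_integrableOn_Ioc_of_le hL.le] at h2

/-- The integral of the derivative of a periodic function over a period vanishes. -/
theorem setIntegral_deriv_periodic [CompleteSpace E] {f' : ℝ → E} (hL : 0 < L)
    (hf : Function.Periodic f L) (h : ∀ t, HasDerivAt f (f' t) t) (hc : Continuous f') :
    ∫ t in Set.Ioc 0 L, f' t = 0 := by
  rw [← intervalIntegral.integral_of_le hL.le,
    intervalIntegral.integral_eq_sub_of_hasDerivAt (fun t _ => h t) (hc.intervalIntegrable _ _)]
  have := hf 0
  rw [zero_add] at this
  rw [this, sub_self]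

omit [NormedSpace ℝ E] in
theorem Continuous.integrable_Ioc (hf : Continuous f) (a b : ℝ) :
    Integrable f (volume.restrict (Set.Ioc a b)) :=
  hf.continuousOn.integrableOn_Icc.mono_set Set.Ioc_subset_Icc_self

end Periodic

/-- A multiple of `|v| ^ (-1/2)`, in the form in which it arises as a bound. -/
def weakSingularity (K v : ℝ) : ℝ := (v ^ 2 / K ^ 3) ^ (-(1 / 4) : ℝ)

theorem integrable_weakSingularity {K : ℝ} (hK : 0 < K) (L : ℝ) (u : ℝ) :
    Integrable (fun t => weakSingularity K (t - u))
      (volume.restrict (Set.Ioc (u - L / 2) (u + L / 2))) := by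
  have h0 : ∀ a b, IntervalIntegrable (weakSingularity K) volume a b := fun a b => by
    refine intervalIntegrable_of_even (fun x => by simp [weakSingularity]) fun x hx => ?_
    have h1 : IntervalIntegrable (fun v : ℝ => v ^ (-(1 / 2) : ℝ) * (K ^ 3) ^ (1 / 4 : ℝ))
        volume 0 x := (intervalIntegral.intervalIntegrable_rpow' (by norm_num)).mul_const _
    refine h1.congr fun v hv => ?_
    rw [Set.uIoc_of_le hx.le] at hv
    have hv0 : 0 < v := hv.1
    simp only [weakSingularity]
    rw [Real.div_rpow (by positivity) (by positivity), Real.rpow_neg (x := K ^ 3) (by positivity),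
      div_inv_eq_mul, ← Real.rpow_natCast v 2, ← Real.rpow_mul hv0.le]
    norm_num
  rcases le_total 0 L with hL | hL
  · have h1 := (h0 (u - L / 2 - u) (u + L / 2 - u)).comp_sub_right u
    simp only [sub_add_cancel] at h1
    rwa [intervalIntegrable_iff_integrableOn_Ioc_of_le (by linarith)] at h1
  · rw [Set.Ioc_eq_empty (by linarith)]; simp

theorem integral_weakSingularity (K L u : ℝ) :
    ∫ t in Set.Ioc (u - L / 2) (u + L / 2), weakSingularity K (t - u)
      = ∫ t in Set.Ioc (0 - L / 2) (0 + L / 2), weakSingularity K (t - 0) := by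
  rcases le_total 0 L with hL | hL
  · rw [← intervalIntegral.integral_of_le (by linarith),
      ← intervalIntegral.integral_of_le (by linarith),
      intervalIntegral.integral_comp_sub_right (weakSingularity K),
      intervalIntegral.integral_comp_sub_right (weakSingularity K)]
    congr 1 <;> ring
  · rw [Set.Ioc_eq_empty (by linarith), Set.Ioc_eq_empty (by linarith)]; simp

section NormalOffset

variable {k : ℝ} {G G₁ G₂ : ℝ → ℂ} {L : ℝ} {γ T n : ℝ → Plane} {τ : ℝ → ℝ} {K δ C : ℝ}

namespace IsTube

variable (hT : IsTube L γ T n τ K δ)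

include hT

theorem sq_add_sq_le {s : ℝ} (hs : |s| ≤ δ) (t u : ℝ) :
    ‖γ t - γ u‖ ^ 2 + s ^ 2 ≤ K * ‖γ t + s • n t - γ u‖ ^ 2 := by
  simpa using hT.tube_le t u s 0 hs (by simpa using hT.pos.le)

theorem sq_normal_le {s : ℝ} (hs : |s| ≤ δ) (t u : ℝ) : ‖γ t + s • n t - γ u‖ ^ 2 ≤ K := by
  simpa using hT.diam_le t u s 0 hs (by simpa using hT.pos.le)

theorem normal_ne_zero {s : ℝ} (hs : |s| ≤ δ) {t u : ℝ} (h : γ t ≠ γ u ∨ s ≠ 0) :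
    γ t + s • n t - γ u ≠ 0 := fun h0 => by
  have h1 := hT.sq_add_sq_le hs t u
  rw [h0, norm_zero, zero_pow two_ne_zero, mul_zero] at h1
  rcases h with h | h
  · have := norm_sq_pos_of_ne (sub_ne_zero.2 h)
    nlinarith [sq_nonneg s]
  · have : 0 < s ^ 2 := by positivity
    nlinarith [sq_nonneg ‖γ t - γ u‖]

theorem norm_le_normal {s : ℝ} (hs : |s| ≤ δ) (t u : ℝ) :
    ‖γ t - γ u‖ ≤ K * ‖γ t + s • n t - γ u‖ := by
  have h := hT.sq_add_sq_le hs t u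
  have hK := hT.one_le
  refine abs_le_of_sq_le_sq' (?_) (by positivity) |>.2
  rw [mul_pow]
  have : K * ‖γ t + s • n t - γ u‖ ^ 2 ≤ K ^ 2 * ‖γ t + s • n t - γ u‖ ^ 2 := by
    gcongr; nlinarith
  nlinarith [sq_nonneg s]

theorem abs_le_normal {s : ℝ} (hs : |s| ≤ δ) (t u : ℝ) :
    |s| ≤ K * ‖γ t + s • n t - γ u‖ := by
  have h := hT.sq_add_sq_le hs t u
  have hK := hT.one_le
  refine abs_le_of_sq_le_sq' (?_) (by positivity) |>.2
  rw [mul_pow, sq_abs]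
  have : K * ‖γ t + s • n t - γ u‖ ^ 2 ≤ K ^ 2 * ‖γ t + s • n t - γ u‖ ^ 2 := by
    gcongr; nlinarith
  nlinarith [sq_nonneg ‖γ t - γ u‖]

end IsTube

/-- `‖γ t + s n t - γ u‖` is at least a multiple of `|t - u|`, also for `s ≠ 0`. -/
theorem norm_radial_le (hT : IsTube L γ T n τ K δ) (hB : RadialBound G G₁ G₂ K C) {s : ℝ}
    (hs : |s| ≤ δ) {t u : ℝ} (h : γ t ≠ γ u) (htu : |t - u| ≤ L / 2) :
    ‖G (‖γ t + s • n t - γ u‖ ^ 2)‖ ≤ C * weakSingularity K (t - u) := by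
  have hK := hT.one_le
  have hC := hB.nonneg
  have hne : t - u ≠ 0 := fun h0 => h (by rw [sub_eq_zero.1 h0])
  have h1 := hT.sq_add_sq_le hs t u
  have h2 := hT.abs_sub_le t u htu
  refine (hB.bound₀ _ (norm_sq_pos_of_ne (hT.normal_ne_zero hs (Or.inl h)))
    (hT.sq_normal_le hs t u)).trans ?_
  rw [weakSingularity]
  refine mul_le_mul_of_nonneg_left (Real.rpow_le_rpow_of_nonpos (by positivity) ?_ (by norm_num)) hC
  rw [div_le_iff₀ (by positivity)]
  have h3 : (t - u) ^ 2 ≤ (K * ‖γ t - γ u‖) ^ 2 := by rw [← sq_abs]; gcongr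
  calc (t - u) ^ 2 ≤ K ^ 2 * ‖γ t - γ u‖ ^ 2 := by rwa [← mul_pow]
    _ ≤ K ^ 2 * (K * ‖γ t + s • n t - γ u‖ ^ 2) := by gcongr; nlinarith [sq_nonneg s]
    _ = _ := by ring

/-- The kernel of the single layer potential on the curve is weakly singular. -/
theorem isWeakKernel_singleLayer (hG : IsRadialSolution k G G₁ G₂) (hF : IsArcFrame L γ T n τ)
    (hT : IsTube L γ T n τ K δ) : IsWeakKernel L (fun t u => G (‖γ t - γ u‖ ^ 2)) := by
  obtain ⟨C, hB⟩ := hG.exists_radialBound K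
  have hL := hF.length_pos
  have hK : 0 < K := by linarith [hT.one_le]
  have hγ := hF.continuous
  have hm : Measurable (Function.uncurry fun t u => G (‖γ t - γ u‖ ^ 2)) :=
    hG.measurable.comp (Continuous.measurable (by fun_prop))
  have hper : ∀ u, Function.Periodic (fun t => G (‖γ t - γ u‖ ^ 2)) L := fun u t => by
    simp only [hF.periodic t]
  have hb : ∀ u, ∀ᵐ t ∂(volume.restrict (Set.Ioc (u - L / 2) (u + L / 2))),
      ‖G (‖γ t - γ u‖ ^ 2)‖ ≤ C * weakSingularity K (t - u) := fun u => by
    filter_upwards [hF.ae_ne u (volume.restrict (Set.Ioc (u - L / 2) (u + L / 2))),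
      ae_restrict_mem measurableSet_Ioc] with t h1 h2
    have h3 : |t - u| ≤ L / 2 := abs_le.2 ⟨by linarith [h2.1], by linarith [h2.2]⟩
    have := norm_radial_le hT hB (s := 0) (by simpa using hT.pos.le) h1 h3
    simpa using this
  have hi := fun u => (integrable_weakSingularity hK L u).const_mul C
  have hi' : ∀ u, Integrable (fun t => G (‖γ t - γ u‖ ^ 2))
      (volume.restrict (Set.Ioc (u - L / 2) (u + L / 2))) := fun u =>
    (hi u).mono' (hm.comp measurable_prodMk_right).aestronglyMeasurable (hb u)
  refine ⟨hm, fun u => (hper u).integrable_shift hL u (hi' u),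
    C * ∫ t in Set.Ioc (0 - L / 2) (0 + L / 2), weakSingularity K (t - 0), fun u => ?_⟩
  have hpn : Function.Periodic (fun t => ‖G (‖γ t - γ u‖ ^ 2)‖) L := (hper u).comp norm
  rw [hpn.setIntegral_shift hL u, ← integral_weakSingularity K L u, ← integral_const_mul]
  exact integral_mono_ae (hi' u).norm (hi u) (hb u)

end NormalOffset

/-! ### The normal derivative of the double layer potential -/

/-- The kernel `ν_t · ∇_x ∂Γ(x, y)/∂ν_y` at `x = γ t + s ν_t`, `y = γ u`. -/
def hyperKernel (G₁ G₂ : ℝ → ℂ) (γ n : ℝ → Plane) (s t u : ℝ) : ℂ :=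
  -radialHess G₁ G₂ (γ t + s • n t - γ u) (n t) (n u)

/-- The part of `hyperKernel`, tested against `ψ` and integrated by parts, that is dominated by an
integrable function uniformly in `s`. -/
def regularPart (k : ℝ) (G G₁ : ℝ → ℂ) (γ T n : ℝ → Plane) (τ : ℝ → ℝ) (ψ : ℝ → ℂ)
    (s t u : ℝ) : ℂ :=
  (k : ℂ) ^ 2 * G (‖γ t + s • n t - γ u‖ ^ 2) * (inner ℝ (T t) (T u) : ℝ) * ψ t
    + G (‖γ t + s • n t - γ u‖ ^ 2) * deriv (deriv ψ) t
    - radialGrad G₁ (γ t + s • n t - γ u) (T u - T t) * deriv ψ t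
    + s * radialGrad G₁ (γ t + s • n t - γ u) (T t) * (τ t * deriv ψ t)

/-- The remaining part, an approximate identity acting on a function that vanishes at `u`, up to
terms of order `s`. -/
def concentratedPart (G₁ G₂ : ℝ → ℂ) (γ T n : ℝ → Plane) (τ : ℝ → ℝ) (ψ : ℝ → ℂ)
    (s t u : ℝ) : ℂ :=
  s * (τ t * ψ t - τ u * ψ u * ((1 + s * τ t : ℝ) : ℂ))
    * radialHess G₁ G₂ (γ t + s • n t - γ u) (T u) (T t)

namespace IsBoundaryTest

variable {L : ℝ} {ψ : ℝ → ℂ} (hψ : IsBoundaryTest L ψ)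

include hψ

theorem hasDerivAt (t : ℝ) : HasDerivAt ψ (deriv ψ t) t :=
  (hψ.contDiff.differentiable (by norm_num) t).hasDerivAt

theorem contDiff_deriv : ContDiff ℝ 1 (deriv ψ) := by
  have := hψ.contDiff
  rw [show (2 : WithTop ℕ∞) = 1 + 1 by norm_num, contDiff_succ_iff_deriv] at this
  exact this.2.2

theorem hasDerivAt_deriv (t : ℝ) : HasDerivAt (deriv ψ) (deriv (deriv ψ) t) t :=
  (hψ.contDiff_deriv.differentiable (by norm_num) t).hasDerivAt

theorem continuous : Continuous ψ := hψ.contDiff.continuous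

theorem continuous_deriv : Continuous (deriv ψ) := hψ.contDiff_deriv.continuous

theorem continuous_deriv_deriv : Continuous (deriv (deriv ψ)) :=
  hψ.contDiff_deriv.continuous_deriv (by norm_num)

theorem periodic_deriv : Function.Periodic (deriv ψ) L := fun t => by
  have h : (fun x => ψ (x + L)) = ψ := funext hψ.periodic
  rw [← deriv_comp_add_const, h]

theorem periodic_deriv_deriv : Function.Periodic (deriv (deriv ψ)) L := fun t => by
  have h : (fun x => deriv ψ (x + L)) = deriv ψ := funext hψ.periodic_deriv
  rw [← deriv_comp_add_const, h]

theorem exists_bound (hL : 0 < L) : ∃ R : ℝ, 0 ≤ R ∧ ∀ t, ‖ψ t‖ ≤ R ∧ ‖deriv ψ t‖ ≤ R ∧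
    ‖deriv (deriv ψ) t‖ ≤ R := by
  obtain ⟨a, ha⟩ := isBounded_iff_forall_norm_le.1
    (hψ.periodic.isBounded_of_continuous hL.ne' hψ.continuous)
  obtain ⟨b, hb⟩ := isBounded_iff_forall_norm_le.1
    (hψ.periodic_deriv.isBounded_of_continuous hL.ne' hψ.continuous_deriv)
  obtain ⟨c, hc⟩ := isBounded_iff_forall_norm_le.1
    (hψ.periodic_deriv_deriv.isBounded_of_continuous hL.ne' hψ.continuous_deriv_deriv)
  have ha' := ha _ ⟨0, rfl⟩
  have hb' := hb _ ⟨0, rfl⟩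
  have hc' := hc _ ⟨0, rfl⟩
  have p1 := (norm_nonneg _).trans ha'
  have p2 := (norm_nonneg _).trans hb'
  have p3 := (norm_nonneg _).trans hc'
  refine ⟨a + b + c, by linarith, fun t => ⟨?_, ?_, ?_⟩⟩
  · linarith [ha _ ⟨t, rfl⟩]
  · linarith [hb _ ⟨t, rfl⟩]
  · linarith [hc _ ⟨t, rfl⟩]

end IsBoundaryTest

theorem integral_add_sub_sub {α : Type*} [MeasurableSpace α] {μ : Measure α} {f a b c : α → ℂ}
    (hf : Integrable f μ) (ha : Integrable a μ) (hb : Integrable b μ) (hc : Integrable c μ) :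
    ∫ t, f t + (a t - b t - c t) ∂μ = ∫ t, f t ∂μ + (∫ t, a t ∂μ - ∫ t, b t ∂μ - ∫ t, c t ∂μ) := by
  have h1 : Integrable (fun t => a t - b t) μ := ha.sub hb
  have h2 : Integrable (fun t => a t - b t - c t) μ := h1.sub hc
  rw [integral_add hf h2, integral_sub h1 hc, integral_sub ha hb]

section Limit

variable {k : ℝ} {G G₁ G₂ : ℝ → ℂ} {L : ℝ} {γ T n : ℝ → Plane} {τ : ℝ → ℝ} {K δ C : ℝ} {ψ : ℝ → ℂ}

theorem hasDerivAt_normal (hF : IsArcFrame L γ T n τ) (s t u : ℝ) :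
    HasDerivAt (fun t => γ t + s • n t - γ u) ((1 + s * τ t) • T t) t := by
  refine (((hF.hasDerivAt t).add ((hF.hasDerivAt_n t).const_smul s)).sub_const (γ u)).congr_deriv ?_
  module

theorem measurable_hyperKernel (hG : IsRadialSolution k G G₁ G₂) (hF : IsArcFrame L γ T n τ)
    (s : ℝ) : Measurable (Function.uncurry (hyperKernel G₁ G₂ γ n s)) := by
  have h1 := hF.continuous
  have h2 := hF.continuous_n
  refine (measurable_radialHess hG.measurable₁ hG.measurable₂ ?_ ?_ ?_).neg <;>
  exact Continuous.measurable (by fun_prop)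

theorem norm_hyperKernel_le (hF : IsArcFrame L γ T n τ) (hT : IsTube L γ T n τ K δ)
    (hB : RadialBound G G₁ G₂ K C) {s : ℝ} (hs : |s| ≤ δ) (hs0 : s ≠ 0) (t u : ℝ) :
    ‖hyperKernel G₁ G₂ γ n s t u‖ ≤ 6 * C * K / s ^ 2 := by
  have hK := hT.one_le
  have hC := hB.nonneg
  have h0 := hT.normal_ne_zero hs (t := t) (u := u) (Or.inr hs0)
  have h1 := hT.sq_add_sq_le hs t u
  have h2 := norm_sq_pos_of_ne h0
  have hs2 : 0 < s ^ 2 := by positivity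
  rw [hyperKernel, norm_neg]
  refine (hB.norm_radialHess_le_div h0 (hT.sq_normal_le hs t u)).trans ?_
  rw [hF.norm_n, hF.norm_n, mul_one, mul_one, div_le_div_iff₀ h2 hs2]
  calc 6 * C * s ^ 2 ≤ 6 * C * (K * ‖γ t + s • n t - γ u‖ ^ 2) := by
        gcongr; nlinarith [sq_nonneg ‖γ t - γ u‖]
    _ = _ := by ring

theorem continuous_radialHess_normal (hG : IsRadialSolution k G G₁ G₂)
    (hF : IsArcFrame L γ T n τ) (hT : IsTube L γ T n τ K δ) {s : ℝ} (hs : |s| ≤ δ) (hs0 : s ≠ 0)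
    (u : ℝ) {A B : ℝ → Plane} (hA : Continuous A) (hB : Continuous B) :
    Continuous fun t => radialHess G₁ G₂ (γ t + s • n t - γ u) (A t) (B t) := by
  have h1 := hF.continuous
  have h2 := hF.continuous_n
  exact hG.continuousOn_radialHess.comp_continuous
    (f := fun t => (γ t + s • n t - γ u, A t, B t)) (by fun_prop)
    fun t => hT.normal_ne_zero hs (Or.inr hs0)

theorem continuous_radialGrad_normal (hG : IsRadialSolution k G G₁ G₂)
    (hF : IsArcFrame L γ T n τ) (hT : IsTube L γ T n τ K δ) {s : ℝ} (hs : |s| ≤ δ) (hs0 : s ≠ 0)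
    (u : ℝ) {A : ℝ → Plane} (hA : Continuous A) :
    Continuous fun t => radialGrad G₁ (γ t + s • n t - γ u) (A t) := by
  have h1 := hF.continuous
  have h2 := hF.continuous_n
  exact hG.continuousOn_radialGrad.comp_continuous
    (f := fun t => (γ t + s • n t - γ u, A t)) (by fun_prop)
    fun t => hT.normal_ne_zero hs (Or.inr hs0)

theorem continuous_radial_normal (hG : IsRadialSolution k G G₁ G₂)
    (hF : IsArcFrame L γ T n τ) (hT : IsTube L γ T n τ K δ) {s : ℝ} (hs : |s| ≤ δ) (hs0 : s ≠ 0)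
    (u : ℝ) : Continuous fun t => G (‖γ t + s • n t - γ u‖ ^ 2) := by
  have h1 := hF.continuous
  have h2 := hF.continuous_n
  exact hG.continuousOn_radial.comp_continuous
    (f := fun t => γ t + s • n t - γ u) (by fun_prop)
    fun t => hT.normal_ne_zero hs (Or.inr hs0)

section Continuity

variable (hG : IsRadialSolution k G G₁ G₂) (hF : IsArcFrame L γ T n τ)
  (hT : IsTube L γ T n τ K δ) (hψ : IsBoundaryTest L ψ)
  {s : ℝ} (hs : |s| ≤ δ) (hs0 : s ≠ 0) (u : ℝ)

include hG hF hT hψ hs hs0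

theorem continuous_regularPart :
    Continuous fun t => regularPart k G G₁ γ T n τ ψ s t u := by
  have cT := hF.continuous_T
  have cτ := hF.continuous_τ
  have c0 := hψ.continuous
  have c1 := hψ.continuous_deriv
  have c2 := hψ.continuous_deriv_deriv
  have g0 := continuous_radial_normal hG hF hT hs hs0 u
  have g1 := continuous_radialGrad_normal hG hF hT hs hs0 u (A := fun t => T u - T t) (by fun_prop)
  have g2 := continuous_radialGrad_normal hG hF hT hs hs0 u cT
  have ci : Continuous fun t => ((inner ℝ (T t) (T u) : ℝ) : ℂ) := by fun_prop
  have ct : Continuous fun t => (τ t : ℂ) := by fun_prop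
  exact (((((continuous_const.mul g0).mul ci).mul c0).add (g0.mul c2)).sub (g1.mul c1)).add
    ((continuous_const.mul g2).mul (ct.mul c1))

theorem continuous_concentratedPart :
    Continuous fun t => concentratedPart G₁ G₂ γ T n τ ψ s t u := by
  have cT := hF.continuous_T
  have cτ := hF.continuous_τ
  have c0 := hψ.continuous
  have g0 := continuous_radialHess_normal hG hF hT hs hs0 u (continuous_const (y := T u)) cT
  unfold concentratedPart
  fun_prop

/-- Integration by parts along the curve, off the boundary. The Helmholtz equation turns the two
normal derivatives into tangential ones, and the derivative along the parallel curve carries the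
factor `1 + s τ`; as `τ` is only continuous, this factor cannot be moved onto the test function. -/
theorem integral_hyperKernel :
    ∫ t in Set.Ioc 0 L, hyperKernel G₁ G₂ γ n s t u * ψ t =
      (∫ t in Set.Ioc 0 L, regularPart k G G₁ γ T n τ ψ s t u)
        - ∫ t in Set.Ioc 0 L, concentratedPart G₁ G₂ γ T n τ ψ s t u := by
  have hL := hF.length_pos
  have cγ := hF.continuous
  have cT := hF.continuous_T
  have cn := hF.continuous_n
  have cτ := hF.continuous_τ
  have c0 := hψ.continuous
  have c1 := hψ.continuous_deriv
  have c2 := hψ.continuous_deriv_deriv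
  have g0 := continuous_radial_normal hG hF hT hs hs0 u
  have gu := continuous_radialGrad_normal hG hF hT hs hs0 u (continuous_const (y := T u))
  have gt := continuous_radialGrad_normal hG hF hT hs hs0 u cT
  have gH := continuous_radialHess_normal hG hF hT hs hs0 u (continuous_const (y := T u)) cT
  have gN := continuous_radialHess_normal hG hF hT hs hs0 u cn (continuous_const (y := n u))
  have hne : ∀ t, γ t + s • n t - γ u ≠ 0 := fun t => hT.normal_ne_zero hs (Or.inr hs0)
  have dgrad : ∀ t, HasDerivAt (fun t => radialGrad G₁ (γ t + s • n t - γ u) (T u))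
      (((1 + s * τ t : ℝ) : ℂ) * radialHess G₁ G₂ (γ t + s • n t - γ u) (T u) (T t)) t := by
    intro t
    refine (hG.hasDerivAt_radialGrad_comp (hasDerivAt_normal hF s t u)
      (hasDerivAt_const t (T u)) (hne t)).congr_deriv ?_
    rw [radialHess_smul]; simp [radialGrad]
  have drad : ∀ t, HasDerivAt (fun t => G (‖γ t + s • n t - γ u‖ ^ 2))
      (((1 + s * τ t : ℝ) : ℂ) * radialGrad G₁ (γ t + s • n t - γ u) (T t)) t := fun t => by
    refine (hG.hasDerivAt_comp (hasDerivAt_normal hF s t u) (hne t)).congr_deriv ?_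
    rw [radialGrad_smul]
  have pgrad : Function.Periodic (fun t => radialGrad G₁ (γ t + s • n t - γ u) (T u)) L :=
    fun t => by simp only [hF.periodic t, hF.periodic_n t]
  have prad : Function.Periodic (fun t => G (‖γ t + s • n t - γ u‖ ^ 2)) L :=
    fun t => by simp only [hF.periodic t, hF.periodic_n t]
  have cs : Continuous fun t => ((1 + s * τ t : ℝ) : ℂ) := by fun_prop
  have k1 : Continuous fun t => ((1 + s * τ t : ℝ) : ℂ)
      * radialHess G₁ G₂ (γ t + s • n t - γ u) (T u) (T t) := cs.mul gH
  have k2 : Continuous fun t => ((1 + s * τ t : ℝ) : ℂ)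
      * radialHess G₁ G₂ (γ t + s • n t - γ u) (T u) (T t) * ψ t
      + radialGrad G₁ (γ t + s • n t - γ u) (T u) * deriv ψ t := (k1.mul c0).add (gu.mul c1)
  have k3 : Continuous fun t => ((1 + s * τ t : ℝ) : ℂ)
      * radialGrad G₁ (γ t + s • n t - γ u) (T t) * deriv ψ t
      + G (‖γ t + s • n t - γ u‖ ^ 2) * deriv (deriv ψ) t :=
    ((cs.mul gt).mul c1).add (g0.mul c2)
  have i2 := k2.integrable_Ioc 0 L
  have i3 := k3.integrable_Ioc 0 L
  have i1 := (k1.integrable_Ioc 0 L).const_mul (s * τ u * ψ u)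
  have k0 : Continuous fun t => regularPart k G G₁ γ T n τ ψ s t u
      - concentratedPart G₁ G₂ γ T n τ ψ s t u :=
    (continuous_regularPart hG hF hT hψ hs hs0 u).sub
      (continuous_concentratedPart hG hF hT hψ hs hs0 u)
  -- three total derivatives of periodic functions: of the tangential gradient, of its product with
  -- `ψ`, and of the product of the fundamental solution with `ψ'`
  have z1 := setIntegral_deriv_periodic hL pgrad dgrad k1
  have z2 := setIntegral_deriv_periodic hL (pgrad.mul hψ.periodic)
    (fun t => (dgrad t).mul (hψ.hasDerivAt t)) k2
  have z3 := setIntegral_deriv_periodic hL (prad.mul hψ.periodic_deriv)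
    (fun t => (drad t).mul (hψ.hasDerivAt_deriv t)) k3
  rw [← integral_sub ((continuous_regularPart hG hF hT hψ hs hs0 u).integrable_Ioc 0 L)
    ((continuous_concentratedPart hG hF hT hψ hs hs0 u).integrable_Ioc 0 L)]
  have key : ∀ t, hyperKernel G₁ G₂ γ n s t u * ψ t =
      regularPart k G G₁ γ T n τ ψ s t u - concentratedPart G₁ G₂ γ T n τ ψ s t u
      + ((((1 + s * τ t : ℝ) : ℂ) * radialHess G₁ G₂ (γ t + s • n t - γ u) (T u) (T t) * ψ t
          + radialGrad G₁ (γ t + s • n t - γ u) (T u) * deriv ψ t)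
        - (((1 + s * τ t : ℝ) : ℂ) * radialGrad G₁ (γ t + s • n t - γ u) (T t) * deriv ψ t
          + G (‖γ t + s • n t - γ u‖ ^ 2) * deriv (deriv ψ) t)
        - s * τ u * ψ u * (((1 + s * τ t : ℝ) : ℂ)
          * radialHess G₁ G₂ (γ t + s • n t - γ u) (T u) (T t))) := by
    intro t
    rw [hyperKernel, hG.radialHess_normal (hne t) (hF.inner_frame _ t u) (hF.inner_n t u),
      regularPart, concentratedPart, radialGrad_sub, radialHess_comm G₁ G₂ _ (T t) (T u)]
    push_cast
    ring
  simp only [key]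
  refine (integral_add_sub_sub (k0.integrable_Ioc 0 L) i2 i3 i1).trans ?_
  rw [integral_const_mul, z1]
  rw [z2, z3]
  simp

end Continuity

end Limit

/-! ### Passage to the limit on the boundary -/

section Limit

variable {k : ℝ} {G G₁ G₂ : ℝ → ℂ} {L : ℝ} {γ T n : ℝ → Plane} {τ : ℝ → ℝ} {K δ C R : ℝ} {ψ : ℝ → ℂ}

theorem IsArcFrame.abs_inner_T_le_one (hF : IsArcFrame L γ T n τ) (t u : ℝ) :
    |inner ℝ (T t) (T u)| ≤ 1 := by
  refine (abs_real_inner_le_norm _ _).trans ?_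
  rw [hF.norm_T, hF.norm_T, mul_one]

theorem norm_radialGrad_T_sub_le (hT : IsTube L γ T n τ K δ)
    (hB : RadialBound G G₁ G₂ K C) {s : ℝ} (hs : |s| ≤ δ) {t u : ℝ} (h : γ t ≠ γ u) :
    ‖radialGrad G₁ (γ t + s • n t - γ u) (T u - T t)‖ ≤ 2 * C * K ^ 2 := by
  have hC := hB.nonneg
  have hK := hT.one_le
  have h0 := hT.normal_ne_zero hs (Or.inl h)
  have h1 := hT.norm_le_normal hs t u
  refine (hB.norm_radialGrad_le_div h0 (hT.sq_normal_le hs t u)).trans ?_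
  rw [div_le_iff₀ (norm_pos_iff.2 h0), norm_sub_rev]
  calc 2 * C * ‖T t - T u‖ ≤ 2 * C * (K * (K * ‖γ t + s • n t - γ u‖)) := by
        gcongr
        exact (hT.norm_T_sub_le t u).trans (by gcongr)
    _ = _ := by ring

theorem norm_mul_radialGrad_le (hF : IsArcFrame L γ T n τ) (hT : IsTube L γ T n τ K δ)
    (hB : RadialBound G G₁ G₂ K C) {s : ℝ} (hs : |s| ≤ δ) {t u : ℝ} (h : γ t ≠ γ u) :
    |s| * ‖radialGrad G₁ (γ t + s • n t - γ u) (T t)‖ ≤ 2 * C * K := by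
  have hC := hB.nonneg
  have h0 := hT.normal_ne_zero hs (Or.inl h)
  have h1 := hT.abs_le_normal hs t u
  have hx := norm_pos_iff.2 h0
  calc |s| * ‖radialGrad G₁ (γ t + s • n t - γ u) (T t)‖
      ≤ (K * ‖γ t + s • n t - γ u‖) * (2 * C * 1 / ‖γ t + s • n t - γ u‖) := by
        have h2 := hB.norm_radialGrad_le_div (a := T t) h0 (hT.sq_normal_le hs t u)
        rw [hF.norm_T] at h2
        exact mul_le_mul h1 h2 (norm_nonneg _) ((abs_nonneg s).trans h1)
    _ = _ := by field_simp

/-- A bound that does not depend on `s`: differences `T u - T t` and factors `s` compensate the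
singularity `1 / |x|` of the gradient. -/
theorem norm_regularPart_le (hF : IsArcFrame L γ T n τ) (hT : IsTube L γ T n τ K δ)
    (hB : RadialBound G G₁ G₂ K C)
    (hR : ∀ t, ‖ψ t‖ ≤ R ∧ ‖deriv ψ t‖ ≤ R ∧ ‖deriv (deriv ψ) t‖ ≤ R)
    {s : ℝ} (hs : |s| ≤ δ) {t u : ℝ} (h : γ t ≠ γ u) (htu : |t - u| ≤ L / 2) :
    ‖regularPart k G G₁ γ T n τ ψ s t u‖
      ≤ (k ^ 2 + 1) * C * R * weakSingularity K (t - u) + 4 * C * K ^ 2 * R := by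
  have hC := hB.nonneg
  have hK := hT.one_le
  obtain ⟨r0, r1, r2⟩ := hR t
  have hR0 : 0 ≤ R := (norm_nonneg _).trans r0
  have hw := norm_radial_le hT hB hs h htu
  have hw0 : 0 ≤ weakSingularity K (t - u) := Real.rpow_nonneg (by positivity) _
  have h1 := norm_radialGrad_T_sub_le hT hB hs h
  have h2 := norm_mul_radialGrad_le hF hT hB hs h
  have h3 := hF.abs_inner_T_le_one t u
  have h4 := hT.abs_τ_le t
  set w := weakSingularity K (t - u)
  refine (norm_add_le _ _).trans ((add_le_add ((norm_sub_le _ _).trans (add_le_add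
    (norm_add_le _ _) le_rfl)) le_rfl).trans ?_)
  simp only [norm_mul, norm_pow, Complex.norm_real, Real.norm_eq_abs, sq_abs]
  calc _ ≤ k ^ 2 * (C * w) * 1 * R + C * w * R + 2 * C * K ^ 2 * R + 2 * C * K * (K * R) := by
        gcongr
    _ = _ := by ring

theorem tendsto_regularPart (hG : IsRadialSolution k G G₁ G₂) {t u : ℝ} (h : γ t ≠ γ u) :
    Tendsto (fun s => regularPart k G G₁ γ T n τ ψ s t u) (𝓝 0)
      (𝓝 (regularPart k G G₁ γ T n τ ψ 0 t u)) := by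
  have h0 : γ t + (0 : ℝ) • n t - γ u ≠ 0 := by simpa using sub_ne_zero.2 h
  have hX : ContinuousAt (fun s : ℝ => γ t + s • n t - γ u) 0 :=
    Continuous.continuousAt (by fun_prop)
  have c0 : ContinuousAt (fun s : ℝ => G (‖γ t + s • n t - γ u‖ ^ 2)) 0 :=
    ContinuousAt.comp (f := fun s : ℝ => γ t + s • n t - γ u)
      (hG.continuousOn_radial.continuousAt (isOpen_ne.mem_nhds h0)) hX
  have c1 : ∀ a : Plane, ContinuousAt (fun s : ℝ => radialGrad G₁ (γ t + s • n t - γ u) a) 0 :=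
    fun a => ContinuousAt.comp (f := fun s : ℝ => γ t + s • n t - γ u)
      (hG.hasFDerivAt_radialGrad h0 a).continuousAt hX
  have cs : ContinuousAt (fun s : ℝ => (s : ℂ)) 0 := Complex.continuous_ofReal.continuousAt
  exact ((((continuousAt_const.mul c0).mul continuousAt_const).mul continuousAt_const).add
    (c0.mul continuousAt_const) |>.sub ((c1 _).mul continuousAt_const)).add
    ((cs.mul (c1 _)).mul continuousAt_const)

theorem measurable_regularPart (hG : IsRadialSolution k G G₁ G₂) (hF : IsArcFrame L γ T n τ)
    (hψ : IsBoundaryTest L ψ) (s u : ℝ) :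
    Measurable fun t => regularPart k G G₁ γ T n τ ψ s t u := by
  have cγ := hF.continuous
  have cT := hF.continuous_T
  have cn := hF.continuous_n
  have cτ := hF.continuous_τ
  have m0 : Measurable fun t => G (‖γ t + s • n t - γ u‖ ^ 2) :=
    hG.measurable.comp (Continuous.measurable (by fun_prop))
  have m1 : Measurable fun t => radialGrad G₁ (γ t + s • n t - γ u) (T u - T t) :=
    measurable_radialGrad hG.measurable₁ (Continuous.measurable (by fun_prop))
      (Continuous.measurable (by fun_prop))
  have m2 : Measurable fun t => radialGrad G₁ (γ t + s • n t - γ u) (T t) :=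
    measurable_radialGrad hG.measurable₁ (Continuous.measurable (by fun_prop)) cT.measurable
  have ci : Continuous fun t => ((inner ℝ (T t) (T u) : ℝ) : ℂ) := by fun_prop
  have ct : Continuous fun t => (τ t : ℂ) := by fun_prop
  have d0 := hψ.continuous.measurable
  have d1 := hψ.continuous_deriv.measurable
  have d2 := hψ.continuous_deriv_deriv.measurable
  exact (((((m0.const_mul _).mul ci.measurable).mul d0).add (m0.mul d2)).sub (m1.mul d1)).add
    ((m2.const_mul _).mul (ct.measurable.mul d1))

theorem periodic_regularPart (hF : IsArcFrame L γ T n τ) (hψ : IsBoundaryTest L ψ) (s u : ℝ) :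
    Function.Periodic (fun t => regularPart k G G₁ γ T n τ ψ s t u) L := fun t => by
  simp only [regularPart, hF.periodic t, hF.periodic_T t, hF.periodic_n t, hF.periodic_τ t,
    hψ.periodic t, hψ.periodic_deriv t, hψ.periodic_deriv_deriv t]

/-- The regular part converges, boundedly in `u`, by dominated convergence. -/
theorem exists_bound_integral_regularPart (hG : IsRadialSolution k G G₁ G₂)
    (hF : IsArcFrame L γ T n τ) (hT : IsTube L γ T n τ K δ) (hψ : IsBoundaryTest L ψ) :
    (∃ B, ∀ s, |s| ≤ δ → ∀ u, ‖∫ t in Set.Ioc 0 L, regularPart k G G₁ γ T n τ ψ s t u‖ ≤ B) ∧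
    ∀ u, Tendsto (fun s => ∫ t in Set.Ioc 0 L, regularPart k G G₁ γ T n τ ψ s t u) (𝓝 0)
      (𝓝 (∫ t in Set.Ioc 0 L, regularPart k G G₁ γ T n τ ψ 0 t u)) := by
  obtain ⟨C, hB⟩ := hG.exists_radialBound K
  have hL := hF.length_pos
  have hK : 0 < K := by linarith [hT.one_le]
  obtain ⟨R, hR0, hR⟩ := hψ.exists_bound hL
  have hshift : ∀ s u, ∫ t in Set.Ioc 0 L, regularPart k G G₁ γ T n τ ψ s t u
      = ∫ t in Set.Ioc (u - L / 2) (u + L / 2), regularPart k G G₁ γ T n τ ψ s t u :=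
    fun s u => (periodic_regularPart hF hψ s u).setIntegral_shift hL u
  have hi : ∀ u, Integrable (fun t => (k ^ 2 + 1) * C * R * weakSingularity K (t - u)
      + 4 * C * K ^ 2 * R) (volume.restrict (Set.Ioc (u - L / 2) (u + L / 2))) := fun u =>
    ((integrable_weakSingularity hK L u).const_mul _).add (integrable_const _)
  have hb : ∀ s, |s| ≤ δ → ∀ u, ∀ᵐ t ∂(volume.restrict (Set.Ioc (u - L / 2) (u + L / 2))),
      ‖regularPart k G G₁ γ T n τ ψ s t u‖
        ≤ (k ^ 2 + 1) * C * R * weakSingularity K (t - u) + 4 * C * K ^ 2 * R := fun s hs u => by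
    filter_upwards [hF.ae_ne u (volume.restrict (Set.Ioc (u - L / 2) (u + L / 2))),
      ae_restrict_mem measurableSet_Ioc] with t h1 h2
    exact norm_regularPart_le hF hT hB hR hs h1 (abs_le.2 ⟨by linarith [h2.1], by linarith [h2.2]⟩)
  refine ⟨⟨(k ^ 2 + 1) * C * R * (∫ t in Set.Ioc (0 - L / 2) (0 + L / 2), weakSingularity K (t - 0))
    + L * (4 * C * K ^ 2 * R), fun s hs u => ?_⟩, fun u => ?_⟩
  · rw [hshift]
    refine (norm_integral_le_of_norm_le (hi u) (hb s hs u)).trans (le_of_eq ?_)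
    rw [integral_add ((integrable_weakSingularity hK L u).const_mul _) (integrable_const _),
      integral_const_mul, integral_weakSingularity K L u, integral_const]
    simp only [measureReal_restrict_apply_univ, Real.volume_real_Ioc, smul_eq_mul]
    rw [max_eq_left (by linarith)]
    ring
  · simp only [hshift]
    have hev : ∀ᶠ s in 𝓝 (0 : ℝ), |s| ≤ δ := by
      filter_upwards [Icc_mem_nhds (neg_lt_zero.2 hT.pos) hT.pos] with s hs using abs_le.2 hs
    refine tendsto_integral_filter_of_dominated_convergence _
      (Eventually.of_forall fun s => (measurable_regularPart hG hF hψ s u).aestronglyMeasurable)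
      (hev.mono fun s hs => hb s hs u) (hi u) ?_
    filter_upwards [hF.ae_ne u (volume.restrict (Set.Ioc (u - L / 2) (u + L / 2)))] with t ht
    exact tendsto_regularPart hG ht

/-- The Hessian is `O(1 / (s² + c (t - u)²))`, and its coefficient vanishes at `t = u`, `s = 0`. -/
theorem norm_concentratedPart_le (hF : IsArcFrame L γ T n τ) (hT : IsTube L γ T n τ K δ)
    (hB : RadialBound G G₁ G₂ K C) (hR : ∀ t, ‖ψ t‖ ≤ R) {s : ℝ} (hs : |s| ≤ δ) (hs0 : s ≠ 0)
    {t u : ℝ} (htu : |t - u| ≤ L / 2) :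
    ‖concentratedPart G₁ G₂ γ T n τ ψ s t u‖ ≤
      6 * C * K * ((‖τ t * ψ t - τ u * ψ u‖ + |s| * (K * K * R))
        * (|s| / (s ^ 2 + (K ^ 2)⁻¹ * (t - u) ^ 2))) := by
  have hC := hB.nonneg
  have hK := hT.one_le
  have hK0 : 0 < K := by linarith
  have hR0 : 0 ≤ R := (norm_nonneg _).trans (hR 0)
  have h0 := hT.normal_ne_zero hs (t := t) (u := u) (Or.inr hs0)
  have hs2 : 0 < s ^ 2 := by positivity
  have hd : 0 < s ^ 2 + (K ^ 2)⁻¹ * (t - u) ^ 2 := by positivity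
  have hden : s ^ 2 + (K ^ 2)⁻¹ * (t - u) ^ 2 ≤ K * ‖γ t + s • n t - γ u‖ ^ 2 := by
    have h1 := hT.sq_add_sq_le hs t u
    have h2 := hT.abs_sub_le t u htu
    have h3 : (t - u) ^ 2 ≤ K ^ 2 * ‖γ t - γ u‖ ^ 2 := by
      rw [← sq_abs, ← mul_pow]; gcongr
    have h4 : (K ^ 2)⁻¹ * (t - u) ^ 2 ≤ ‖γ t - γ u‖ ^ 2 := by
      rwa [inv_mul_le_iff₀ (by positivity)]
    linarith
  have hH : ‖radialHess G₁ G₂ (γ t + s • n t - γ u) (T u) (T t)‖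
      ≤ 6 * C * K / (s ^ 2 + (K ^ 2)⁻¹ * (t - u) ^ 2) := by
    refine (hB.norm_radialHess_le_div h0 (hT.sq_normal_le hs t u)).trans ?_
    rw [hF.norm_T, hF.norm_T, mul_one, mul_one, div_le_div_iff₀ (norm_sq_pos_of_ne h0) hd]
    calc _ ≤ 6 * C * (K * ‖γ t + s • n t - γ u‖ ^ 2) := by gcongr
      _ = _ := by ring
  have hcoef : ‖τ t * ψ t - τ u * ψ u * ((1 + s * τ t : ℝ) : ℂ)‖
      ≤ ‖τ t * ψ t - τ u * ψ u‖ + |s| * (K * K * R) := by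
    have e : (τ t * ψ t - τ u * ψ u * ((1 + s * τ t : ℝ) : ℂ) : ℂ)
        = (τ t * ψ t - τ u * ψ u) - s * (τ u * τ t * ψ u) := by push_cast; ring
    rw [e]
    refine (norm_sub_le _ _).trans ?_
    gcongr
    simp only [norm_mul, Complex.norm_real, Real.norm_eq_abs]
    gcongr
    · exact hT.abs_τ_le u
    · exact hT.abs_τ_le t
    · exact hR u
  rw [concentratedPart, norm_mul, norm_mul, Complex.norm_real, Real.norm_eq_abs]
  calc _ ≤ |s| * (‖τ t * ψ t - τ u * ψ u‖ + |s| * (K * K * R))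
        * (6 * C * K / (s ^ 2 + (K ^ 2)⁻¹ * (t - u) ^ 2)) := by gcongr
    _ = _ := by ring

/-- The concentrated part tends to zero, boundedly in `u`. -/
theorem exists_bound_integral_concentratedPart (hG : IsRadialSolution k G G₁ G₂)
    (hF : IsArcFrame L γ T n τ) (hT : IsTube L γ T n τ K δ) (hψ : IsBoundaryTest L ψ) :
    (∃ B, ∀ s, |s| ≤ δ → s ≠ 0 → ∀ u,
      ‖∫ t in Set.Ioc 0 L, concentratedPart G₁ G₂ γ T n τ ψ s t u‖ ≤ B) ∧
    ∀ u, Tendsto (fun s => ∫ t in Set.Ioc 0 L, concentratedPart G₁ G₂ γ T n τ ψ s t u) (𝓝[≠] 0)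
      (𝓝 0) := by
  obtain ⟨C, hB⟩ := hG.exists_radialBound K
  have hC := hB.nonneg
  have hL := hF.length_pos
  have hK1 := hT.one_le
  have hK : 0 < K := by linarith
  obtain ⟨R, hR0, hR⟩ := hψ.exists_bound hL
  have cτ := hF.continuous_τ
  have cψ := hψ.continuous
  set c := (K ^ 2)⁻¹ with hc
  have hc0 : 0 < c := by positivity
  set h : ℝ → ℝ → ℝ := fun u t => ‖τ t * ψ t - τ u * ψ u‖ with hh
  have ch : ∀ u, Continuous (h u) := fun u => by fun_prop
  have hhb : ∀ u t, |h u t| ≤ 2 * (K * R) := fun u t => by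
    have h1 : ∀ t, ‖(τ t : ℂ) * ψ t‖ ≤ K * R := fun t => by
      rw [norm_mul, Complex.norm_real, Real.norm_eq_abs]
      gcongr
      · exact hT.abs_τ_le t
      · exact (hR t).1
    rw [abs_of_nonneg (norm_nonneg _)]
    exact (norm_sub_le _ _).trans (by linarith [h1 t, h1 u])
  set I := ∫ w : ℝ, (1 + c * w ^ 2)⁻¹ with hI
  -- the total bound, an integral over the whole line
  have key : ∀ s, |s| ≤ δ → s ≠ 0 → ∀ u,
      ‖∫ t in Set.Ioc 0 L, concentratedPart G₁ G₂ γ T n τ ψ s t u‖ ≤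
        6 * C * K * ((∫ t, h u t * (|s| / (s ^ 2 + c * (t - u) ^ 2))) + |s| * (K * K * R) * I) := by
    intro s hs hs0 u
    have hper : Function.Periodic (fun t => concentratedPart G₁ G₂ γ T n τ ψ s t u) L := fun t => by
      simp only [concentratedPart, hF.periodic t, hF.periodic_T t, hF.periodic_n t,
        hF.periodic_τ t, hψ.periodic t]
    have p1 := integrable_poisson (ch u) (hhb u) hc0 u hs0
    have p2 := integrable_poisson (continuous_const (y := |s| * (K * K * R)))
      (B := |(|s| * (K * K * R))|) (fun _ => le_rfl) hc0 u hs0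
    have p3 : Integrable fun t => 6 * C * K * ((h u t + |s| * (K * K * R))
        * (|s| / (s ^ 2 + c * (t - u) ^ 2))) :=
      ((p1.add p2).const_mul (6 * C * K)).congr (Eventually.of_forall fun t => by
        simp only [Pi.add_apply]; ring)
    rw [hper.setIntegral_shift hL u]
    calc _ ≤ ∫ t in Set.Ioc (u - L / 2) (u + L / 2), 6 * C * K * ((h u t + |s| * (K * K * R))
            * (|s| / (s ^ 2 + c * (t - u) ^ 2))) := by
          refine norm_integral_le_of_norm_le p3.restrict ?_
          filter_upwards [ae_restrict_mem measurableSet_Ioc] with t ht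
          exact norm_concentratedPart_le hF hT hB (fun t => (hR t).1) hs hs0
            (abs_le.2 ⟨by linarith [ht.1], by linarith [ht.2]⟩)
      _ ≤ ∫ t, 6 * C * K * ((h u t + |s| * (K * K * R)) * (|s| / (s ^ 2 + c * (t - u) ^ 2))) := by
          refine setIntegral_le_integral p3 (Eventually.of_forall fun t => ?_)
          have : 0 ≤ h u t := norm_nonneg _
          simp only [Pi.zero_apply]
          positivity
      _ = 6 * C * K * ((∫ t, h u t * (|s| / (s ^ 2 + c * (t - u) ^ 2)))
            + ∫ t, |s| * (K * K * R) * (|s| / (s ^ 2 + c * (t - u) ^ 2))) := by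
          rw [integral_const_mul, ← integral_add p1 p2]
          simp only [add_mul]
      _ = _ := by
          rw [integral_poisson (fun _ => |s| * (K * K * R)) c u hs0]
          simp only [div_eq_mul_inv, integral_const_mul, hI]
  have hI0 : 0 ≤ I := integral_nonneg fun w => by positivity
  refine ⟨⟨6 * C * K * (2 * (K * R) * I + δ * (K * K * R) * I), fun s hs hs0 u => ?_⟩, fun u => ?_⟩
  · refine (key s hs hs0 u).trans ?_
    gcongr
    exact integral_poisson_le (ch u) (hhb u) hc0 u hs0
  · have l1 := tendsto_integral_poisson (ch u) (hhb u) hc0 u (by simp [hh])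
    have l2 : Tendsto (fun s : ℝ => |s| * (K * K * R) * I) (𝓝[≠] 0) (𝓝 0) := by
      have : Continuous fun s : ℝ => |s| * (K * K * R) * I := by fun_prop
      simpa using (this.tendsto 0).mono_left (nhdsWithin_le_nhds (s := {0}ᶜ))
    have l3 := ((l1.add l2).const_mul (6 * C * K))
    rw [add_zero, mul_zero] at l3
    refine squeeze_zero_norm' ?_ l3
    have hev : ∀ᶠ s in 𝓝[≠] (0 : ℝ), |s| ≤ δ := by
      filter_upwards [nhdsWithin_le_nhds (Icc_mem_nhds (neg_lt_zero.2 hT.pos) hT.pos)] with s hs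
        using abs_le.2 hs
    filter_upwards [hev, self_mem_nhdsWithin] with s hs hs0
    exact key s hs hs0 u

end Limit

/-! ### Integration by parts on the boundary -/

section Boundary

variable {k : ℝ} {G G₁ G₂ : ℝ → ℂ} {L : ℝ} {γ T n : ℝ → Plane} {τ : ℝ → ℝ} {K δ C : ℝ} {ψ : ℝ → ℂ}

theorem norm_radialGrad_T_sub_le_chord (hF : IsArcFrame L γ T n τ) (hT : IsTube L γ T n τ K δ)
    (hB : RadialBound G G₁ G₂ K C) (t u : ℝ) :
    ‖radialGrad G₁ (γ t - γ u) (T u - T t)‖ ≤ 4 * C * K ^ 2 * ‖γ t - γ u‖ := by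
  have hC := hB.nonneg
  by_cases h : γ t - γ u = 0
  · rw [h, radialGrad_zero_left, norm_zero, norm_zero, mul_zero]
  · have h0 := norm_sq_pos_of_ne h
    have h1 := hT.sq_normal_le (s := 0) (by simpa using hT.pos.le) t u
    rw [zero_smul, add_zero] at h1
    refine (hB.norm_radialGrad_le h h1).trans ?_
    rw [div_le_iff₀ h0]
    calc _ ≤ 2 * C * (2 * K ^ 2 * ‖γ t - γ u‖ ^ 3) := by
          gcongr; exact hT.abs_inner_T_sub_le hF t u
      _ = _ := by ring

/-- By the Helmholtz equation, the tangential derivative of the gradient in the direction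
`T u - T t` contains the bounded kernel of the first-order operator. -/
theorem hasDerivAt_radialGrad_T_sub (hG : IsRadialSolution k G G₁ G₂) (hF : IsArcFrame L γ T n τ)
    {t u : ℝ} (h : γ t ≠ γ u) :
    HasDerivAt (fun t => radialGrad G₁ (γ t - γ u) (T u - T t))
      (radialHess G₁ G₂ (γ t - γ u) (n t) (n t - n u) + τ t * radialGrad G₁ (γ t - γ u) (n t)
        + (k : ℂ) ^ 2 * G (‖γ t - γ u‖ ^ 2) * (1 - (inner ℝ (T t) (T u) : ℝ))) t := by
  have h0 := sub_ne_zero.2 h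
  have hX : HasDerivAt (fun t => γ t - γ u) (T t) t := (hF.hasDerivAt t).sub_const _
  have hA : HasDerivAt (fun t => T u - T t) (τ t • n t) t :=
    ((hF.hasDerivAt_T t).const_sub (T u)).congr_deriv (neg_neg _)
  refine (hG.hasDerivAt_radialGrad_comp hX hA h0).congr_deriv ?_
  have e1 := hG.radialHess_normal h0 (hF.inner_frame (γ t - γ u) t u) (hF.inner_n t u)
  have e2 := hG.radialHess_normal h0 (hF.inner_frame (γ t - γ u) t t) (hF.inner_n t t)
  rw [real_inner_self_eq_norm_sq (T t), hF.norm_T] at e2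
  rw [radialGrad_smul, radialHess_sub, e1, e2, radialHess_comm, radialHess_sub]
  push_cast
  ring

/-- The tangential component of the gradient in the direction `T u - T t` is continuous across the
diagonal, although the gradient is not. -/
theorem continuous_radialGrad_T_sub (hG : IsRadialSolution k G G₁ G₂)
    (hF : IsArcFrame L γ T n τ) (hT : IsTube L γ T n τ K δ) (u : ℝ) :
    Continuous fun t => radialGrad G₁ (γ t - γ u) (T u - T t) := by
  obtain ⟨C, hB⟩ := hG.exists_radialBound K
  refine continuous_iff_continuousAt.2 fun t => ?_
  by_cases h : γ t = γ u
  · have h0 : radialGrad G₁ (γ t - γ u) (T u - T t) = 0 := by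
      rw [h, sub_self, radialGrad_zero_left]
    have hc : Continuous fun t => 4 * C * K ^ 2 * ‖γ t - γ u‖ := by
      have := hF.continuous
      fun_prop
    have hl := hc.tendsto t
    rw [h, sub_self, norm_zero, mul_zero] at hl
    rw [ContinuousAt, h0]
    exact squeeze_zero_norm (fun t => norm_radialGrad_T_sub_le_chord hF hT hB t u) hl
  · exact (hasDerivAt_radialGrad_T_sub hG hF h).continuousAt

theorem measurable_kernel_hess (hG : IsRadialSolution k G G₁ G₂) (hF : IsArcFrame L γ T n τ) :
    Measurable (Function.uncurry fun t u =>
      radialHess G₁ G₂ (γ t - γ u) (n t) (n t - n u)) := by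
  have h1 := hF.continuous
  have h2 := hF.continuous_n
  refine measurable_radialHess hG.measurable₁ hG.measurable₂ ?_ ?_ ?_ <;>
  exact Continuous.measurable (by fun_prop)

theorem measurable_kernel_grad (hG : IsRadialSolution k G G₁ G₂) (hF : IsArcFrame L γ T n τ) :
    Measurable (Function.uncurry fun t u => radialGrad G₁ (γ t - γ u) (n t)) := by
  have h1 := hF.continuous
  have h2 := hF.continuous_n
  refine measurable_radialGrad hG.measurable₁ ?_ ?_ <;>
  exact Continuous.measurable (by fun_prop)

theorem isWeakKernel_hess (hG : IsRadialSolution k G G₁ G₂) (hF : IsArcFrame L γ T n τ)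
    (hT : IsTube L γ T n τ K δ) :
    IsWeakKernel L fun t u => radialHess G₁ G₂ (γ t - γ u) (n t) (n t - n u) := by
  obtain ⟨C, hB⟩ := hG.exists_radialBound K
  refine IsWeakKernel.of_bound (measurable_kernel_hess hG hF) (B := 10 * C * K ^ 4) fun t u => ?_
  simpa using norm_radialHess_offset_le hF hT hB (ε := 0) (by simpa using hT.pos.le) t u

theorem isWeakKernel_grad (hG : IsRadialSolution k G G₁ G₂) (hF : IsArcFrame L γ T n τ)
    (hT : IsTube L γ T n τ K δ) :
    IsWeakKernel L fun t u => radialGrad G₁ (γ t - γ u) (n t) := by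
  obtain ⟨C, hB⟩ := hG.exists_radialBound K
  refine IsWeakKernel.of_bound (measurable_kernel_grad hG hF) (B := 4 * C * K ^ 2) fun t u => ?_
  simpa using norm_radialGrad_offset_le hF hT hB (ε := 0) (by simpa using hT.pos.le) t u

/-- Integration by parts on the boundary itself: in the limit of the normal derivative, the terms
other than those with the single layer kernel have bounded kernels. -/
theorem integral_regularPart_zero (hG : IsRadialSolution k G G₁ G₂) (hF : IsArcFrame L γ T n τ)
    (hT : IsTube L γ T n τ K δ) (hψ : IsBoundaryTest L ψ) (u : ℝ) :
    ∫ t in Set.Ioc 0 L, regularPart k G G₁ γ T n τ ψ 0 t u =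
      (∫ t in Set.Ioc 0 L, radialHess G₁ G₂ (γ t - γ u) (n t) (n t - n u) * ψ t)
      + (∫ t in Set.Ioc 0 L, radialGrad G₁ (γ t - γ u) (n t) * (τ t * ψ t))
      + (∫ t in Set.Ioc 0 L, G (‖γ t - γ u‖ ^ 2) * deriv (deriv ψ) t)
      + (k : ℂ) ^ 2 * ∫ t in Set.Ioc 0 L, G (‖γ t - γ u‖ ^ 2) * ψ t := by
  have hL := hF.length_pos
  have cT := hF.continuous_T
  have cτ := hF.continuous_τ
  have c0 := hψ.continuous
  have c1 := hψ.continuous_deriv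
  have cW := continuous_radialGrad_T_sub hG hF hT u
  have ci : Continuous fun t => ((inner ℝ (T t) (T u) : ℝ) : ℂ) * ψ t := by fun_prop
  have cτψ : Continuous fun t => (τ t : ℂ) * ψ t := by fun_prop
  have j1 := (isWeakKernel_hess hG hF hT).integrable_mul c0 u
  have j2 := (isWeakKernel_grad hG hF hT).integrable_mul cτψ u
  have j3 := (isWeakKernel_singleLayer hG hF hT).integrable_mul hψ.continuous_deriv_deriv u
  have j4 := ((isWeakKernel_singleLayer hG hF hT).integrable_mul c0 u).const_mul ((k : ℂ) ^ 2)
  have j5 := ((isWeakKernel_singleLayer hG hF hT).integrable_mul ci u).const_mul ((k : ℂ) ^ 2)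
  have cWψ : Continuous fun t => radialGrad G₁ (γ t - γ u) (T u - T t) * deriv ψ t := cW.mul c1
  have j6 := cWψ.integrable_Ioc 0 L
  set h1 := fun t => radialHess G₁ G₂ (γ t - γ u) (n t) (n t - n u) * ψ t with e1
  set h2 := fun t => radialGrad G₁ (γ t - γ u) (n t) * (τ t * ψ t) with e2
  set h3 := fun t => G (‖γ t - γ u‖ ^ 2) * deriv (deriv ψ) t with e3
  set h4 := fun t => (k : ℂ) ^ 2 * (G (‖γ t - γ u‖ ^ 2) * ψ t) with e4
  set h5 := fun t => (k : ℂ) ^ 2 * (G (‖γ t - γ u‖ ^ 2) * ((inner ℝ (T t) (T u) : ℝ) * ψ t)) with e5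
  set h6 := fun t => radialGrad G₁ (γ t - γ u) (T u - T t) * deriv ψ t with e6
  have jsum : Integrable (fun t => h1 t + h2 t + h3 t + h4 t)
      (volume.restrict (Set.Ioc 0 L)) := ((j1.add j2).add j3).add j4
  have jder : Integrable (fun t => h1 t + h2 t + (h4 t - h5 t) + h6 t)
      (volume.restrict (Set.Ioc 0 L)) := ((j1.add j2).add (j4.sub j5)).add j6
  have hper : radialGrad G₁ (γ L - γ u) (T u - T L) * ψ L
      = radialGrad G₁ (γ 0 - γ u) (T u - T 0) * ψ 0 := by
    have p1 := hF.periodic 0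
    have p2 := hF.periodic_T 0
    have p3 := hψ.periodic 0
    rw [zero_add] at p1 p2 p3
    rw [p1, p2, p3]
  have key : ∫ t in Set.Ioc 0 L, h1 t + h2 t + (h4 t - h5 t) + h6 t = 0 := by
    rw [← intervalIntegral.integral_of_le hL.le,
      integral_eq_of_hasDerivAt_off_countable
        (fun t => radialGrad G₁ (γ t - γ u) (T u - T t) * ψ t) _ (hF.countable_eq u)
        (cW.mul c0).continuousOn (fun t ht => ?_)
        ((intervalIntegrable_iff_integrableOn_Ioc_of_le hL.le).2 jder), hper, sub_self]
    refine ((hasDerivAt_radialGrad_T_sub hG hF ht.2).mul (hψ.hasDerivAt t)).congr_deriv ?_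
    simp only [e1, e2, e4, e5, e6]
    ring
  have esum : ∫ t in Set.Ioc 0 L, h1 t + h2 t + h3 t + h4 t
      = (∫ t in Set.Ioc 0 L, h1 t) + (∫ t in Set.Ioc 0 L, h2 t) + (∫ t in Set.Ioc 0 L, h3 t)
        + ∫ t in Set.Ioc 0 L, h4 t := by
    have j12 : Integrable (fun t => h1 t + h2 t) (volume.restrict (Set.Ioc 0 L)) := j1.add j2
    have j123 : Integrable (fun t => h1 t + h2 t + h3 t) (volume.restrict (Set.Ioc 0 L)) :=
      j12.add j3
    rw [integral_add j123 j4, integral_add j12 j3, integral_add j1 j2]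
  rw [← integral_const_mul, ← esum, ← sub_zero (∫ t in Set.Ioc 0 L, h1 t + h2 t + h3 t + h4 t),
    ← key, ← integral_sub jsum jder]
  refine integral_congr_ae (Eventually.of_forall fun t => ?_)
  simp only [regularPart, e1, e2, e3, e4, e5, e6, zero_smul, add_zero, Complex.ofReal_zero,
    zero_mul]
  ring

/-- The normal derivative of the double layer potential converges, as a distribution. -/
theorem tendsto_integral_hyperKernel (hG : IsRadialSolution k G G₁ G₂)
    (hF : IsArcFrame L γ T n τ) (hT : IsTube L γ T n τ K δ) (hψ : IsBoundaryTest L ψ)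
    {f : ℝ → ℂ} (hf : Integrable f (volume.restrict (Set.Ioc 0 L))) :
    Tendsto (fun s => ∫ t in Set.Ioc 0 L, (∫ u in Set.Ioc 0 L, hyperKernel G₁ G₂ γ n s t u * f u)
      * ψ t) (𝓝[≠] 0)
      (𝓝 (∫ u in Set.Ioc 0 L, (∫ t in Set.Ioc 0 L, regularPart k G G₁ γ T n τ ψ 0 t u) * f u)) := by
  obtain ⟨C, hB⟩ := hG.exists_radialBound K
  obtain ⟨⟨B₁, hB₁⟩, h1⟩ := exists_bound_integral_regularPart hG hF hT hψ
  obtain ⟨⟨B₂, hB₂⟩, h2⟩ := exists_bound_integral_concentratedPart hG hF hT hψ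
  have hev : ∀ᶠ s in 𝓝[≠] (0 : ℝ), |s| ≤ δ ∧ s ≠ 0 := by
    filter_upwards [nhdsWithin_le_nhds (Icc_mem_nhds (neg_lt_zero.2 hT.pos) hT.pos),
      self_mem_nhdsWithin] with s hs hs0 using ⟨abs_le.2 hs, hs0⟩
  have hK : ∀ s, |s| ≤ δ ∧ s ≠ 0 → IsWeakKernel L (hyperKernel G₁ G₂ γ n s) := fun s hs =>
    IsWeakKernel.of_bound (measurable_hyperKernel hG hF s)
      fun t u => norm_hyperKernel_le hF hT hB hs.1 hs.2 t u
  have key : Tendsto (fun s => ∫ u in Set.Ioc 0 L,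
      (∫ t in Set.Ioc 0 L, hyperKernel G₁ G₂ γ n s t u * ψ t) * f u) (𝓝[≠] 0)
      (𝓝 (∫ u in Set.Ioc 0 L,
        (∫ t in Set.Ioc 0 L, regularPart k G G₁ γ T n τ ψ 0 t u) * f u)) := by
    refine tendsto_integral_filter_of_dominated_convergence (fun u => (B₁ + B₂) * ‖f u‖) ?_ ?_
      (hf.norm.const_mul _) (Eventually.of_forall fun u => ?_)
    · filter_upwards [hev] with s hs
      exact ((hK s hs).integral_swap hψ.continuous hf).1.aestronglyMeasurable
    · filter_upwards [hev] with s hs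
      refine Eventually.of_forall fun u => ?_
      rw [norm_mul, integral_hyperKernel hG hF hT hψ hs.1 hs.2]
      gcongr
      exact (norm_sub_le _ _).trans (add_le_add (hB₁ s hs.1 u) (hB₂ s hs.1 hs.2 u))
    · have h := ((h1 u).mono_left (nhdsWithin_le_nhds (s := {0}ᶜ))).sub (h2 u)
      rw [sub_zero] at h
      refine (h.congr' ?_).mul_const (f u)
      filter_upwards [hev] with s hs
      rw [integral_hyperKernel hG hF hT hψ hs.1 hs.2]
  refine key.congr' ?_
  filter_upwards [hev] with s hs
  exact ((hK s hs).integral_swap hψ.continuous hf).2.symm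

end Boundary

/-! ### Layer potentials in terms of arc length -/

theorem stronglyMeasurable_radialHessL {G₁ G₂ : ℝ → ℂ} (h₁ : Measurable G₁) (h₂ : Measurable G₂)
    {X A : ℝ → Plane} (hX : Continuous X) (hA : Continuous A) :
    StronglyMeasurable fun u => radialHessL G₁ G₂ (X u) (A u) := by
  have hi : ∀ Y : ℝ → Plane, Continuous Y →
      StronglyMeasurable fun u => Complex.ofRealCLM.comp (innerSL ℝ (Y u)) := fun Y hY =>
    Continuous.stronglyMeasurable (by fun_prop)
  have h3 : StronglyMeasurable fun u => 2 * G₁ (‖X u‖ ^ 2) :=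
    ((h₁.comp (hX.norm.pow 2).measurable).const_mul 2).stronglyMeasurable
  have h4 : StronglyMeasurable fun u => 4 * G₂ (‖X u‖ ^ 2) * ((inner ℝ (X u) (A u) : ℝ) : ℂ) :=
    (((h₂.comp (hX.norm.pow 2).measurable).const_mul 4).mul
      (Complex.continuous_ofReal.comp (hX.inner hA)).measurable).stronglyMeasurable
  exact (h3.smul (hi A hA)).add (h4.smul (hi X hX))

/-- Differentiation of the double layer potential under the integral sign, off the curve. -/
theorem hasFDerivAt_integral_radialGrad {k : ℝ} {G G₁ G₂ : ℝ → ℂ}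
    (hG : IsRadialSolution k G G₁ G₂) {L : ℝ} {γ n : ℝ → Plane} (hγ : Continuous γ)
    (hn : Continuous n) (hn1 : ∀ u, ‖n u‖ = 1) {f : ℝ → ℂ}
    (hf : Integrable f (volume.restrict (Set.Ioc 0 L))) {x₀ : Plane} {r M : ℝ} (hr : 0 < r)
    (hlow : ∀ u, r ≤ ‖x₀ - γ u‖) (hup : ∀ u, ‖x₀ - γ u‖ ≤ M) :
    ∃ ℓ : Plane →L[ℝ] ℂ,
      HasFDerivAt (fun x => ∫ u in Set.Ioc 0 L, -radialGrad G₁ (x - γ u) (n u) * f u) ℓ x₀ ∧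
      ∀ a, ℓ a = ∫ u in Set.Ioc 0 L, -radialHess G₁ G₂ (x₀ - γ u) a (n u) * f u := by
  obtain ⟨C, hB⟩ := hG.exists_radialBound ((M + r) ^ 2)
  have hC := hB.nonneg
  set F' : Plane → ℝ → Plane →L[ℝ] ℂ := fun x u => f u • -radialHessL G₁ G₂ (x - γ u) (n u)
  have hball : ∀ x ∈ Metric.ball x₀ (r / 2), ∀ u, r / 2 ≤ ‖x - γ u‖ ∧ ‖x - γ u‖ ≤ M + r := by
    intro x hx u
    rw [mem_ball_iff_norm] at hx
    have h1 := norm_sub_le_norm_sub_add_norm_sub x₀ x (γ u)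
    have h2 := norm_sub_le_norm_sub_add_norm_sub x x₀ (γ u)
    rw [norm_sub_rev x₀ x] at h1
    exact ⟨by linarith [hlow u], by linarith [hup u]⟩
  have hne : ∀ x ∈ Metric.ball x₀ (r / 2), ∀ u, x - γ u ≠ 0 := fun x hx u =>
    norm_pos_iff.1 ((half_pos hr).trans_le (hball x hx u).1)
  have hmem : x₀ ∈ Metric.ball x₀ (r / 2) := Metric.mem_ball_self (half_pos hr)
  have hsq : ∀ x ∈ Metric.ball x₀ (r / 2), ∀ u, ‖x - γ u‖ ^ 2 ≤ (M + r) ^ 2 := fun x hx u =>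
    pow_le_pow_left₀ (norm_nonneg _) (hball x hx u).2 2
  have hbound : ∀ u, ∀ x ∈ Metric.ball x₀ (r / 2), ‖F' x u‖ ≤ 6 * C / (r / 2) ^ 2 * ‖f u‖ := by
    intro u x hx
    rw [norm_smul, norm_neg, mul_comm]
    gcongr
    refine ContinuousLinearMap.opNorm_le_bound _ (by positivity) fun a => ?_
    rw [radialHessL_apply]
    refine (hB.norm_radialHess_le_div (hne x hx u) (hsq x hx u)).trans ?_
    have h1 := (hball x hx u).1
    rw [hn1, one_mul, div_mul_eq_mul_div]
    gcongr
  have hF'm : AEStronglyMeasurable (F' x₀) (volume.restrict (Set.Ioc 0 L)) :=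
    hf.aestronglyMeasurable.smul (stronglyMeasurable_radialHessL hG.measurable₁ hG.measurable₂
      (continuous_const.sub hγ) hn).aestronglyMeasurable.neg
  have hgm : ∀ x : Plane, Measurable fun u => -radialGrad G₁ (x - γ u) (n u) := fun x =>
    (measurable_radialGrad hG.measurable₁ (continuous_const.sub hγ).measurable hn.measurable).neg
  refine ⟨∫ u in Set.Ioc 0 L, F' x₀ u, ?_, fun a => ?_⟩
  · refine hasFDerivAt_integral_of_dominated_of_fderiv_le
      (bound := fun u => 6 * C / (r / 2) ^ 2 * ‖f u‖)
      (Metric.ball_mem_nhds x₀ (half_pos hr))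
      (Eventually.of_forall fun x => (hgm x).aestronglyMeasurable.mul hf.aestronglyMeasurable)
      (hf.bdd_mul (c := 2 * C / r) (hgm x₀).aestronglyMeasurable (Eventually.of_forall fun u => ?_))
      hF'm (Eventually.of_forall hbound) (hf.norm.const_mul _)
      (Eventually.of_forall fun u x hx => ?_)
    · rw [norm_neg]
      refine (hB.norm_radialGrad_le_div (hne x₀ hmem u) (hsq x₀ hmem u)).trans ?_
      rw [hn1, mul_one]
      exact div_le_div_of_nonneg_left (by positivity) hr (hlow u)
    · have h1 : HasFDerivAt (fun x => radialGrad G₁ (x - γ u) (n u))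
          (radialHessL G₁ G₂ (x - γ u) (n u)) x := by
        exact (hG.hasFDerivAt_radialGrad (hne x hx u) (n u)).comp x
          ((hasFDerivAt_id x).sub_const (γ u))
      exact h1.neg.mul_const (f u)
  · have hi : Integrable (F' x₀) (volume.restrict (Set.Ioc 0 L)) :=
      (hf.norm.const_mul _).mono' hF'm (Eventually.of_forall fun u => hbound u x₀ hmem)
    rw [ContinuousLinearMap.integral_apply hi]
    refine integral_congr_ae (Eventually.of_forall fun u => ?_)
    simp only [F', smul_apply, neg_apply,
      radialHessL_apply, radialHess_comm G₁ G₂ _ (n u) a, smul_eq_mul]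
    ring

/-- The first-order coefficient in the expansion of the Neumann–Poincaré operator of the coated
domain. -/
def firstOrderOperator (G₁ G₂ : ℝ → ℂ) (D : Set Plane) (L : ℝ) (γ : ℝ → Plane) (φ : Plane → ℂ)
    (x : Plane) : ℂ :=
  ∫ u in Set.Ioc 0 L,
    (signedCurvature D γ (γ u) * radialGrad G₁ (x - γ u) (outwardNormal D x) +
      radialHess G₁ G₂ (x - γ u) (outwardNormal D x)
        (outwardNormal D x - outwardNormal D (γ u))) * φ (γ u)

theorem MemBoundaryL2.integrable {L : ℝ} {γ : ℝ → Plane} {φ : Plane → ℂ}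
    (hφ : MemBoundaryL2 L γ φ) :
    Integrable (fun u => φ (γ u)) (volume.restrict (Set.Ioc 0 L)) :=
  MemLp.integrable one_le_two hφ

namespace IsC2Domain

variable {D : Set Plane} {L : ℝ} {γ : ℝ → Plane} (hD : IsC2Domain D L γ)
  {k : ℝ} {G G₁ G₂ : ℝ → ℂ} (hG : IsRadialSolution k G G₁ G₂)
  (hfs : ∀ x y : Plane, x ≠ y → fundSol k x y = G (‖x - y‖ ^ 2))

include hD

theorem arcIntegral_eq (f : Plane → ℂ) :
    arcIntegral L γ f = ∫ u in Set.Ioc 0 L, f (γ u) := by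
  rw [arcIntegral, intervalIntegral.integral_of_le hD.length_pos.le]
  simp [hD.norm_deriv]

theorem boundaryPairing_eq (v : Plane → ℂ) (ψ : ℝ → ℂ) :
    boundaryPairing L γ v ψ = ∫ t in Set.Ioc 0 L, v (γ t) * ψ t :=
  intervalIntegral.integral_of_le hD.length_pos.le

include hfs in
theorem singleLayer_eq (φ : Plane → ℂ) (t : ℝ) :
    singleLayer k L γ φ (γ t) = ∫ u in Set.Ioc 0 L, G (‖γ t - γ u‖ ^ 2) * φ (γ u) := by
  rw [singleLayer, hD.arcIntegral_eq]
  refine integral_congr_ae ?_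
  filter_upwards [hD.isArcFrame_outwardNormal.ae_ne t (volume.restrict (Set.Ioc 0 L))] with u hu
  rw [hfs _ _ hu.symm]

include hG hfs

theorem neumannPoincare_eq (φ : Plane → ℂ) (t : ℝ) :
    neumannPoincare k D L γ φ (γ t) =
      ∫ u in Set.Ioc 0 L, radialGrad G₁ (γ t - γ u) (outwardNormal D (γ t)) * φ (γ u) := by
  rw [neumannPoincare, hD.arcIntegral_eq]
  refine integral_congr_ae ?_
  filter_upwards [hD.isArcFrame_outwardNormal.ae_ne t (volume.restrict (Set.Ioc 0 L))] with u hu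
  rw [hG.fderiv_fundSol_left hfs hu.symm]

theorem doubleLayer_eq (φ : Plane → ℂ) {x : Plane} (hx : ∀ u, x ≠ γ u) :
    doubleLayer k D L γ φ x =
      ∫ u in Set.Ioc 0 L, -radialGrad G₁ (x - γ u) (outwardNormal D (γ u)) * φ (γ u) := by
  rw [doubleLayer, hD.arcIntegral_eq]
  refine integral_congr_ae (Eventually.of_forall fun u => ?_)
  simp only [hG.fderiv_fundSol_right hfs (hx u)]

section Tube

variable {K δ : ℝ} (hT : IsTube L γ (deriv γ) (fun t => outwardNormal D (γ t))
  (fun t => signedCurvature D γ (γ t)) K δ)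

include hT

theorem coatedNeumannPoincare_eq {ε : ℝ} (h0 : 0 < ε) (hε : ε < δ) (φ : Plane → ℂ) (t : ℝ) :
    coatedNeumannPoincare k D L γ ε (transportDensity D ε φ) (offsetMap D ε (γ t)) =
      ∫ u in Set.Ioc 0 L, coatedKernel G₁ γ (fun t => outwardNormal D (γ t))
        (fun t => signedCurvature D γ (γ t)) ε t u * φ (γ u) := by
  have hεa : |ε| ≤ δ := by rw [abs_of_pos h0]; exact hε.le
  rw [coatedNeumannPoincare, neumannPoincare, arcIntegral,
    intervalIntegral.integral_of_le hD.length_pos.le]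
  refine integral_congr_ae ?_
  filter_upwards [hD.isArcFrame_outwardNormal.ae_ne t (volume.restrict (Set.Ioc 0 L))] with u hu
  have hne : offsetMap D ε (γ t) ≠ offsetMap D ε (γ u) := fun h =>
    hu.symm (eq_of_tube hT hεa hεa h).1
  have e : offsetMap D ε (γ t) - offsetMap D ε (γ u)
      = γ t - γ u + ε • (outwardNormal D (γ t) - outwardNormal D (γ u)) := by
    simp only [offsetMap]; module
  rw [hD.norm_deriv_offsetMap hT hεa, hD.transportDensity_offsetMap hT hεa,
    hG.fderiv_fundSol_left hfs hne, hD.outwardNormal_coatedDomain hT h0 hε, e, coatedKernel]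
  ring

theorem fderiv_doubleLayer_eq {φ : Plane → ℂ} (hφ : MemBoundaryL2 L γ φ) {s : ℝ} (hs : |s| ≤ δ)
    (hs0 : s ≠ 0) (t : ℝ) :
    fderiv ℝ (doubleLayer k D L γ φ) (γ t + s • outwardNormal D (γ t)) (outwardNormal D (γ t)) =
      ∫ u in Set.Ioc 0 L, hyperKernel G₁ G₂ γ (fun t => outwardNormal D (γ t)) s t u
        * φ (γ u) := by
  have hF := hD.isArcFrame_outwardNormal
  have hK := hT.one_le
  have hsa : 0 < |s| := abs_pos.2 hs0
  have hlow : ∀ u, |s| / K ≤ ‖γ t + s • outwardNormal D (γ t) - γ u‖ := fun u => by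
    rw [div_le_iff₀' (by linarith)]
    exact hT.abs_le_normal hs t u
  have hup : ∀ u, ‖γ t + s • outwardNormal D (γ t) - γ u‖ ≤ K := fun u => by
    have h1 := hT.sq_normal_le hs t u
    refine (sq_le_sq₀ (norm_nonneg _) (by linarith)).1 (h1.trans ?_)
    nlinarith
  obtain ⟨ℓ, hℓ, hℓa⟩ := hasFDerivAt_integral_radialGrad hG hF.continuous hF.continuous_n
    hF.norm_n hφ.integrable (by positivity) hlow hup
  have hclosed : IsClosed (Set.range γ) := hD.range_eq ▸ isClosed_frontier
  have hnot : γ t + s • outwardNormal D (γ t) ∈ (Set.range γ)ᶜ := by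
    rintro ⟨u, hu⟩
    exact hT.normal_ne_zero hs (Or.inr hs0) (sub_eq_zero.2 hu.symm)
  have heq : doubleLayer k D L γ φ =ᶠ[𝓝 (γ t + s • outwardNormal D (γ t))] fun x =>
      ∫ u in Set.Ioc 0 L, -radialGrad G₁ (x - γ u) (outwardNormal D (γ u)) * φ (γ u) := by
    filter_upwards [hclosed.isOpen_compl.mem_nhds hnot] with x hx
    exact hD.doubleLayer_eq hG hfs φ fun u hu => hx ⟨u, hu.symm⟩
  rw [(hℓ.congr_of_eventuallyEq heq).fderiv, hℓa]
  rfl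

end Tube

end IsC2Domain

namespace IsC2Domain

variable {D : Set Plane} {L : ℝ} {γ : ℝ → Plane} (hD : IsC2Domain D L γ)
  {k : ℝ} {G G₁ G₂ : ℝ → ℂ} (hG : IsRadialSolution k G G₁ G₂)
  (hfs : ∀ x y : Plane, x ≠ y → fundSol k x y = G (‖x - y‖ ^ 2))
  {K δ : ℝ} (hT : IsTube L γ (deriv γ) (fun t => outwardNormal D (γ t))
    (fun t => signedCurvature D γ (γ t)) K δ)
  {φ : Plane → ℂ} (hφ : MemBoundaryL2 L γ φ) {ψ : ℝ → ℂ} (hψ : IsBoundaryTest L ψ)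

include hD hG hfs hT hφ hψ

/-- The normal derivative of the double layer potential is the limit found by integrating by
parts. -/
theorem tendsto_boundaryPairing_fderiv_doubleLayer :
    Tendsto (fun s : ℝ => boundaryPairing L γ (fun x =>
        fderiv ℝ (doubleLayer k D L γ φ) (x + s • outwardNormal D x) (outwardNormal D x)) ψ)
      (𝓝[≠] 0)
      (𝓝 (∫ u in Set.Ioc 0 L, (∫ t in Set.Ioc 0 L, regularPart k G G₁ γ (deriv γ)
        (fun t => outwardNormal D (γ t)) (fun t => signedCurvature D γ (γ t)) ψ 0 t u)
          * φ (γ u))) := by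
  refine (tendsto_integral_hyperKernel hG hD.isArcFrame_outwardNormal hT hψ
    hφ.integrable).congr' ?_
  filter_upwards [nhdsWithin_le_nhds (Icc_mem_nhds (neg_lt_zero.2 hT.pos) hT.pos),
    self_mem_nhdsWithin] with s hs hs0
  rw [hD.boundaryPairing_eq]
  refine integral_congr_ae (Eventually.of_forall fun t => ?_)
  simp only [hD.fderiv_doubleLayer_eq hG hfs hT hφ (abs_le.2 hs) hs0 t]

/-- The formula for the first-order operator: both sides are the same combination of integrals
against `φ`, after exchanging the order of integration. -/
theorem boundaryPairing_firstOrderOperator :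
    boundaryPairing L γ (firstOrderOperator G₁ G₂ D L γ φ) ψ =
      boundaryPairing L γ
        (neumannPoincare k D L γ fun y => (signedCurvature D γ y : ℂ) * φ y) ψ
      - boundaryPairing L γ
        (fun x => (signedCurvature D γ x : ℂ) * neumannPoincare k D L γ φ x) ψ
      + (∫ u in Set.Ioc 0 L, (∫ t in Set.Ioc 0 L, regularPart k G G₁ γ (deriv γ)
        (fun t => outwardNormal D (γ t)) (fun t => signedCurvature D γ (γ t)) ψ 0 t u)
          * φ (γ u))
      - secondTangentialDeriv L γ (singleLayer k L γ φ) ψ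
      - (k : ℂ) ^ 2 * boundaryPairing L γ (singleLayer k L γ φ) ψ := by
  have hF := hD.isArcFrame_outwardNormal
  have hf := hφ.integrable
  obtain ⟨C, hB⟩ := hG.exists_radialBound K
  have c0 := hψ.continuous
  have cτ := hF.continuous_τ
  set n : ℝ → Plane := fun t => outwardNormal D (γ t) with hn
  set τ : ℝ → ℝ := fun t => signedCurvature D γ (γ t) with hτ
  set f : ℝ → ℂ := fun u => φ (γ u) with hfdef
  have cτψ : Continuous fun t => (τ t : ℂ) * ψ t := by fun_prop
  have hτf : Integrable (fun u => (τ u : ℂ) * f u) (volume.restrict (Set.Ioc 0 L)) :=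
    hf.bdd_mul (c := K) (Complex.continuous_ofReal.comp cτ).aestronglyMeasurable
      (Eventually.of_forall fun u => by
        simpa using hT.abs_τ_le u)
  have wE := IsWeakKernel.of_bound (L := L) (measurable_coatedKernelDeriv hG hF 0) fun t u =>
    norm_coatedKernelDeriv_le hF hT hB (ε := 0) (by simpa using hT.pos.le) t u
  have wH := isWeakKernel_hess hG hF hT
  have wA := isWeakKernel_grad hG hF hT
  have wS := isWeakKernel_singleLayer hG hF hT
  obtain ⟨-, e0⟩ := wE.integral_swap c0 hf
  obtain ⟨iH, -⟩ := wH.integral_swap c0 hf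
  obtain ⟨iA, e1⟩ := wA.integral_swap c0 hτf
  obtain ⟨iB, e2⟩ := wA.integral_swap cτψ hf
  obtain ⟨iS, e3⟩ := wS.integral_swap c0 hf
  obtain ⟨iS2, e4⟩ := wS.integral_swap hψ.continuous_deriv_deriv hf
  have p0 : boundaryPairing L γ (firstOrderOperator G₁ G₂ D L γ φ) ψ
      = (∫ u in Set.Ioc 0 L, (∫ t in Set.Ioc 0 L, radialGrad G₁ (γ t - γ u) (n t) * ψ t)
          * (τ u * f u))
        + ∫ u in Set.Ioc 0 L, (∫ t in Set.Ioc 0 L,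
          radialHess G₁ G₂ (γ t - γ u) (n t) (n t - n u) * ψ t) * f u := by
    rw [hD.boundaryPairing_eq, ← integral_add iA iH]
    have e : ∀ t, firstOrderOperator G₁ G₂ D L γ φ (γ t)
        = ∫ u in Set.Ioc 0 L, coatedKernelDeriv G₁ G₂ γ n τ 0 t u * f u := fun t => by
      simp only [firstOrderOperator, coatedKernelDeriv, zero_mul, add_zero, zero_smul,
        Complex.ofReal_one, one_mul, hn, hτ, hfdef]
    simp only [e]
    rw [e0]
    refine integral_congr_ae (Eventually.of_forall fun u => ?_)
    have h1 : ∀ t, coatedKernelDeriv G₁ G₂ γ n τ 0 t u * ψ t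
        = τ u * (radialGrad G₁ (γ t - γ u) (n t) * ψ t)
          + radialHess G₁ G₂ (γ t - γ u) (n t) (n t - n u) * ψ t := fun t => by
      simp only [coatedKernelDeriv, zero_mul, add_zero, zero_smul, Complex.ofReal_one, one_mul]
      ring
    simp only [h1]
    rw [integral_add ((wA.integrable_mul c0 u).const_mul _) (wH.integrable_mul c0 u),
      integral_const_mul]
    ring
  have p1 : boundaryPairing L γ
      (neumannPoincare k D L γ fun y => (signedCurvature D γ y : ℂ) * φ y) ψ
      = ∫ u in Set.Ioc 0 L, (∫ t in Set.Ioc 0 L, radialGrad G₁ (γ t - γ u) (n t) * ψ t)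
          * (τ u * f u) := by
    rw [hD.boundaryPairing_eq, ← e1]
    simp only [hD.neumannPoincare_eq hG hfs, hn, hτ, hfdef]
  have p2 : boundaryPairing L γ
      (fun x => (signedCurvature D γ x : ℂ) * neumannPoincare k D L γ φ x) ψ
      = ∫ u in Set.Ioc 0 L, (∫ t in Set.Ioc 0 L, radialGrad G₁ (γ t - γ u) (n t)
          * (τ t * ψ t)) * f u := by
    rw [hD.boundaryPairing_eq, ← e2]
    refine integral_congr_ae (Eventually.of_forall fun t => ?_)
    simp only [hD.neumannPoincare_eq hG hfs, hn, hτ, hfdef]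
    ring
  have p3 : boundaryPairing L γ (singleLayer k L γ φ) ψ
      = ∫ u in Set.Ioc 0 L, (∫ t in Set.Ioc 0 L, G (‖γ t - γ u‖ ^ 2) * ψ t) * f u := by
    rw [hD.boundaryPairing_eq, ← e3]
    simp only [hD.singleLayer_eq hfs, hfdef]
  have p4 : secondTangentialDeriv L γ (singleLayer k L γ φ) ψ
      = ∫ u in Set.Ioc 0 L, (∫ t in Set.Ioc 0 L, G (‖γ t - γ u‖ ^ 2) * deriv (deriv ψ) t)
          * f u := by
    rw [secondTangentialDeriv, hD.boundaryPairing_eq, ← e4]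
    simp only [hD.singleLayer_eq hfs, hfdef]
  have p5 : ∫ u in Set.Ioc 0 L, (∫ t in Set.Ioc 0 L,
        regularPart k G G₁ γ (deriv γ) n τ ψ 0 t u) * f u
      = (∫ u in Set.Ioc 0 L, (∫ t in Set.Ioc 0 L,
          radialHess G₁ G₂ (γ t - γ u) (n t) (n t - n u) * ψ t) * f u)
        + (∫ u in Set.Ioc 0 L, (∫ t in Set.Ioc 0 L, radialGrad G₁ (γ t - γ u) (n t)
          * (τ t * ψ t)) * f u)
        + (∫ u in Set.Ioc 0 L, (∫ t in Set.Ioc 0 L, G (‖γ t - γ u‖ ^ 2) * deriv (deriv ψ) t)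
          * f u)
        + (k : ℂ) ^ 2 * ∫ u in Set.Ioc 0 L, (∫ t in Set.Ioc 0 L, G (‖γ t - γ u‖ ^ 2) * ψ t)
          * f u := by
    have i2 := iH.add iB
    have i3 := i2.add iS2
    rw [← integral_const_mul, ← integral_add' iH iB, ← integral_add' i2 iS2,
      ← integral_add' i3 (iS.const_mul _)]
    refine integral_congr_ae (Eventually.of_forall fun u => ?_)
    simp only [integral_regularPart_zero hG hF hT hψ u, Pi.add_apply]
    ring
  rw [p0, p1, p2, p3, p4, p5]
  ring

end IsC2Domain

end

theorem proposition4p2 (D : Set Plane) (L : ℝ) (γ : ℝ → Plane) (hD : IsC2Domain D L γ)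
    (k : ℝ) (hk : 0 ≤ k) :
    ∃ K₁ : (Plane → ℂ) → (Plane → ℂ), ∀ φ : Plane → ℂ, MemBoundaryL2 L γ φ →
      -- all terms of the expansion are in `L²(∂D)`
      MemBoundaryL2 L γ (neumannPoincare k D L γ φ) ∧
      MemBoundaryL2 L γ (K₁ φ) ∧
      (∀ᶠ ε in 𝓝[>] (0 : ℝ), MemBoundaryL2 L γ fun x =>
        coatedNeumannPoincare k D L γ ε (transportDensity D ε φ) (offsetMap D ε x)) ∧
      -- the expansion, with remainder `o(ε)` in `L²(∂D)`
      Tendsto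
        (fun ε : ℝ => boundaryL2Norm L γ (fun x =>
            coatedNeumannPoincare k D L γ ε (transportDensity D ε φ) (offsetMap D ε x) -
              (neumannPoincare k D L γ φ x + (ε : ℂ) * K₁ φ x)) / ENNReal.ofReal ε)
        (𝓝[>] 0) (𝓝 0) ∧
      -- the formula for `K₁ φ`, as an identity of distributions on `∂D`
      ∃ dD : (ℝ → ℂ) → ℂ, IsNormalDeriv D L γ (doubleLayer k D L γ φ) dD ∧
        ∀ ψ : ℝ → ℂ, IsBoundaryTest L ψ →
          boundaryPairing L γ (K₁ φ) ψ =
            boundaryPairing L γ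
              (neumannPoincare k D L γ fun y => (signedCurvature D γ y : ℂ) * φ y) ψ
            - boundaryPairing L γ
              (fun x => (signedCurvature D γ x : ℂ) * neumannPoincare k D L γ φ x) ψ
            + dD ψ
            - secondTangentialDeriv L γ (singleLayer k L γ φ) ψ
            - (k : ℂ) ^ 2 * boundaryPairing L γ (singleLayer k L γ φ) ψ := by
  obtain ⟨G, G₁, G₂, hG, hfs⟩ := exists_isRadialSolution hk
  have hF := hD.isArcFrame_outwardNormal
  obtain ⟨K, δ, hT⟩ := hF.exists_tube
  obtain ⟨C, hB⟩ := hG.exists_radialBound K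
  have h00 : |(0 : ℝ)| ≤ δ := by simpa using hT.pos.le
  have hsmall : ∀ᶠ ε in 𝓝[>] (0 : ℝ), 0 < ε ∧ ε < δ := by
    filter_upwards [Ioo_mem_nhdsGT hT.pos] with s hs using hs
  refine ⟨firstOrderOperator G₁ G₂ D L γ, fun φ hφ => ?_⟩
  have hf := hφ.integrable
  have e0 : ∀ t, neumannPoincare k D L γ φ (γ t)
      = ∫ u in Set.Ioc 0 L, coatedKernel G₁ γ (fun t => outwardNormal D (γ t))
        (fun t => signedCurvature D γ (γ t)) 0 t u * φ (γ u) := fun t => by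
    simp [hD.neumannPoincare_eq hG hfs, coatedKernel]
  have e1 : ∀ t, firstOrderOperator G₁ G₂ D L γ φ (γ t)
      = ∫ u in Set.Ioc 0 L, coatedKernelDeriv G₁ G₂ γ (fun t => outwardNormal D (γ t))
        (fun t => signedCurvature D γ (γ t)) 0 t u * φ (γ u) := fun t => by
    simp [firstOrderOperator, coatedKernelDeriv]
  refine ⟨?_, ?_, ?_, ?_, _, fun ψ hψ =>
    hD.tendsto_boundaryPairing_fderiv_doubleLayer hG hfs hT hφ hψ,
    fun ψ hψ => hD.boundaryPairing_firstOrderOperator hG hfs hT hφ hψ⟩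
  · simp only [MemBoundaryL2, e0]
    exact memLp_integral_kernel (measurable_coatedKernel hG hF 0)
      (norm_coatedKernel_le hF hT hB h00) hf
  · simp only [MemBoundaryL2, e1]
    exact memLp_integral_kernel (measurable_coatedKernelDeriv hG hF 0)
      (norm_coatedKernelDeriv_le hF hT hB h00) hf
  · filter_upwards [hsmall] with ε ⟨h0, h1⟩
    simp only [MemBoundaryL2, hD.coatedNeumannPoincare_eq hG hfs hT h0 h1]
    exact memLp_integral_kernel (measurable_coatedKernel hG hF ε)
      (norm_coatedKernel_le hF hT hB (by rw [abs_of_pos h0]; exact h1.le)) hf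
  · refine (tendsto_coatedKernel_expansion hG hF hT hf).congr' ?_
    filter_upwards [hsmall] with ε ⟨h0, h1⟩
    simp only [boundaryL2Norm, e0, e1, hD.coatedNeumannPoincare_eq hG hfs hT h0 h1]
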